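/- Conventions. For a finite alphabet $\Sigma$, $\Sigma^\omega$ carries the product of the discrete topologies, and for a language $L\subseteq\Sigma^{<\omega}$ of finite words its $\omega$-power is $L^\infty:=\{w_0w_1w_2\ldots\in\Sigma^\omega \mid \forall i\in\omega\ \ w_i\in L\}$. $\mathbf{\Sigma}^0_1$ and $\mathbf{\Pi}^0_1$ are the classes of open and of closed sets, $\mathbf{\Sigma}^0_{n+1}$ (resp. $\mathbf{\Pi}^0_{n+1}$) is the class of countable unions of $\mathbf{\Pi}^0_n$ sets (resp. countable intersections of $\mathbf{\Sigma}^0_n$ sets). For such a class $\mathbf{\Gamma}$, a set $C\subseteq\Sigma^\omega$ is $\mathbf{\Gamma}$-complete if $C\in\mathbf{\Gamma}(\Sigma^\omega)$ and, for every finite alphabet $Y$ and every $A\subseteq Y^\omega$ in $\mathbf{\Gamma}(Y^\omega)$, there is a continuous $f:Y^\omega\to\Sigma^\omega$ with $A=f^{-1}(C)$. A one-counter automaton is a (nondeterministic, $\lambda$-transitions allowed) pushdown automaton over a finite input alphabet, accepting by final state, whose stack alphabet is $\{Z_0,z\}$, where the start symbol $Z_0$ always remains at, and occurs only at, the bottom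 of the stack. Theorem. Let $n\geq 1$ be a natural number. (a) There is a language $P_n$ of finite words over a finite alphabet which is accepted by a one-counter automaton and such that $P_n^\infty$ is $\mathbf{\Pi}^0_n$-complete. (b) There is a language $S_n$ of finite words over a finite alphabet which is accepted by a one-counter automaton and such that $S_n^\infty$ is $\mathbf{\Sigma}^0_n$-complete. Moreover, such automata can be constructed effectively from $n$: there are computable functions which assign to each $n\geq 1$ (a finite description of) a one-counter automaton accepting such a language $P_n$, respectively $S_n$. -/

import Mathlib

namespace OmegaPower

universe u v w

/-! ### Pushdown automata and one-counter automata -/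

/-- A pushdown automaton `(Q, Σ, Γ, q₀, Z₀, δ, F)`, where `none : Option S` stands for the empty
word `λ` (a transition that reads nothing). Finiteness of `Q`, `Σ`, `Γ` is carried by type-class
binders. The last two fields say that the start symbol `Z₀` is the bottom symbol and always remains
at the bottom of the stack (and appears nowhere else in it). Stacks are written with the top symbol
first. -/
structure PDA (Q : Type u) (S : Type v) (G : Type w) [Finite Q] [Finite S] [Finite G] where
  /-- the initial state -/
  start : Q
  /-- the bottom symbol -/
  bottom : G
  /-- the transition map, into the finite subsets of `Q × Γ^*` -/
  δ : Q → Option S → G → Set (Q × List G)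
  δ_finite : ∀ q a Z, (δ q a Z).Finite
  /-- the final states -/
  final : Set Q
  bottom_stays : ∀ q a p β, (p, β) ∈ δ q a bottom → ∃ β', bottom ∉ β' ∧ β = β' ++ [bottom]
  bottom_only_at_bottom : ∀ q a Z p β, Z ≠ bottom → (p, β) ∈ δ q a Z → bottom ∉ β

namespace PDA

variable {Q : Type u} {S : Type v} {G : Type w} [Finite Q] [Finite S] [Finite G]

/-- One step `a : (q, Zγ) ↦ (p, βγ)` between configurations, for `(p, β) ∈ δ(q, a, Z)`. -/
def Step (A : PDA Q S G) (c : Q × List G) (a : Option S) (c' : Q × List G) : Prop :=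
  ∃ (q : Q) (Z : G) (γ : List G) (p : Q) (β : List G),
    c = (q, Z :: γ) ∧ (p, β) ∈ A.δ q a Z ∧ c' = (p, β ++ γ)

/-- `A.Run c w c'`: there is a run of `A` on the word `w` from configuration `c` to `c'`. -/
inductive Run (A : PDA Q S G) : Q × List G → List S → Q × List G → Prop
  | nil (c : Q × List G) : Run A c [] c
  | cons (c c' c'' : Q × List G) (a : Option S) (w : List S) :
      A.Step c a c' → Run A c' w c'' → Run A c (a.toList ++ w) c''

/-- The language accepted by `A` (by final state). -/
def language (A : PDA Q S G) : Language S :=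
  {w | ∃ p γ, p ∈ A.final ∧ A.Run (A.start, [A.bottom]) w (p, γ)}

/-- A one-counter automaton is a pushdown automaton whose stack alphabet consists of the bottom
symbol and exactly one further symbol. -/
def IsOneCounter (_A : PDA Q S G) : Prop := Nat.card G = 2

end PDA

/-! ### Finite descriptions of one-counter automata

To speak of algorithms that output one-counter automata, such automata are presented by finite
data, over which Mathlib's `Computable` makes sense. -/

/-- A transition `(q, a, z, p, k)`: in state `q`, reading `a` (`none` is `λ`), with top stack symbol
`Z₀` if `z = false` and the counter symbol if `z = true`, go to state `p` and replace the top
symbol by `k` counter symbols (followed by `Z₀` if `z = false`). -/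
abbrev TransitionCode : Type := ℕ × Option ℕ × Bool × ℕ × ℕ

/-- `(s, m, T, F)`: states `0, …, s` with initial state `0`, alphabet `{0, …, m - 1}`, transition
list `T`, final states `F`. Transitions and final states outside these ranges have no effect. -/
abbrev OneCounterCode : Type := ℕ × ℕ × List TransitionCode × List ℕ

namespace OneCounterCode

/-- the number of states is `c.maxState + 1` -/
def maxState (c : OneCounterCode) : ℕ := c.1

/-- the number of letters of the input alphabet -/
def alphabetSize (c : OneCounterCode) : ℕ := c.2.1

/-- the list of transitions -/
def transitions (c : OneCounterCode) : List TransitionCode := c.2.2.1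

/-- the list of final states -/
def finals (c : OneCounterCode) : List ℕ := c.2.2.2

/-- The word that replaces the top symbol `Z` (`false` is `Z₀`, `true` is the counter symbol). -/
def pushWord (Z : Bool) (k : ℕ) : List Bool :=
  List.replicate k true ++ if Z = true then [] else [false]

/-- The one-counter automaton described by a code; its stack alphabet is `Bool`, with bottom symbol
`false` and counter symbol `true`. -/
def automaton (c : OneCounterCode) :
    PDA (Fin (c.maxState + 1)) (Fin c.alphabetSize) Bool where
  start := 0
  bottom := false
  δ q a Z := {x | ∃ k : ℕ,
    ((q : ℕ), a.map Fin.val, Z, (x.1 : ℕ), k) ∈ c.transitions ∧ x.2 = pushWord Z k}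
  δ_finite q a Z := by
    have h : (⋃ t ∈ {t | t ∈ c.transitions}, {x : Fin (c.maxState + 1) × List Bool |
        x.2 = pushWord Z t.2.2.2.2}).Finite := by
      refine Set.Finite.biUnion (List.finite_toSet _) fun t _ => ?_
      refine (Set.finite_range fun p : Fin (c.maxState + 1) =>
        (p, pushWord Z t.2.2.2.2)).subset ?_
      rintro ⟨p, β⟩ hx
      exact ⟨p, by simpa [eq_comm] using hx⟩
    refine h.subset ?_
    rintro x ⟨k, hk, hx⟩
    exact Set.mem_biUnion (x := ((q : ℕ), a.map Fin.val, Z, (x.1 : ℕ), k)) hk hx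
  final := {q | (q : ℕ) ∈ c.finals}
  bottom_stays q a p β := by
    rintro ⟨k, _, h⟩
    exact ⟨List.replicate k true, by simp, by simpa [pushWord] using h⟩
  bottom_only_at_bottom q a Z p β hZ := by
    rintro ⟨k, _, h⟩
    obtain rfl : Z = true := by simpa using hZ
    have h' : β = pushWord true k := h
    simp [h', pushWord]

end OneCounterCode

/-! ### Omega-powers -/

/-- The infinite word `σ` is the concatenation `w₀w₁w₂…`: each finite product `w₀…w_{k-1}` is the
prefix of `σ` of its length, and the lengths of these products are unbounded (so that `w₀w₁w₂…`
is an infinite word). -/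
def IsInfiniteConcat {S : Type u} (w : ℕ → List S) (σ : ℕ → S) : Prop :=
  (∀ k, ((List.range k).map w).flatten =
    (List.range ((List.range k).map w).flatten.length).map σ) ∧
  ∀ N, ∃ k, N ≤ ((List.range k).map w).flatten.length

/-- The omega-power `L^∞ = {w₀w₁… ∈ Σ^ω | ∀ i, wᵢ ∈ L}`. -/
def omegaPower {S : Type u} (L : Language S) : Set (ℕ → S) :=
  {σ | ∃ w : ℕ → List S, (∀ i, w i ∈ L) ∧ IsInfiniteConcat w σ}

/-! ### Borel classes of finite rank and completeness -/

/-- The pair `(𝚺⁰ₙ(X), 𝚷⁰ₙ(X))`; the index `0` is not used and gets empty classes. -/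
def borelClasses (X : Type u) [TopologicalSpace X] : ℕ → Set (Set X) × Set (Set X)
  | 0 => (∅, ∅)
  | 1 => ({A | IsOpen A}, {A | IsClosed A})
  | n + 2 =>
    ({A | ∃ B : ℕ → Set X, (∀ i, B i ∈ (borelClasses X (n + 1)).2) ∧ A = ⋃ i, B i},
     {A | ∃ B : ℕ → Set X, (∀ i, B i ∈ (borelClasses X (n + 1)).1) ∧ A = ⋂ i, B i})

/-- `𝚺⁰ₙ(X)` -/
def Sigma0 (n : ℕ) (X : Type u) [TopologicalSpace X] : Set (Set X) := (borelClasses X n).1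

/-- `𝚷⁰ₙ(X)` -/
def Pi0 (n : ℕ) (X : Type u) [TopologicalSpace X] : Set (Set X) := (borelClasses X n).2

/-- `A ⊆ Y^ω` is Wadge reducible to `C ⊆ Σ^ω`. -/
def WadgeReducible {X Y : Type} [TopologicalSpace X] [TopologicalSpace Y]
    (A : Set Y) (C : Set X) : Prop :=
  ∃ f : Y → X, Continuous f ∧ A = f ⁻¹' C

/-- `C ⊆ Σ^ω` is `𝚪`-complete: it is in `𝚪`, and for each finite alphabet `Y` each subset of `Y^ω`
in `𝚪` is Wadge reducible to `C`. Alphabets are discrete and `Y^ω` has the product topology. -/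
def IsComplete (Γ : ∀ (X : Type) [TopologicalSpace X], Set (Set X))
    {S : Type} [TopologicalSpace S] (C : Set (ℕ → S)) : Prop :=
  C ∈ Γ (ℕ → S) ∧
  ∀ (Y : Type) [Finite Y] [TopologicalSpace Y] [DiscreteTopology Y] (A : Set (ℕ → Y)),
    A ∈ Γ (ℕ → Y) → WadgeReducible A C

end OmegaPower

/-! The Borel level is raised one step at a time by an operation `L ↦ histLang L` on languages that
preserves acceptance with one counter. An infinite word over the new alphabet is read as the history
of a stack of letters: each block lists the stack at one moment, and from one block to the next some
items are popped and one item is pushed. If every position of the stack stabilises, the part above a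
root item has a limit word, and a valid history is to be accepted exactly when this limit exists and
lies in `omegaPower L`. Taking the limit is a map of the first Baire class on a Π⁰₃ subset of the
valid histories, so membership climbs by one level and no more (`histLang_mem_Pi0`,
`histLang_mem_Sigma0`). Conversely, a set of the next level is the preimage of a complete set under
a pointwise limit of continuous maps (`exists_characteristic`, `exists_limit`), and a stack that
follows the approximations converges to that limit (`followBlock_converges`); this gives hardness
(`reduce_histLang`).

The point is to express this by an omega-power and with a single counter. Two devices do it. First,
every item carries a label in unary, fresh at each push, and the header of a block repeats the label
of the item pushed just before. A word of `edgeLang L` runs from a header with label `h` to a later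
stack that contains an item labelled `h`, with a word of `L` above it. Equality of the labels is
tested with the counter, which is then zero and free for a run of the automaton for `L`. As labels
are not reused, the item has never been popped in between, so a factorization of the history into
such words spells a factorization of the limit into words of `L` (`StackSeq.path_iff`). Second,
validity is not verified but its failure is accepted: all words with a local error are put into the
language (`mem_omegaPower_free`), and a nondeterministic one-counter automaton can guess an error,
which is a wrong pair of letters, a wrong label or a disagreement between successive stacks
(`rel_bad`). These words contribute only an open set.

The recursion starts at Π⁰₂ with the words that contain a given letter infinitely often, and at Σ⁰₃
with the words in which some number, written in unary, occurs infinitely often. The additive side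
cannot start lower, since the Π⁰₃ domain of convergence is absorbed only from Σ⁰₄ on; the remaining
low levels have languages of their own. All automata are built from small fragments by primitive
recursive combinators, hence so are the maps from `n` to the codes. -/

namespace OmegaPower

/-! ### Fragments of one-counter automata -/

/-- A fragment `(N, T)` of a one-counter automaton: states `0, …, N - 1`, entry `0`, exit `1`. -/
abbrev Frag : Type := ℕ × List TransitionCode

namespace Frag

/-- Runs between (state, counter) configurations. -/
inductive Run (T : List TransitionCode) : ℕ → ℕ → List ℕ → ℕ → ℕ → Prop
  | nil (q c : ℕ) : Run T q c [] q c
  | cons {q c : ℕ} {a : Option ℕ} {p k : ℕ} {w : List ℕ} {r c' : ℕ} :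
      (q, a, decide (0 < c), p, k) ∈ T → Run T p (c - 1 + k) w r c' →
      Run T q c (a.toList ++ w) r c'

theorem Run.mono {T T' : List TransitionCode} (f : ℕ → ℕ)
    (h : ∀ q a z p k, (q, a, z, p, k) ∈ T → (f q, a, z, f p, k) ∈ T')
    {q c : ℕ} {w : List ℕ} {r c' : ℕ} (hr : Run T q c w r c') :
    Run T' (f q) c w (f r) c' := by
  induction hr with
  | nil q c => exact .nil _ _
  | cons h1 _ ih => exact .cons (h _ _ _ _ _ h1) ih

theorem Run.trans {T : List TransitionCode} {q c : ℕ} {u : List ℕ} {r c' : ℕ} {v : List ℕ}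
    {s c'' : ℕ} (h1 : Run T q c u r c') (h2 : Run T r c' v s c'') :
    Run T q c (u ++ v) s c'' := by
  induction h1 with
  | nil q c => simpa using h2
  | cons h _ ih => rw [List.append_assoc]; exact .cons h (ih h2)

/-- The relation computed by a fragment. -/
def Sem (F : Frag) (c : ℕ) (w : List ℕ) (c' : ℕ) : Prop := Run F.2 0 c w 1 c'

/-- All states of the transitions are below the bound. -/
def WF (F : Frag) : Prop := 2 ≤ F.1 ∧ ∀ t ∈ F.2, t.1 < F.1 ∧ t.2.2.2.1 < F.1

/-- Renaming of states. -/
def shift (d : ℕ) (T : List TransitionCode) : List TransitionCode :=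
  T.map fun t => (t.1 + d, t.2.1, t.2.2.1, t.2.2.2.1 + d, t.2.2.2.2)

/-- Silent transitions from `p` to `q`. -/
def eps (p q : ℕ) : List TransitionCode := [(p, none, false, q, 0), (p, none, true, q, 1)]

theorem mem_shift {d : ℕ} {T : List TransitionCode} {q a z p k} :
    (q, a, z, p, k) ∈ shift d T ↔ ∃ q' p', (q', a, z, p', k) ∈ T ∧ q = q' + d ∧ p = p' + d := by
  simp only [shift, List.mem_map, Prod.mk.injEq, Prod.exists]
  constructor
  · rintro ⟨q', a', z', p', k', h, rfl, rfl, rfl, rfl, rfl⟩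
    exact ⟨_, _, h, rfl, rfl⟩
  · rintro ⟨q', p', h, rfl, rfl⟩
    exact ⟨_, _, _, _, _, h, rfl, rfl, rfl, rfl, rfl⟩

theorem mem_eps {s t q : ℕ} {a : Option ℕ} {z : Bool} {p k : ℕ} :
    (q, a, z, p, k) ∈ eps s t ↔ q = s ∧ p = t ∧ a = none ∧ k = z.toNat := by
  cases z <;> simp [eps] <;> tauto

/-- A silent move pops the top symbol and pushes it back. At `c = 0` the truncated subtraction is
right because the bottom symbol is not counted. -/
theorem counter_eps (c : ℕ) : c - 1 + (decide (0 < c)).toNat = c := by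
  rcases Nat.eq_zero_or_pos c with rfl | h
  · rfl
  · simp [h]; omega

theorem Run.eps {T : List TransitionCode} {s t : ℕ} (h : ∀ x ∈ Frag.eps s t, x ∈ T) {c : ℕ}
    {w : List ℕ} {r c' : ℕ} (hr : Run T t c w r c') : Run T s c w r c' := by
  have := Run.cons (a := none) (q := s) (c := c) (p := t) (k := (decide (0 < c)).toNat) (w := w)
    (T := T) (r := r) (c' := c') (h _ (mem_eps.2 ⟨rfl, rfl, rfl, rfl⟩))
    (by rwa [counter_eps])
  simpa using this

/-! #### Combinators -/

/-- One transition out of a list of `(letter, top symbol, pushed counter symbols)`. -/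
def prim (l : List (Option ℕ × Bool × ℕ)) : Frag :=
  (2, l.map fun x => (0, x.1, x.2.1, 1, x.2.2))

/-- Sequential composition. -/
def seq (F G : Frag) : Frag :=
  (2 + F.1 + G.1, shift 2 F.2 ++ (shift (2 + F.1) G.2 ++
    (eps 0 2 ++ (eps 3 (2 + F.1) ++ eps (3 + F.1) 1))))

/-- Choice. -/
def union (F G : Frag) : Frag :=
  (2 + F.1 + G.1, shift 2 F.2 ++ (shift (2 + F.1) G.2 ++
    (eps 0 2 ++ (eps 0 (2 + F.1) ++ (eps 3 1 ++ eps (3 + F.1) 1)))))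

/-- Iteration. -/
def star (F : Frag) : Frag :=
  (2 + F.1, shift 2 F.2 ++ (eps 0 2 ++ (eps 3 0 ++ eps 0 1)))

/-- Letters are shifted by `3`, and the letter `1` may be read anywhere without effect. -/
def subst (F : Frag) : Frag :=
  (F.1, (F.2.map fun t => (t.1, t.2.1.map (· + 3), t.2.2.1, t.2.2.2.1, t.2.2.2.2)) ++
    (List.range F.1).flatMap fun q => [(q, some 1, false, q, 0), (q, some 1, true, q, 1)])

theorem wf_prim (l) : (prim l).WF := by
  refine ⟨le_rfl, ?_⟩
  simp only [prim, List.mem_map]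
  rintro t ⟨x, _, rfl⟩
  simp

theorem wf_seq {F G : Frag} (hF : F.WF) (hG : G.WF) : (seq F G).WF := by
  have h1 := hF.1; have h2 := hG.1
  refine ⟨by simp only [seq]; omega, ?_⟩
  rintro ⟨q, a, z, p, k⟩ ht
  simp only [seq, List.mem_append, mem_shift, mem_eps] at ht ⊢
  rcases ht with ⟨q', p', h, rfl, rfl⟩ | ⟨q', p', h, rfl, rfl⟩ | h | h | h
  · have := hF.2 _ h; simp only at this; omega
  · have := hG.2 _ h; simp only at this; omega
  all_goals omega

theorem wf_union {F G : Frag} (hF : F.WF) (hG : G.WF) : (union F G).WF := by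
  have h1 := hF.1; have h2 := hG.1
  refine ⟨by simp only [union]; omega, ?_⟩
  rintro ⟨q, a, z, p, k⟩ ht
  simp only [union, List.mem_append, mem_shift, mem_eps] at ht ⊢
  rcases ht with ⟨q', p', h, rfl, rfl⟩ | ⟨q', p', h, rfl, rfl⟩ | h | h | h | h
  · have := hF.2 _ h; simp only at this; omega
  · have := hG.2 _ h; simp only at this; omega
  all_goals omega

theorem wf_star {F : Frag} (hF : F.WF) : (star F).WF := by
  have h1 := hF.1
  refine ⟨by simp only [star]; omega, ?_⟩
  rintro ⟨q, a, z, p, k⟩ ht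
  simp only [star, List.mem_append, mem_shift, mem_eps] at ht ⊢
  rcases ht with ⟨q', p', h, rfl, rfl⟩ | h | h | h
  · have := hF.2 _ h; simp only at this; omega
  all_goals omega

theorem wf_subst {F : Frag} (hF : F.WF) : (subst F).WF := by
  refine ⟨hF.1, ?_⟩
  rintro ⟨q, a, z, p, k⟩ ht
  simp only [subst, List.mem_append, List.mem_map, List.mem_flatMap, List.mem_range] at ht ⊢
  rcases ht with ⟨t, h, he⟩ | ⟨q', h, he⟩
  · have := hF.2 _ h
    simp only [Prod.mk.injEq] at he
    omega
  · simp only [List.mem_cons, Prod.mk.injEq, List.not_mem_nil, or_false] at he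
    omega

theorem sem_prim {l c w c'} : (prim l).Sem c w c' ↔
    ∃ a k, (a, decide (0 < c), k) ∈ l ∧ w = a.toList ∧ c' = c - 1 + k := by
  constructor
  · intro h
    unfold Sem at h
    cases h with
    | cons h1 h2 =>
      simp only [prim, List.mem_map, Prod.mk.injEq, Prod.exists] at h1
      obtain ⟨a', z', k', h1, _, rfl, rfl, rfl, rfl⟩ := h1
      cases h2 with
      | nil => exact ⟨_, _, h1, by simp, rfl⟩
      | cons h3 _ => simp [prim] at h3
  · rintro ⟨a, k, h, rfl, rfl⟩
    have := Run.cons (T := (prim l).2) (q := 0) (c := c) (a := a) (p := 1) (k := k) (w := [])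
      (by simp only [prim, List.mem_map]; exact ⟨_, h, rfl⟩) (.nil _ _)
    simpa [Sem] using this

/-- A run leaves the copy of `F` only through its exit, and nothing leads back from the copy of `G`,
so the word splits at the unique passage. -/
theorem sem_seq {F G : Frag} (hF : F.WF) {c w c''} : (seq F G).Sem c w c'' ↔
    ∃ u v c', w = u ++ v ∧ F.Sem c u c' ∧ G.Sem c' v c'' := by
  constructor
  · intro h
    have h2 := hF.1
    -- One invariant for each region of states: the fresh entry `0`, the copy of `F`, the copy of
    -- `G`, the fresh exit `1`. The bound on the states of `F` keeps the two copies apart.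
    have key : ∀ {q c w r c''}, Run (seq F G).2 q c w r c'' → r = 1 →
        (q = 0 → ∃ u v c', w = u ++ v ∧ F.Sem c u c' ∧ G.Sem c' v c'') ∧
        (∀ q0, q0 < F.1 → q = q0 + 2 →
          ∃ u v c', w = u ++ v ∧ Run F.2 q0 c u 1 c' ∧ G.Sem c' v c'') ∧
        (∀ q0, q = q0 + (2 + F.1) → Run G.2 q0 c w 1 c'') ∧
        (q = 1 → w = [] ∧ c = c'') := by
      intro q c w r c'' h
      induction h with
      | nil q c =>
        rintro rfl
        refine ⟨by simp, by simp, ?_, by simp⟩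
        intro q0 h0; omega
      | @cons q c a p k w r c' ht hr ih =>
        intro hr1
        obtain ⟨i0, iF, iG, i1⟩ := ih hr1
        subst hr1
        simp only [seq, List.mem_append, mem_shift, mem_eps] at ht
        rcases ht with ⟨q', p', h, rfl, rfl⟩ | ⟨q', p', h, rfl, rfl⟩ |
          ⟨rfl, rfl, rfl, rfl⟩ | ⟨rfl, rfl, rfl, rfl⟩ | ⟨rfl, rfl, rfl, rfl⟩
        · have hb := hF.2 _ h
          simp only at hb
          refine ⟨by omega, ?_, by omega, by omega⟩
          intro q0 _ hq
          obtain rfl : q' = q0 := by omega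
          obtain ⟨u, v, d, rfl, hu, hv⟩ := iF p' hb.2 rfl
          exact ⟨_, v, d, by rw [List.append_assoc], .cons h hu, hv⟩
        · refine ⟨by omega, by omega, ?_, by omega⟩
          intro q0 hq
          obtain rfl : q' = q0 := by omega
          exact .cons h (iG p' rfl)
        all_goals rw [counter_eps] at i0 iF iG i1
        · refine ⟨?_, by omega, by omega, by omega⟩
          intro _
          exact iF 0 (by omega) rfl
        · refine ⟨by omega, ?_, by omega, by omega⟩
          intro q0 _ hq
          obtain rfl : q0 = 1 := by omega
          exact ⟨[], w, c, by simp, .nil _ _, iG 0 (by omega)⟩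
        · refine ⟨by omega, by omega, ?_, by omega⟩
          intro q0 hq
          obtain rfl : q0 = 1 := by omega
          obtain ⟨rfl, rfl⟩ := i1 rfl
          simpa using Run.nil _ _
    exact (key h rfl).1 rfl
  · rintro ⟨u, v, d, rfl, hu, hv⟩
    have hu' := hu.mono (T' := (seq F G).2) (· + 2) (fun q a z p k h => by
      simp only [seq, List.mem_append, mem_shift]; exact .inl ⟨_, _, h, rfl, rfl⟩)
    have hv' := hv.mono (T' := (seq F G).2) (· + (2 + F.1)) (fun q a z p k h => by
      simp only [seq, List.mem_append, mem_shift]; exact .inr (.inl ⟨_, _, h, rfl, rfl⟩))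
    refine Run.eps (t := 2) (fun x hx => by simp [seq, hx]) ?_
    refine Run.trans (by simpa using hu') (Run.eps (t := 2 + F.1) (fun x hx => by simp [seq,
      hx]) ?_)
    have h1 : Run (seq F G).2 (3 + F.1) c'' [] 1 c'' :=
      Run.eps (t := 1) (fun x hx => by simp [seq, hx]) (.nil _ _)
    rw [← List.append_nil v]
    exact Run.trans (by simpa using hv') (by convert h1 using 1; omega)

theorem sem_union {F G : Frag} (hF : F.WF) {c w c''} : (union F G).Sem c w c'' ↔
    F.Sem c w c'' ∨ G.Sem c w c'' := by
  constructor
  · intro h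
    have h2 := hF.1
    have key : ∀ {q c w r c''}, Run (union F G).2 q c w r c'' → r = 1 →
        (q = 0 → F.Sem c w c'' ∨ G.Sem c w c'') ∧
        (∀ q0, q0 < F.1 → q = q0 + 2 → Run F.2 q0 c w 1 c'') ∧
        (∀ q0, q = q0 + (2 + F.1) → Run G.2 q0 c w 1 c'') ∧
        (q = 1 → w = [] ∧ c = c'') := by
      intro q c w r c'' h
      induction h with
      | nil q c =>
        rintro rfl
        refine ⟨by simp, by simp, ?_, by simp⟩
        intro q0 h0; omega
      | @cons q c a p k w r c' ht hr ih =>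
        intro hr1
        obtain ⟨i0, iF, iG, i1⟩ := ih hr1
        subst hr1
        simp only [union, List.mem_append, mem_shift, mem_eps] at ht
        rcases ht with ⟨q', p', h, rfl, rfl⟩ | ⟨q', p', h, rfl, rfl⟩ |
          ⟨rfl, rfl, rfl, rfl⟩ | ⟨rfl, rfl, rfl, rfl⟩ | ⟨rfl, rfl, rfl, rfl⟩ | ⟨rfl, rfl, rfl, rfl⟩
        · have hb := hF.2 _ h
          simp only at hb
          refine ⟨by omega, ?_, by omega, by omega⟩
          intro q0 _ hq
          obtain rfl : q' = q0 := by omega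
          exact .cons h (iF p' hb.2 rfl)
        · refine ⟨by omega, by omega, ?_, by omega⟩
          intro q0 hq
          obtain rfl : q' = q0 := by omega
          exact .cons h (iG p' rfl)
        all_goals rw [counter_eps] at i0 iF iG i1
        · refine ⟨?_, by omega, by omega, by omega⟩
          intro _
          exact .inl (iF 0 (by omega) rfl)
        · refine ⟨?_, by omega, by omega, by omega⟩
          intro _
          exact .inr (iG 0 (by omega))
        · refine ⟨by omega, ?_, by omega, by omega⟩
          intro q0 _ hq
          obtain rfl : q0 = 1 := by omega
          obtain ⟨rfl, rfl⟩ := i1 rfl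
          simpa using Run.nil _ _
        · refine ⟨by omega, by omega, ?_, by omega⟩
          intro q0 hq
          obtain rfl : q0 = 1 := by omega
          obtain ⟨rfl, rfl⟩ := i1 rfl
          simpa using Run.nil _ _
    exact (key h rfl).1 rfl
  · rintro (hu | hv)
    · have hu' := hu.mono (T' := (union F G).2) (· + 2) (fun q a z p k h => by
        simp only [union, List.mem_append, mem_shift]; exact .inl ⟨_, _, h, rfl, rfl⟩)
      refine Run.eps (t := 2) (fun x hx => by simp [union, hx]) ?_
      have h1 : Run (union F G).2 3 c'' [] 1 c'' :=
        Run.eps (t := 1) (fun x hx => by simp [union, hx]) (.nil _ _)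
      simpa using Run.trans (by simpa using hu') h1
    · have hv' := hv.mono (T' := (union F G).2) (· + (2 + F.1)) (fun q a z p k h => by
        simp only [union, List.mem_append, mem_shift]; exact .inr (.inl ⟨_, _, h, rfl, rfl⟩))
      refine Run.eps (t := 2 + F.1) (fun x hx => by simp [union, hx]) ?_
      have h1 : Run (union F G).2 (3 + F.1) c'' [] 1 c'' :=
        Run.eps (t := 1) (fun x hx => by simp [union, hx]) (.nil _ _)
      rw [← List.append_nil w]
      exact Run.trans (by simpa using hv') (by convert h1 using 1; omega)

/-- Iterated composition of a word relation. -/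
inductive StarRel {S : Type*} (R : ℕ → List S → ℕ → Prop) : ℕ → List S → ℕ → Prop
  | nil (c : ℕ) : StarRel R c [] c
  | cons {c u c' v c''} : R c u c' → StarRel R c' v c'' → StarRel R c (u ++ v) c''

/-- Each pass through the copy of `F` returns to the fresh entry `0`, which is not a state of the
copy; loops through the entry of `F` itself are therefore not mistaken for passes. -/
theorem sem_star {F : Frag} (hF : F.WF) {c w c''} : (star F).Sem c w c'' ↔
    StarRel F.Sem c w c'' := by
  constructor
  · intro h
    have h2 := hF.1
    have key : ∀ {q c w r c''}, Run (star F).2 q c w r c'' → r = 1 →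
        (q = 0 → StarRel F.Sem c w c'') ∧
        (∀ q0, q0 < F.1 → q = q0 + 2 →
          ∃ u v c', w = u ++ v ∧ Run F.2 q0 c u 1 c' ∧ StarRel F.Sem c' v c'') ∧
        (q = 1 → w = [] ∧ c = c'') := by
      intro q c w r c'' h
      induction h with
      | nil q c =>
        rintro rfl
        exact ⟨by simp, by simp, by simp⟩
      | @cons q c a p k w r c' ht hr ih =>
        intro hr1
        obtain ⟨i0, iF, i1⟩ := ih hr1
        subst hr1
        simp only [star, List.mem_append, mem_shift, mem_eps] at ht
        rcases ht with ⟨q', p', h, rfl, rfl⟩ | ⟨rfl, rfl, rfl, rfl⟩ | ⟨rfl, rfl, rfl, rfl⟩ |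
          ⟨rfl, rfl, rfl, rfl⟩
        · have hb := hF.2 _ h
          simp only at hb
          refine ⟨by omega, ?_, by omega⟩
          intro q0 _ hq
          obtain rfl : q' = q0 := by omega
          obtain ⟨u, v, d, rfl, hu, hv⟩ := iF p' hb.2 rfl
          exact ⟨_, v, d, by rw [List.append_assoc], .cons h hu, hv⟩
        all_goals rw [counter_eps] at i0 iF i1
        · refine ⟨?_, by omega, by omega⟩
          intro _
          obtain ⟨u, v, d, rfl, hu, hv⟩ := iF 0 (by omega) rfl
          change StarRel F.Sem c (u ++ v) _
          exact .cons hu hv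
        · refine ⟨by omega, ?_, by omega⟩
          intro q0 _ hq
          obtain rfl : q0 = 1 := by omega
          exact ⟨[], w, c, by simp, .nil _ _, i0 rfl⟩
        · refine ⟨?_, by omega, by omega⟩
          intro _
          obtain ⟨rfl, rfl⟩ := i1 rfl
          exact .nil _
    exact (key h rfl).1 rfl
  · intro h
    unfold Sem
    induction h with
    | nil c => exact Run.eps (t := 1) (fun x hx => by simp [star, hx]) (.nil _ _)
    | cons hu _ ih =>
      have hu' := hu.mono (T' := (star F).2) (· + 2) (fun q a z p k h => by
        simp only [star, List.mem_append, mem_shift]; exact .inl ⟨_, _, h, rfl, rfl⟩)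
      refine Run.eps (t := 2) (fun x hx => by simp [star, hx]) ?_
      exact Run.trans (by simpa using hu') (Run.eps (t := 0) (fun x hx => by simp [star, hx]) ih)

theorem run_tick {F : Frag} {q c : ℕ} (hq : q < F.1) {w r c'} (h : Run (subst F).2 q c w r c') :
    Run (subst F).2 q c (1 :: w) r c' := by
  refine Run.cons (a := some 1) (p := q) (k := (decide (0 < c)).toNat) ?_
    (by rwa [counter_eps])
  simp only [subst, List.mem_append, List.mem_flatMap, List.mem_range]
  refine .inr ⟨q, hq, ?_⟩
  rcases Nat.eq_zero_or_pos c with rfl | h0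
  · simp
  · simp [h0]

theorem run_subst {F : Frag} (hF : F.WF) {q c w r c'} (hq : q < F.1) :
    Run (subst F).2 q c w r c' ↔
      (∀ x ∈ w, x = 1 ∨ 3 ≤ x) ∧ Run F.2 q c ((w.filter (3 ≤ ·)).map (· - 3)) r c' := by
  constructor
  · intro h
    induction h with
    | nil q c => exact ⟨by simp, by simpa using Run.nil _ _⟩
    | @cons q c a p k w r c' ht hr ih =>
      simp only [subst, List.mem_append, List.mem_flatMap, List.mem_range, List.mem_map] at ht
      rcases ht with ⟨⟨q', a', z', p', k'⟩, ht, he⟩ | ⟨q', hq', ht⟩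
      · simp only [Prod.mk.injEq] at he
        obtain ⟨rfl, rfl, rfl, rfl, rfl⟩ := he
        obtain ⟨i1, i2⟩ := ih (hF.2 _ ht).2
        refine ⟨?_, ?_⟩
        · intro x hx
          rcases List.mem_append.1 hx with hx | hx
          · cases a' <;> simp at hx; omega
          · exact i1 x hx
        · have := Run.cons ht i2
          cases a' <;> simpa using this
      · have hqq : q = q' ∧ p = q ∧ a = some 1 ∧ k = (decide (0 < c)).toNat := by
          simp only [List.mem_cons, Prod.mk.injEq, List.not_mem_nil, or_false] at ht
          rcases ht with ⟨h1, h2, h3, h4, h5⟩ | ⟨h1, h2, h3, h4, h5⟩ <;>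
            exact ⟨h1, by omega, h2, by rw [h3, h5]; rfl⟩
        obtain ⟨rfl, rfl, rfl, rfl⟩ := hqq
        obtain ⟨i1, i2⟩ := ih hq
        rw [counter_eps] at i2
        exact ⟨by simpa using i1, by simpa using i2⟩
  · rintro ⟨h1, h2⟩
    -- The ticks removed by the filter are put back as loops, either before the next letter is read
    -- or at the end of the run.
    generalize hv : (w.filter (3 ≤ ·)).map (· - 3) = v at h2
    induction h2 generalizing w with
    | nil q c =>
      induction w with
      | nil => exact .nil _ _
      | cons x w ih =>
        simp only [List.mem_cons, forall_eq_or_imp] at h1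
        have hx : x = 1 := by
          rcases h1.1 with h | h
          · exact h
          · simp [h] at hv
        subst hx
        exact run_tick hq (ih h1.2 (by simpa using hv))
    | @cons q c a p k v r c' ht hr ih =>
      have hp := (hF.2 _ ht).2
      have ht' : (q, a.map (· + 3), decide (0 < c), p, k) ∈ (subst F).2 := by
        simp only [subst, List.mem_append, List.mem_map]
        exact .inl ⟨_, ht, rfl⟩
      cases a with
      | none => simpa using Run.cons ht' (ih hp h1 (by simpa using hv))
      | some a =>
        clear hr
        induction w with
        | nil => simp at hv
        | cons x w ihw =>
          simp only [List.mem_cons, forall_eq_or_imp] at h1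
          by_cases hx : 3 ≤ x
          · simp only [hx, decide_true, List.filter_cons_of_pos, List.map_cons, Option.toList_some,
              List.singleton_append, List.cons.injEq] at hv
            obtain ⟨rfl, hv⟩ := hv
            have hxx : x - 3 + 3 = x := by omega
            have := Run.cons ht' (ih hp h1.2 hv)
            simpa [hxx] using this
          · obtain rfl : x = 1 := by omega
            exact run_tick hq (ihw h1.2 (by simpa using hv))

theorem sem_subst {F : Frag} (hF : F.WF) {c w c'} : (subst F).Sem c w c' ↔
    (∀ x ∈ w, x = 1 ∨ 3 ≤ x) ∧ F.Sem c ((w.filter (3 ≤ ·)).map (· - 3)) c' :=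
  run_subst hF (by have := hF.1; omega)

/-! #### Computability -/

theorem primrec_shift : Primrec₂ shift := by
  refine Primrec.list_map Primrec.snd ?_
  have t : Primrec (fun x : (ℕ × List TransitionCode) × TransitionCode => x.2) := Primrec.snd
  have d : Primrec (fun x : (ℕ × List TransitionCode) × TransitionCode => x.1.1) :=
    Primrec.fst.comp Primrec.fst
  have t2 := Primrec.snd.comp t
  have t3 := Primrec.snd.comp t2
  have t4 := Primrec.snd.comp t3
  exact (Primrec.nat_add.comp (Primrec.fst.comp t) d).pair ((Primrec.fst.comp t2).pair
    ((Primrec.fst.comp t3).pair ((Primrec.nat_add.comp (Primrec.fst.comp t4) d).pair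
      (Primrec.snd.comp t4))))

theorem primrec_eps : Primrec₂ eps := by
  have c : ∀ {β : Type} [Primcodable β] (b : β), Primrec (fun _ : ℕ × ℕ => b) :=
    fun b => Primrec.const b
  refine Primrec.list_cons.comp ?_ (Primrec.list_cons.comp ?_ (Primrec.const []))
  · exact Primrec.fst.pair ((c none).pair ((c false).pair (Primrec.snd.pair (c 0))))
  · exact Primrec.fst.pair ((c none).pair ((c true).pair (Primrec.snd.pair (c 1))))

section
variable {α : Type} [Primcodable α]

theorem primrec_prim {f : α → List (Option ℕ × Bool × ℕ)} (hf : Primrec f) :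
    Primrec fun x => prim (f x) := by
  refine (Primrec.const 2).pair (Primrec.list_map hf ?_)
  have t : Primrec (fun x : α × (Option ℕ × Bool × ℕ) => x.2) := Primrec.snd
  have t2 := Primrec.snd.comp t
  exact (Primrec.const 0).pair ((Primrec.fst.comp t).pair ((Primrec.fst.comp t2).pair
    ((Primrec.const 1).pair (Primrec.snd.comp t2))))

theorem primrec_seq {f g : α → Frag} (hf : Primrec f) (hg : Primrec g) :
    Primrec fun x => seq (f x) (g x) := by
  have f1 := Primrec.fst.comp hf
  have f2 := Primrec.snd.comp hf
  have g1 := Primrec.fst.comp hg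
  have g2 := Primrec.snd.comp hg
  have k : ∀ n : ℕ, Primrec (fun _ : α => n) := fun n => Primrec.const n
  have d2 := Primrec.nat_add.comp (k 2) f1
  have d3 := Primrec.nat_add.comp (k 3) f1
  refine (Primrec.nat_add.comp d2 g1).pair ?_
  refine Primrec.list_append.comp (primrec_shift.comp (k 2) f2) ?_
  refine Primrec.list_append.comp (primrec_shift.comp d2 g2) ?_
  refine Primrec.list_append.comp (primrec_eps.comp (k 0) (k 2)) ?_
  exact Primrec.list_append.comp (primrec_eps.comp (k 3) d2) (primrec_eps.comp d3 (k 1))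

theorem primrec_union {f g : α → Frag} (hf : Primrec f) (hg : Primrec g) :
    Primrec fun x => union (f x) (g x) := by
  have f1 := Primrec.fst.comp hf
  have f2 := Primrec.snd.comp hf
  have g1 := Primrec.fst.comp hg
  have g2 := Primrec.snd.comp hg
  have k : ∀ n : ℕ, Primrec (fun _ : α => n) := fun n => Primrec.const n
  have d2 := Primrec.nat_add.comp (k 2) f1
  have d3 := Primrec.nat_add.comp (k 3) f1
  refine (Primrec.nat_add.comp d2 g1).pair ?_
  refine Primrec.list_append.comp (primrec_shift.comp (k 2) f2) ?_
  refine Primrec.list_append.comp (primrec_shift.comp d2 g2) ?_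
  refine Primrec.list_append.comp (primrec_eps.comp (k 0) (k 2)) ?_
  refine Primrec.list_append.comp (primrec_eps.comp (k 0) d2) ?_
  exact Primrec.list_append.comp (primrec_eps.comp (k 3) (k 1)) (primrec_eps.comp d3 (k 1))

theorem primrec_star {f : α → Frag} (hf : Primrec f) : Primrec fun x => star (f x) := by
  have f1 := Primrec.fst.comp hf
  have f2 := Primrec.snd.comp hf
  have k : ∀ n : ℕ, Primrec (fun _ : α => n) := fun n => Primrec.const n
  refine (Primrec.nat_add.comp (k 2) f1).pair ?_
  refine Primrec.list_append.comp (primrec_shift.comp (k 2) f2) ?_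
  refine Primrec.list_append.comp (primrec_eps.comp (k 0) (k 2)) ?_
  exact Primrec.list_append.comp (primrec_eps.comp (k 3) (k 0)) (primrec_eps.comp (k 0) (k 1))

theorem primrec_subst {f : α → Frag} (hf : Primrec f) : Primrec fun x => subst (f x) := by
  have f1 := Primrec.fst.comp hf
  have f2 := Primrec.snd.comp hf
  refine f1.pair (Primrec.list_append.comp (Primrec.list_map f2 ?_)
    (Primrec.list_flatMap (Primrec.list_range.comp f1) ?_))
  · have t : Primrec (fun x : α × TransitionCode => x.2) := Primrec.snd
    have t2 := Primrec.snd.comp t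
    have t3 := Primrec.snd.comp t2
    refine (Primrec.fst.comp t).pair (Primrec.pair ?_ t3)
    refine Primrec.option_map (Primrec.fst.comp t2) ?_
    exact Primrec.nat_add.comp Primrec.snd (Primrec.const 3)
  · have q : Primrec (fun x : α × ℕ => x.2) := Primrec.snd
    have c : ∀ {β : Type} [Primcodable β] (b : β), Primrec (fun _ : α × ℕ => b) :=
      fun b => Primrec.const b
    refine Primrec.list_cons.comp ?_ (Primrec.list_cons.comp ?_ (Primrec.const []))
    · exact q.pair ((c (some 1)).pair ((c false).pair (q.pair (c 0))))
    · exact q.pair ((c (some 1)).pair ((c true).pair (q.pair (c 1))))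

end

/-! #### The automaton of a fragment -/

/-- The one-counter code of a fragment over an alphabet of `m` letters. -/
def toCode (x : ℕ × Frag) : OneCounterCode := (x.2.1 - 1, x.1, x.2.2, [1])

theorem primrec_toCode : Primrec toCode := by
  have h2 : Primrec (fun x : ℕ × Frag => x.2) := Primrec.snd
  refine (Primrec.nat_sub.comp (Primrec.fst.comp h2) (Primrec.const 1)).pair
    (Primrec.fst.pair ((Primrec.snd.comp h2).pair (Primrec.const [1])))

/-- The stack with `c` counter symbols. -/
def stack (c : ℕ) : List Bool := List.replicate c true ++ [false]

theorem stack_cons (c : ℕ) : stack c = decide (0 < c) :: (if 0 < c then stack (c - 1) else []) := by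
  cases c <;> simp [stack, List.replicate_succ]

theorem pushWord_append (c k : ℕ) : OneCounterCode.pushWord (decide (0 < c)) k ++
    (if 0 < c then stack (c - 1) else []) = stack (c - 1 + k) := by
  cases c with
  | zero => simp [stack, OneCounterCode.pushWord]
  | succ c =>
    simp only [OneCounterCode.pushWord, stack, Nat.add_sub_cancel, Nat.succ_pos, decide_true,
      if_true, List.append_nil]
    rw [← List.append_assoc, ← List.replicate_add, add_comm]

/-- From the initial stack only stacks of the form `stack c` are reachable, so configurations of the
automaton amount to pairs of a state and a counter value. -/
theorem language_toCode {m : ℕ} {F : Frag} (hF : F.WF) :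
    (toCode (m, F)).automaton.language =
      {w : List (Fin m) | ∃ c', F.Sem 0 (w.map Fin.val) c'} := by
  -- A code records the largest state instead of the number of states.
  have hN : F.1 - 1 + 1 = F.1 := by have := hF.1; omega
  set A := (toCode (m, F)).automaton with hA
  have fwd : ∀ {x w y}, A.Run x w y → ∀ c, x.2 = stack c →
      ∃ c', y.2 = stack c' ∧ Run F.2 x.1.val c (w.map Fin.val) y.1.val c' := by
    intro x w y h
    induction h with
    | nil x => intro c hc; exact ⟨c, hc, .nil _ _⟩
    | cons x x' x'' a w hs _ ih =>
      intro c hc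
      obtain ⟨q, Z, γ, p, β, rfl, ⟨k, hk, hβ⟩, rfl⟩ := hs
      simp only at hβ hk
      simp only [stack_cons c, List.cons.injEq] at hc
      obtain ⟨rfl, rfl⟩ := hc
      obtain ⟨c', h1, h2⟩ := ih (c - 1 + k) (by simp only; rw [hβ, pushWord_append])
      refine ⟨c', h1, ?_⟩
      have := Run.cons (a := a.map Fin.val) hk h2
      have he : (a.toList ++ w).map Fin.val = (a.map Fin.val).toList ++ w.map Fin.val := by
        cases a <;> simp
      rw [he]
      exact this
  have bwd : ∀ {q c v r c'}, Run F.2 q c v r c' → ∀ (hq : q < F.1 - 1 + 1) (w : List (Fin m)),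
      w.map Fin.val = v → ∃ hr : r < F.1 - 1 + 1,
        A.Run (⟨q, hq⟩, stack c) w (⟨r, hr⟩, stack c') := by
    intro q c v r c' h
    induction h with
    | nil q c =>
      intro hq w hw
      obtain rfl : w = [] := by simpa using hw
      exact ⟨hq, .nil _⟩
    | @cons q c a p k v r c' ht hr ih =>
      intro hq w hw
      have hp : p < F.1 - 1 + 1 := by rw [hN]; exact (hF.2 _ ht).2
      obtain ⟨w1, w2, rfl, h1, h2⟩ := List.map_eq_append_iff.1 hw
      obtain ⟨a', ha1, ha2⟩ : ∃ a' : Option (Fin m), a'.toList = w1 ∧ a'.map Fin.val = a := by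
        cases a with
        | none => exact ⟨none, by simpa using h1.symm, rfl⟩
        | some a =>
          obtain ⟨b, rfl, hb⟩ := by simpa [List.map_eq_cons_iff] using h1
          exact ⟨some b, rfl, by simpa using h1⟩
      obtain ⟨hr', hrun⟩ := ih hp w2 h2
      refine ⟨hr', ?_⟩
      rw [← ha1]
      refine PDA.Run.cons _ (⟨p, hp⟩, stack (c - 1 + k)) _ _ _ ?_ hrun
      refine ⟨⟨q, hq⟩, decide (0 < c), (if 0 < c then stack (c - 1) else []), ⟨p, hp⟩,
        OneCounterCode.pushWord (decide (0 < c)) k, by rw [← stack_cons], ⟨k, ?_, rfl⟩,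
        by rw [pushWord_append]⟩
      subst ha2
      exact ht
  ext w
  constructor
  · rintro ⟨p, γ, hp, hr⟩
    obtain ⟨c', _, h⟩ := fwd hr 0 rfl
    have hp' : (p : ℕ) = 1 := by simpa using (show (p : ℕ) ∈ [1] from hp)
    refine ⟨c', ?_⟩
    simp only [hp'] at h
    exact h
  · rintro ⟨c', h⟩
    obtain ⟨hr, h'⟩ := bwd h (by omega) w rfl
    exact ⟨_, _, List.mem_singleton.2 rfl, h'⟩

end Frag

end OmegaPower

/-! ### Elementary fragments that read letters and move or test the counter. -/

namespace OmegaPower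

namespace Frag

attribute [simp] wf_prim wf_seq wf_union wf_star wf_subst

/-- The word relation of a fragment over a coded alphabet. -/
def rel {S : Type*} (code : S → ℕ) (F : Frag) (c : ℕ) (w : List S) (c' : ℕ) : Prop :=
  F.Sem c (w.map code) c'

/-- Read a letter without changing the counter. -/
def keep (l : List ℕ) : Frag :=
  prim (l.flatMap fun a => [(some a, false, 0), (some a, true, 1)])

/-- Read a letter and increase the counter. -/
def push (l : List ℕ) : Frag :=
  prim (l.flatMap fun a => [(some a, false, 1), (some a, true, 2)])

/-- Read a letter and decrease the counter. -/
def pop (l : List ℕ) : Frag := prim (l.map fun a => (some a, true, 0))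

/-- Test for zero. -/
def zero : Frag := prim [(none, false, 0)]

/-- Test for being positive. -/
def pos : Frag := prim [(none, true, 1)]

/-- Choice out of a list. -/
def unions (l : List Frag) : Frag := l.foldr union (prim [])

@[simp] theorem wf_keep (l) : (keep l).WF := wf_prim _
@[simp] theorem wf_push (l) : (push l).WF := wf_prim _
@[simp] theorem wf_pop (l) : (pop l).WF := wf_prim _
@[simp] theorem wf_zero : zero.WF := wf_prim _
@[simp] theorem wf_pos : pos.WF := wf_prim _

@[simp] theorem wf_unions {l : List Frag} (h : ∀ F ∈ l, F.WF) : (unions l).WF := by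
  induction l with
  | nil => exact wf_prim _
  | cons F l ih =>
    simp only [List.mem_cons, forall_eq_or_imp] at h
    exact wf_union h.1 (ih h.2)

section
variable {S : Type*} {code : S → ℕ} {c c' : ℕ} {w : List S}

theorem rel_seq {F G : Frag} (hF : F.WF) : rel code (seq F G) c w c' ↔
    ∃ u v d, w = u ++ v ∧ rel code F c u d ∧ rel code G d v c' := by
  rw [rel, sem_seq hF]
  constructor
  · rintro ⟨u, v, d, h, hu, hv⟩
    obtain ⟨u', v', rfl, rfl, rfl⟩ := List.map_eq_append_iff.1 h
    exact ⟨u', v', d, rfl, hu, hv⟩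
  · rintro ⟨u, v, d, rfl, hu, hv⟩
    exact ⟨_, _, d, List.map_append, hu, hv⟩

theorem rel_union {F G : Frag} (hF : F.WF) : rel code (union F G) c w c' ↔
    rel code F c w c' ∨ rel code G c w c' := sem_union hF

theorem rel_unions {l : List Frag} (h : ∀ F ∈ l, F.WF) : rel code (unions l) c w c' ↔
    ∃ F ∈ l, rel code F c w c' := by
  induction l with
  | nil => simp [unions, rel, sem_prim]
  | cons F l ih =>
    simp only [List.mem_cons, forall_eq_or_imp] at h
    change rel code (union F (unions l)) c w c' ↔ _
    rw [rel_union h.1, ih h.2]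
    simp

theorem rel_unions_nil : rel code (unions []) c w c' ↔ False := by
  simp [unions, rel, sem_prim]

theorem rel_unions_cons {F : Frag} {l : List Frag} (hF : F.WF) :
    rel code (unions (F :: l)) c w c' ↔ rel code F c w c' ∨ rel code (unions l) c w c' :=
  rel_union hF

theorem rel_star {F : Frag} (hF : F.WF) : rel code (star F) c w c' ↔
    StarRel (rel code F) c w c' := by
  rw [rel, sem_star hF]
  constructor
  · intro h
    generalize hv : w.map code = v at h
    induction h generalizing w with
    | nil c =>
      obtain rfl : w = [] := by simpa using hv
      exact .nil _
    | cons hu _ ih =>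
      obtain ⟨u', v', rfl, rfl, rfl⟩ := List.map_eq_append_iff.1 hv
      exact .cons hu (ih rfl)
  · intro h
    induction h with
    | nil c => exact .nil _
    | cons hu _ ih => rw [List.map_append]; exact .cons hu ih

theorem map_code_eq_singleton {a : ℕ} : w.map code = [a] ↔ ∃ x, code x = a ∧ w = [x] := by
  constructor
  · intro h
    obtain ⟨x, rfl⟩ := List.length_eq_one_iff.1 (by simpa using congrArg List.length h)
    exact ⟨x, by simpa using h, rfl⟩
  · rintro ⟨x, rfl, rfl⟩; rfl

theorem rel_keep {l : List ℕ} : rel code (keep l) c w c' ↔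
    ∃ x, code x ∈ l ∧ w = [x] ∧ c' = c := by
  rw [rel, keep, sem_prim]
  simp only [List.mem_flatMap, List.mem_cons, Prod.mk.injEq, List.not_mem_nil, or_false]
  constructor
  · rintro ⟨a, k, ⟨b, hb, h⟩, hw, rfl⟩
    have ha : a = some b := by tauto
    subst ha
    obtain ⟨x, rfl, rfl⟩ := map_code_eq_singleton.1 hw
    refine ⟨x, hb, rfl, ?_⟩
    rcases h with ⟨_, h, rfl⟩ | ⟨_, h, rfl⟩ <;> simp at h <;> omega
  · rintro ⟨x, hx, rfl, rfl⟩
    rcases Nat.eq_zero_or_pos c' with rfl | h0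
    · exact ⟨some (code x), 0, ⟨_, hx, by simp⟩, by simp, rfl⟩
    · exact ⟨some (code x), 1, ⟨_, hx, by simp [h0]⟩, by simp, by omega⟩

theorem rel_push {l : List ℕ} : rel code (push l) c w c' ↔
    ∃ x, code x ∈ l ∧ w = [x] ∧ c' = c + 1 := by
  rw [rel, push, sem_prim]
  simp only [List.mem_flatMap, List.mem_cons, Prod.mk.injEq, List.not_mem_nil, or_false]
  constructor
  · rintro ⟨a, k, ⟨b, hb, h⟩, hw, rfl⟩
    have ha : a = some b := by tauto
    subst ha
    obtain ⟨x, rfl, rfl⟩ := map_code_eq_singleton.1 hw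
    refine ⟨x, hb, rfl, ?_⟩
    rcases h with ⟨_, h, rfl⟩ | ⟨_, h, rfl⟩ <;> simp at h <;> omega
  · rintro ⟨x, hx, rfl, rfl⟩
    rcases Nat.eq_zero_or_pos c with rfl | h0
    · exact ⟨some (code x), 1, ⟨_, hx, by simp⟩, by simp, rfl⟩
    · exact ⟨some (code x), 2, ⟨_, hx, by simp [h0]⟩, by simp, by omega⟩

theorem rel_pop {l : List ℕ} : rel code (pop l) c w c' ↔
    ∃ x, code x ∈ l ∧ w = [x] ∧ c = c' + 1 := by
  rw [rel, pop, sem_prim]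
  simp only [List.mem_map, Prod.mk.injEq]
  constructor
  · rintro ⟨a, k, ⟨b, hb, rfl, h, rfl⟩, hw, rfl⟩
    obtain ⟨x, rfl, rfl⟩ := map_code_eq_singleton.1 hw
    refine ⟨x, hb, rfl, ?_⟩
    simp at h
    omega
  · rintro ⟨x, hx, rfl, rfl⟩
    exact ⟨some (code x), 0, ⟨_, hx, by simp⟩, by simp, rfl⟩

theorem rel_zero : rel code zero c w c' ↔ w = [] ∧ c = 0 ∧ c' = 0 := by
  rw [rel, zero, sem_prim]
  simp only [List.mem_singleton, Prod.mk.injEq]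
  constructor
  · rintro ⟨a, k, ⟨rfl, h, rfl⟩, hw, rfl⟩
    simp at h hw
    exact ⟨hw, h, by omega⟩
  · rintro ⟨rfl, rfl, rfl⟩
    exact ⟨none, 0, by simp⟩

theorem rel_pos : rel code pos c w c' ↔ w = [] ∧ 0 < c ∧ c' = c := by
  rw [rel, pos, sem_prim]
  simp only [List.mem_singleton, Prod.mk.injEq]
  constructor
  · rintro ⟨a, k, ⟨rfl, h, rfl⟩, hw, rfl⟩
    simp at h hw
    exact ⟨hw, h, by omega⟩
  · rintro ⟨rfl, h, rfl⟩
    exact ⟨none, 1, by simp [h], by simp, by omega⟩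

theorem rel_star_keep {l : List ℕ} : rel code (star (keep l)) c w c' ↔
    (∀ x ∈ w, code x ∈ l) ∧ c' = c := by
  rw [rel_star (wf_keep _)]
  constructor
  · intro h
    induction h with
    | nil => simp
    | cons h _ ih =>
      obtain ⟨x, hx, rfl, rfl⟩ := rel_keep.1 h
      simpa [hx] using ih
  · rintro ⟨h, rfl⟩
    induction w with
    | nil => exact .nil _
    | cons x w ih =>
      simp only [List.mem_cons, forall_eq_or_imp] at h
      exact StarRel.cons (u := [x]) (rel_keep.2 ⟨x, h.1, rfl, rfl⟩) (ih h.2)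

theorem rel_star_push {l : List ℕ} : rel code (star (push l)) c w c' ↔
    (∀ x ∈ w, code x ∈ l) ∧ c' = c + w.length := by
  rw [rel_star (wf_push _)]
  constructor
  · intro h
    induction h with
    | nil => simp
    | cons h _ ih =>
      obtain ⟨x, hx, rfl, rfl⟩ := rel_push.1 h
      refine ⟨by simpa [hx] using ih.1, ?_⟩
      rw [ih.2]
      simp
      omega
  · rintro ⟨h, rfl⟩
    induction w generalizing c with
    | nil => exact .nil _
    | cons x w ih =>
      simp only [List.mem_cons, forall_eq_or_imp] at h
      refine StarRel.cons (u := [x]) (rel_push.2 ⟨x, h.1, rfl, rfl⟩) ?_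
      have := ih (c := c + 1) h.2
      rwa [List.length_cons, show c + (w.length + 1) = c + 1 + w.length by omega]

theorem rel_star_pop {l : List ℕ} : rel code (star (pop l)) c w c' ↔
    (∀ x ∈ w, code x ∈ l) ∧ c = c' + w.length := by
  rw [rel_star (wf_pop _)]
  constructor
  · intro h
    induction h with
    | nil => simp
    | cons h _ ih =>
      obtain ⟨x, hx, rfl, rfl⟩ := rel_pop.1 h
      refine ⟨by simpa [hx] using ih.1, ?_⟩
      rw [ih.2]
      simp
      omega
  · rintro ⟨h, rfl⟩
    induction w with
    | nil => exact .nil _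
    | cons x w ih =>
      simp only [List.mem_cons, forall_eq_or_imp] at h
      exact StarRel.cons (u := [x]) (rel_pop.2 ⟨x, h.1, rfl, by simp; omega⟩) (ih h.2)

end

section
variable {α : Type} [Primcodable α]

theorem primrec_keep {f : α → List ℕ} (hf : Primrec f) : Primrec fun x => keep (f x) := by
  refine primrec_prim (Primrec.list_flatMap hf ?_)
  have q : Primrec (fun x : α × ℕ => some x.2) := Primrec.option_some.comp Primrec.snd
  exact Primrec.list_cons.comp (q.pair (Primrec.const (false, 0)))
    (Primrec.list_cons.comp (q.pair (Primrec.const (true, 1))) (Primrec.const []))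

theorem primrec_push {f : α → List ℕ} (hf : Primrec f) : Primrec fun x => push (f x) := by
  refine primrec_prim (Primrec.list_flatMap hf ?_)
  have q : Primrec (fun x : α × ℕ => some x.2) := Primrec.option_some.comp Primrec.snd
  exact Primrec.list_cons.comp (q.pair (Primrec.const (false, 1)))
    (Primrec.list_cons.comp (q.pair (Primrec.const (true, 2))) (Primrec.const []))

theorem primrec_pop {f : α → List ℕ} (hf : Primrec f) : Primrec fun x => pop (f x) := by
  refine primrec_prim (Primrec.list_map hf ?_)
  exact (Primrec.option_some.comp Primrec.snd).pair (Primrec.const (true, 0))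

theorem primrec_unions {f : α → List Frag} (hf : Primrec f) : Primrec fun x => unions (f x) := by
  refine Primrec.list_foldr (h := fun _ y => union y.1 y.2) hf (Primrec.const (prim [])) ?_
  exact primrec_union (Primrec.fst.comp Primrec.snd) (Primrec.snd.comp Primrec.snd)

end

end Frag

end OmegaPower

/-! ### Infinite words, their factorizations and infinite products. -/

namespace OmegaPower

universe u

section Words
variable {S : Type u}

/-- The factor of length `n` of an infinite word at position `p`. -/
def seg (σ : ℕ → S) (p n : ℕ) : List S := (List.range n).map fun i => σ (p + i)

/-- The word `l` occurs in `σ` at position `p`. -/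
def At (σ : ℕ → S) (p : ℕ) (l : List S) : Prop := seg σ p l.length = l

@[simp] theorem length_seg (σ : ℕ → S) (p n : ℕ) : (seg σ p n).length = n := by simp [seg]

theorem getElem_seg (σ : ℕ → S) (p n i : ℕ) (h : i < (seg σ p n).length) :
    (seg σ p n)[i] = σ (p + i) := by simp [seg]

theorem seg_add (σ : ℕ → S) (p m n : ℕ) : seg σ p (m + n) = seg σ p m ++ seg σ (p + m) n := by
  simp [seg, List.range_add, Function.comp_def, add_assoc]

theorem seg_succ (σ : ℕ → S) (p n : ℕ) : seg σ p (n + 1) = σ p :: seg σ (p + 1) n := by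
  rw [add_comm, seg_add]; simp [seg]

theorem seg_one (σ : ℕ → S) (p : ℕ) : seg σ p 1 = [σ p] := by simp [seg]

theorem at_seg (σ : ℕ → S) (p n : ℕ) : At σ p (seg σ p n) := by simp [At]

@[simp] theorem at_nil (σ : ℕ → S) (p : ℕ) : At σ p [] := rfl

theorem at_append {σ : ℕ → S} {p : ℕ} {u v : List S} :
    At σ p (u ++ v) ↔ At σ p u ∧ At σ (p + u.length) v := by
  rw [At, List.length_append, seg_add, List.append_eq_append_iff_of_size_eq_left]
  · rfl
  · simp

theorem at_singleton {σ : ℕ → S} {p : ℕ} {x : S} : At σ p [x] ↔ σ p = x := by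
  simp [At, seg]

theorem at_cons {σ : ℕ → S} {p : ℕ} {x : S} {l : List S} :
    At σ p (x :: l) ↔ σ p = x ∧ At σ (p + 1) l := by
  simpa [at_singleton] using at_append (σ := σ) (p := p) (u := [x]) (v := l)

theorem at_iff_getElem {σ : ℕ → S} {p : ℕ} {l : List S} :
    At σ p l ↔ ∀ i (h : i < l.length), σ (p + i) = l[i] := by
  constructor
  · intro h i hi
    have h' : seg σ p l.length = l := h
    exact (getElem_seg σ p l.length i (by simpa using hi)).symm.trans (List.getElem_of_eq h' _)
  · intro h
    refine List.ext_getElem (by simp) fun i h1 h2 => ?_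
    rw [getElem_seg]
    exact h i h2

theorem at_seg_of_at {σ : ℕ → S} {p n q : ℕ} {l u v : List S} (h : seg σ p n = u ++ l ++ v)
    (hq : q = p + u.length) : At σ q l := by
  have := at_seg σ p n
  rw [h, at_append, at_append] at this
  rw [hq]
  exact this.1.2

/-- Cutting positions in place of a sequence of words. -/
theorem mem_omegaPower_iff {L : Language S} {σ : ℕ → S} : σ ∈ omegaPower L ↔
    ∃ f : ℕ → ℕ, f 0 = 0 ∧ StrictMono f ∧ ∀ k, seg σ (f k) (f (k + 1) - f k) ∈ L := by
  constructor
  · rintro ⟨w, hw, h1, h2⟩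
    set g : ℕ → ℕ := fun k => (((List.range k).map w).flatten).length with hg
    have g0 : g 0 = 0 := by simp [hg]
    have gs : ∀ k, g (k + 1) = g k + (w k).length := by
      intro k; simp [hg, List.range_succ]
    have gm : Monotone g := monotone_nat_of_le_succ fun k => by rw [gs]; omega
    have hseg : ∀ k, seg σ (g k) (w k).length = w k := by
      intro k
      have e := h1 (k + 1)
      have e1 : ((List.range (k + 1)).map w).flatten = ((List.range k).map w).flatten ++ w k := by
        simp [List.range_succ]
      have e2 : At σ 0 (((List.range (k + 1)).map w).flatten) := by
        have := e.symm
        simpa [At, seg] using this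
      rw [e1, at_append] at e2
      have := e2.2
      rwa [zero_add] at this
    have ex : ∀ n, ∃ m, g n < g m := by
      intro n
      obtain ⟨m, hm⟩ := h2 (g n + 1)
      exact ⟨m, hm⟩
    classical
    -- Some `w i` may be empty. `nx n` is the index of the first nonempty word from `n` on; cutting
    -- just after it makes the positions strictly increasing.
    let nx : ℕ → ℕ := fun n => Nat.find (ex n) - 1
    have nx_lt : ∀ n, g n < g (nx n + 1) := by
      intro n
      have h := Nat.find_spec (ex n)
      have h0 : Nat.find (ex n) ≠ 0 := by
        intro h0; rw [h0] at h; have := gm (Nat.zero_le n); omega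
      have : nx n + 1 = Nat.find (ex n) := by simp only [nx]; omega
      rwa [this]
    have nx_eq : ∀ n, g (nx n) = g n := by
      intro n
      have h := Nat.find_spec (ex n)
      have h0 : Nat.find (ex n) ≠ 0 := by
        intro h0; rw [h0] at h; have := gm (Nat.zero_le n); omega
      have h1 : ¬ g n < g (nx n) := Nat.find_min (ex n) (by simp only [nx]; omega)
      have h2 : n ≤ nx n := by
        by_contra hc
        have := gm (show nx n + 1 ≤ n by omega)
        have := nx_lt n
        omega
      have := gm h2
      omega
    let a : ℕ → ℕ := fun k => Nat.rec 0 (fun _ n => nx n + 1) k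
    have as : ∀ k, a (k + 1) = nx (a k) + 1 := fun k => rfl
    refine ⟨fun k => g (a k), g0, strictMono_nat_of_lt_succ fun k => ?_, fun k => ?_⟩
    · rw [as]; exact nx_lt _
    · have e : g (a (k + 1)) - g (a k) = (w (nx (a k))).length := by
        rw [as, gs, nx_eq]; omega
      simp only
      rw [e, ← nx_eq (a k), hseg]
      exact hw _
  · rintro ⟨f, f0, fm, hf⟩
    have key : ∀ k, ((List.range k).map fun k => seg σ (f k) (f (k + 1) - f k)).flatten =
        seg σ 0 (f k) := by
      intro k
      induction k with
      | zero => simp [f0, seg]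
      | succ k ih =>
        have h1 := fm (Nat.lt_succ_self k)
        have : f (k + 1) = f k + (f (k + 1) - f k) := by simp at h1; omega
        rw [List.range_succ, List.map_append, List.flatten_append, ih, this, seg_add]
        simp
    refine ⟨fun k => seg σ (f k) (f (k + 1) - f k), hf, fun k => ?_, fun N => ⟨N, ?_⟩⟩
    · rw [key]; simp [seg]
    · rw [key, length_seg]; exact fm.id_le N

/-- Suitable when a factorization is not given at once: it suffices to name the admissible cutting
positions and to find an admissible successor of each. -/
theorem mem_omegaPower_of_step {L : Language S} {σ : ℕ → S} (C : ℕ → Prop) (h0 : C 0)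
    (hs : ∀ p, C p → ∃ q, p < q ∧ C q ∧ seg σ p (q - p) ∈ L) : σ ∈ omegaPower L := by
  choose nx h1 h2 h3 using hs
  let a : ℕ → {p // C p} := fun k => Nat.rec ⟨0, h0⟩ (fun _ n => ⟨nx n.1 n.2, h2 _ _⟩) k
  exact mem_omegaPower_iff.2 ⟨fun k => (a k).1, rfl,
    strictMono_nat_of_lt_succ fun k => h1 _ (a k).2, fun k => h3 _ (a k).2⟩

theorem omegaPower_mono {L M : Language S} (h : ∀ w ∈ L, w ∈ M) {σ : ℕ → S}
    (hσ : σ ∈ omegaPower L) : σ ∈ omegaPower M := by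
  obtain ⟨w, hw, hc⟩ := hσ
  exact ⟨w, fun i => h _ (hw i), hc⟩

/-- Adding to `V` all words with a first letter outside `H` and all words with a bad factor has the
effect that all infinite words with such properties are accepted, and only these. -/
theorem mem_omegaPower_free {L V : Language S} {Bad : Set (List S)} {H : Set S}
    (hL : ∀ w, w ∈ L ↔ (∃ x l, w = x :: l ∧ x ∉ H) ∨ (∃ u b v, w = u ++ b ++ v ∧ b ∈ Bad) ∨ w ∈ V)
    (hH : ∀ x ∈ H, ∀ y ∈ H, [x, y] ∈ Bad)
    (hV : ∀ w ∈ V, ∃ u l, w = u ++ [l] ∧ ∀ x, x ∉ H → [l, x] ∈ Bad) {σ : ℕ → S} :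
    σ ∈ omegaPower L ↔ σ 0 ∉ H ∨ (∃ p, ∃ b ∈ Bad, At σ p b) ∨ σ ∈ omegaPower V := by
  constructor
  · intro h
    obtain ⟨f, f0, fm, hf⟩ := mem_omegaPower_iff.1 h
    by_cases h0 : σ 0 ∈ H
    swap
    · exact .inl h0
    by_cases hb : ∃ p, ∃ b ∈ Bad, At σ p b
    · exact .inr (.inl hb)
    refine .inr (.inr (mem_omegaPower_iff.2 ⟨f, f0, fm, fun k => ?_⟩))
    have hlt : ∀ k, f k < f (k + 1) := fun k => fm (Nat.lt_succ_self k)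
    -- In the absence of bad factors, a factor that begins in `H` can only come from `V`.
    have hv : ∀ k, σ (f k) ∈ H → seg σ (f k) (f (k + 1) - f k) ∈ V := by
      intro k hk
      rcases (hL _).1 (hf k) with ⟨x, l, he, hx⟩ | ⟨u, b, v, he, hbad⟩ | h
      · obtain ⟨d, hd⟩ : ∃ d, f (k + 1) - f k = d + 1 :=
          ⟨f (k + 1) - f k - 1, by have := hlt k; omega⟩
        rw [hd, seg_succ] at he
        obtain ⟨rfl, _⟩ := List.cons.inj he
        exact absurd hk hx
      · exact absurd ⟨_, b, hbad, at_seg_of_at he rfl⟩ hb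
      · exact h
    -- A word of `V` ends with a letter after which every letter outside `H` makes a bad pair, so
    -- the next factor begins in `H` again.
    have hk : ∀ k, σ (f k) ∈ H := by
      intro k
      induction k with
      | zero => rwa [f0]
      | succ k ih =>
        by_contra hc
        obtain ⟨u, l, he, hl⟩ := hV _ (hv k ih)
        refine hb ⟨f k + u.length, _, hl _ hc, ?_⟩
        have h1 := at_seg σ (f k) (f (k + 1) - f k)
        have h2 := congrArg List.length he
        rw [he, at_append, at_singleton] at h1
        simp at h2
        have := hlt k
        rw [at_cons, at_singleton]
        exact ⟨h1.2, by congr 1; omega⟩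
    exact hv k (hk k)
  -- The positions from which free factors can start: those of a letter outside `H`, and those after
  -- which all letters lie in `H`, where any two neighbours are a bad pair.
  · have ex : ∀ N, ∃ q, N ≤ q ∧ (σ q ∉ H ∨ ∀ n, q ≤ n → σ n ∈ H) := by
      intro N
      by_cases h : ∃ n, N ≤ n ∧ σ n ∉ H
      · obtain ⟨n, h1, h2⟩ := h
        exact ⟨n, h1, .inl h2⟩
      · push Not at h
        exact ⟨N, le_rfl, .inr h⟩
    have step : ∀ p, (σ p ∉ H ∨ ∀ n, p ≤ n → σ n ∈ H) → ∃ q, p < q ∧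
        (σ q ∉ H ∨ ∀ n, q ≤ n → σ n ∈ H) ∧ seg σ p (q - p) ∈ L := by
      intro p hp
      -- Two letters at least, so that a bad pair fits into the factor.
      obtain ⟨q, hq, hc⟩ := ex (p + 2)
      refine ⟨q, by omega, hc, (hL _).2 ?_⟩
      obtain ⟨d, hd⟩ : ∃ d, q - p = d + 1 + 1 := ⟨q - p - 2, by omega⟩
      rw [hd, seg_succ, seg_succ]
      rcases hp with hp | hp
      · exact .inl ⟨_, _, rfl, hp⟩
      · exact .inr (.inl ⟨[], _, seg σ (p + 1 + 1) d, rfl,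
          hH _ (hp p le_rfl) _ (hp (p + 1) (by omega))⟩)
    rintro (h | ⟨p, b, hb, hp⟩ | h)
    · exact mem_omegaPower_of_step (fun p => σ p ∉ H ∨ ∀ n, p ≤ n → σ n ∈ H) (.inl h) step
    · refine mem_omegaPower_of_step (fun p => p = 0 ∨ (σ p ∉ H ∨ ∀ n, p ≤ n → σ n ∈ H))
        (.inl rfl) ?_
      rintro p' (rfl | h)
      -- The first factor is long enough to contain the bad word; all later ones are free.
      · obtain ⟨q, hq, hc⟩ := ex (p + b.length + 1)
        refine ⟨q, by omega, .inr hc, (hL _).2 (.inr (.inl ⟨seg σ 0 p, b,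
          seg σ (p + b.length) (q - p - b.length), ?_, hb⟩))⟩
        rw [show q - 0 = p + (b.length + (q - p - b.length)) by omega, seg_add, seg_add, zero_add,
          show seg σ p b.length = b from hp, List.append_assoc]
      · obtain ⟨q, h1, h2, h3⟩ := step p' h
        exact ⟨q, h1, .inr h2, h3⟩
    · exact omegaPower_mono (fun w hw => (hL w).2 (.inr (.inr hw))) h

/-! ### Concatenation of infinitely many nonempty words -/

/-- The product of the first `k` words. -/
def cum (w : ℕ → List S) (k : ℕ) : List S := ((List.range k).map w).flatten

theorem cum_zero (w : ℕ → List S) : cum w 0 = [] := rfl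

theorem cum_succ (w : ℕ → List S) (k : ℕ) : cum w (k + 1) = cum w k ++ w k := by
  simp [cum, List.range_succ]

theorem cum_prefix (w : ℕ → List S) {k l : ℕ} (h : k ≤ l) : cum w k <+: cum w l := by
  induction l, h using Nat.le_induction with
  | base => exact List.prefix_rfl
  | succ l _ ih => rw [cum_succ]; exact ih.trans (List.prefix_append _ _)

theorem le_length_cum {w : ℕ → List S} (hw : ∀ k, w k ≠ []) (k : ℕ) : k ≤ (cum w k).length := by
  induction k with
  | zero => simp
  | succ k ih =>
    have := List.length_pos_iff.2 (hw k)
    rw [cum_succ, List.length_append]; omega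

/-- The infinite product of nonempty words. -/
def concat (w : ℕ → List S) (hw : ∀ k, w k ≠ []) (n : ℕ) : S :=
  (cum w (n + 1))[n]'(le_length_cum hw (n + 1))

theorem at_cum {w : ℕ → List S} (hw : ∀ k, w k ≠ []) (k : ℕ) : At (concat w hw) 0 (cum w k) := by
  rw [at_iff_getElem]
  intro i hi
  rw [zero_add, concat]
  rcases le_total k (i + 1) with h | h
  · exact ((cum_prefix w h).getElem hi).symm
  · exact (cum_prefix w h).getElem _

theorem at_concat {w : ℕ → List S} (hw : ∀ k, w k ≠ []) (k : ℕ) :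
    At (concat w hw) (cum w k).length (w k) := by
  have := at_cum hw (k + 1)
  rw [cum_succ, at_append] at this
  simpa using this.2

theorem concat_mem_omegaPower {L : Language S} {w : ℕ → List S} (hw : ∀ k, w k ≠ [])
    (h : ∀ k, w k ∈ L) : concat w hw ∈ omegaPower L := by
  refine ⟨w, h, fun k => ?_, fun N => ⟨N, le_length_cum hw N⟩⟩
  have := at_cum hw k
  simpa [At, seg, cum] using this.symm

/-- As no word is empty, letter `n` is determined by the first `n + 1` words, and these are locally
constant in the parameter. -/
theorem continuous_concat {X : Type*} [TopologicalSpace X] [TopologicalSpace S]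
    {w : X → ℕ → List S} (hw : ∀ x k, w x k ≠ [])
    (hc : ∀ k, IsLocallyConstant fun x => w x k) :
    Continuous fun x => concat (w x) (hw x) := by
  refine continuous_pi fun n => ?_
  have h : ∀ k, IsLocallyConstant fun x => cum (w x) k := by
    intro k
    induction k with
    | zero => exact IsLocallyConstant.const _
    | succ k ih =>
      simp only [cum_succ]
      exact ih.comp₂ (hc k) (· ++ ·)
  have h2 : IsLocallyConstant fun x => (cum (w x) (n + 1))[n]? := (h (n + 1)).comp (·[n]?)
  have h3 : IsLocallyConstant fun x => concat (w x) (hw x) n := by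
    rw [IsLocallyConstant.iff_eventually_eq] at h2 ⊢
    intro x
    filter_upwards [h2 x] with y hy
    have e : ∀ x, (cum (w x) (n + 1))[n]? = some (concat (w x) (hw x) n) := fun x =>
      List.getElem?_eq_getElem (le_length_cum (hw x) (n + 1))
    rw [e, e] at hy
    exact Option.some.inj hy
  exact h3.continuous

/-- Renaming of the letters. -/
theorem mem_omegaPower_map {T : Type*} {L : Language S} {M : Language T} (e : T ≃ S)
    (h : ∀ w, w ∈ M ↔ w.map e ∈ L) {σ : ℕ → T} :
    σ ∈ omegaPower M ↔ (fun n => e (σ n)) ∈ omegaPower L := by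
  rw [mem_omegaPower_iff, mem_omegaPower_iff]
  have : ∀ p n, (seg σ p n).map e = seg (fun n => e (σ n)) p n := by
    intro p n; simp [seg]
  simp only [h, this]

end Words

end OmegaPower

/-! ### The finite Borel hierarchy and limits of continuous maps. -/

namespace OmegaPower

universe u

section Borel
variable {X Z : Type u} [TopologicalSpace X] [TopologicalSpace Z]

theorem mem_Sigma0_one {A : Set X} : A ∈ Sigma0 1 X ↔ IsOpen A := Iff.rfl

theorem mem_Pi0_one {A : Set X} : A ∈ Pi0 1 X ↔ IsClosed A := Iff.rfl

theorem borel_compl_aux (n : ℕ) : ∀ A : Set X,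
    (A ∈ Sigma0 (n + 1) X → Aᶜ ∈ Pi0 (n + 1) X) ∧ (A ∈ Pi0 (n + 1) X → Aᶜ ∈ Sigma0 (n + 1) X) := by
  induction n with
  | zero =>
    intro A
    exact ⟨fun h => mem_Pi0_one.2 (mem_Sigma0_one.1 h).isClosed_compl,
      fun h => mem_Sigma0_one.2 (mem_Pi0_one.1 h).isOpen_compl⟩
  | succ n ih =>
    intro A
    constructor
    · rintro ⟨B, hB, rfl⟩
      exact ⟨fun i => (B i)ᶜ, fun i => (ih _).2 (hB i), Set.compl_iUnion _⟩
    · rintro ⟨B, hB, rfl⟩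
      exact ⟨fun i => (B i)ᶜ, fun i => (ih _).1 (hB i), Set.compl_iInter _⟩

theorem compl_mem_Pi0 {n : ℕ} {A : Set X} : Aᶜ ∈ Pi0 (n + 1) X ↔ A ∈ Sigma0 (n + 1) X :=
  ⟨fun h => by simpa using (borel_compl_aux n _).2 h, (borel_compl_aux n _).1⟩

theorem compl_mem_Sigma0 {n : ℕ} {A : Set X} : Aᶜ ∈ Sigma0 (n + 1) X ↔ A ∈ Pi0 (n + 1) X :=
  ⟨fun h => by simpa using (borel_compl_aux n _).1 h, (borel_compl_aux n _).2⟩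

theorem preimage_borel {f : X → Z} (hf : Continuous f) (n : ℕ) : ∀ A : Set Z,
    (A ∈ Sigma0 n Z → f ⁻¹' A ∈ Sigma0 n X) ∧ (A ∈ Pi0 n Z → f ⁻¹' A ∈ Pi0 n X) := by
  induction n with
  | zero => exact fun A => ⟨fun h => h.elim, fun h => h.elim⟩
  | succ n ih =>
    intro A
    cases n with
    | zero => exact ⟨fun h => IsOpen.preimage hf h, fun h => IsClosed.preimage hf h⟩
    | succ n =>
      constructor
      · rintro ⟨B, hB, rfl⟩
        exact ⟨fun i => f ⁻¹' (B i), fun i => (ih _).2 (hB i), Set.preimage_iUnion⟩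
      · rintro ⟨B, hB, rfl⟩
        exact ⟨fun i => f ⁻¹' (B i), fun i => (ih _).1 (hB i), Set.preimage_iInter⟩

theorem Sigma0_subset_Pi0_succ {n : ℕ} {A : Set X} (h : A ∈ Sigma0 (n + 1) X) :
    A ∈ Pi0 (n + 2) X := ⟨fun _ => A, fun _ => h, (Set.iInter_const A).symm⟩

theorem Pi0_subset_Sigma0_succ {n : ℕ} {A : Set X} (h : A ∈ Pi0 (n + 1) X) :
    A ∈ Sigma0 (n + 2) X := ⟨fun _ => A, fun _ => h, (Set.iUnion_const A).symm⟩

/-- The only topological input is that closed sets are Gδ sets; this starts the induction, and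
complementation transfers each level from Π to Σ. -/
theorem borel_succ_aux [PerfectlyNormalSpace X] (n : ℕ) : ∀ A : Set X,
    (A ∈ Sigma0 (n + 1) X → A ∈ Sigma0 (n + 2) X) ∧ (A ∈ Pi0 (n + 1) X → A ∈ Pi0 (n + 2) X) := by
  have key : ∀ n, (∀ A : Set X, A ∈ Pi0 (n + 1) X → A ∈ Pi0 (n + 2) X) →
      ∀ A : Set X, A ∈ Sigma0 (n + 1) X → A ∈ Sigma0 (n + 2) X := by
    intro n h A hA
    rw [← compl_mem_Pi0 (n := n + 1)]
    exact h _ (compl_mem_Pi0.2 hA)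
  suffices h : ∀ n, ∀ A : Set X, A ∈ Pi0 (n + 1) X → A ∈ Pi0 (n + 2) X from
    fun A => ⟨key n (h n) A, h n A⟩
  intro n
  induction n with
  | zero =>
    intro A hA
    obtain ⟨f, hf, rfl⟩ := isGδ_iff_eq_iInter_nat.1 (IsClosed.isGδ (mem_Pi0_one.1 hA))
    exact ⟨f, hf, rfl⟩
  | succ n ih =>
    rintro A ⟨B, hB, rfl⟩
    exact ⟨B, fun i => key n ih _ (hB i), rfl⟩

theorem Sigma0_mono [PerfectlyNormalSpace X] {m n : ℕ} (hm : 1 ≤ m) (h : m ≤ n) {A : Set X}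
    (hA : A ∈ Sigma0 m X) : A ∈ Sigma0 n X := by
  induction n, h using Nat.le_induction with
  | base => exact hA
  | succ n hn ih =>
    obtain ⟨k, rfl⟩ : ∃ k, n = k + 1 := ⟨n - 1, by omega⟩
    exact (borel_succ_aux k A).1 ih

theorem Pi0_mono [PerfectlyNormalSpace X] {m n : ℕ} (hm : 1 ≤ m) (h : m ≤ n) {A : Set X}
    (hA : A ∈ Pi0 m X) : A ∈ Pi0 n X := by
  induction n, h using Nat.le_induction with
  | base => exact hA
  | succ n hn ih =>
    obtain ⟨k, rfl⟩ : ∃ k, n = k + 1 := ⟨n - 1, by omega⟩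
    exact (borel_succ_aux k A).2 ih

theorem Sigma0_subset_Pi0 [PerfectlyNormalSpace X] {m n : ℕ} (hm : 1 ≤ m) (h : m < n) {A : Set X}
    (hA : A ∈ Sigma0 m X) : A ∈ Pi0 n X := by
  obtain ⟨k, rfl⟩ : ∃ k, m = k + 1 := ⟨m - 1, by omega⟩
  exact Pi0_mono (by omega) h (Sigma0_subset_Pi0_succ hA)

theorem Pi0_subset_Sigma0 [PerfectlyNormalSpace X] {m n : ℕ} (hm : 1 ≤ m) (h : m < n) {A : Set X}
    (hA : A ∈ Pi0 m X) : A ∈ Sigma0 n X := by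
  obtain ⟨k, rfl⟩ : ∃ k, m = k + 1 := ⟨m - 1, by omega⟩
  exact Sigma0_mono (by omega) h (Pi0_subset_Sigma0_succ hA)

theorem iUnion_mem_Sigma0 {n : ℕ} {A : ℕ → Set X} (h : ∀ i, A i ∈ Sigma0 (n + 1) X) :
    ⋃ i, A i ∈ Sigma0 (n + 1) X := by
  cases n with
  | zero => exact isOpen_iUnion h
  | succ n =>
    choose B hB hA using h
    refine ⟨fun k => B k.unpair.1 k.unpair.2, fun k => hB _ _, ?_⟩
    ext x
    simp only [Set.mem_iUnion, hA]
    constructor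
    · rintro ⟨i, j, h⟩; exact ⟨Nat.pair i j, by simpa using h⟩
    · rintro ⟨k, h⟩; exact ⟨_, _, h⟩

theorem union_mem_Sigma0 {n : ℕ} {A B : Set X} (hA : A ∈ Sigma0 (n + 1) X)
    (hB : B ∈ Sigma0 (n + 1) X) : A ∪ B ∈ Sigma0 (n + 1) X := by
  have : A ∪ B = ⋃ i : ℕ, if i = 0 then A else B := by
    ext x
    simp only [Set.mem_union, Set.mem_iUnion]
    constructor
    · rintro (h | h)
      · exact ⟨0, by simpa using h⟩
      · exact ⟨1, by simpa using h⟩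
    · rintro ⟨i, h⟩
      split_ifs at h
      · exact .inl h
      · exact .inr h
  rw [this]
  refine iUnion_mem_Sigma0 fun i => ?_
  split_ifs <;> assumption

theorem inter_mem_Pi0 {n : ℕ} {A B : Set X} (hA : A ∈ Pi0 (n + 1) X)
    (hB : B ∈ Pi0 (n + 1) X) : A ∩ B ∈ Pi0 (n + 1) X := by
  rw [← compl_mem_Sigma0, Set.compl_inter]
  exact union_mem_Sigma0 (compl_mem_Sigma0.2 hA) (compl_mem_Sigma0.2 hB)

theorem inter_mem_Sigma0 {n : ℕ} {A B : Set X} (hA : A ∈ Sigma0 (n + 1) X)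
    (hB : B ∈ Sigma0 (n + 1) X) : A ∩ B ∈ Sigma0 (n + 1) X := by
  cases n with
  | zero => exact IsOpen.inter hA hB
  | succ n =>
    obtain ⟨A, hA, rfl⟩ := hA
    obtain ⟨B, hB, rfl⟩ := hB
    refine ⟨fun k => A k.unpair.1 ∩ B k.unpair.2, fun k => inter_mem_Pi0 (hA _) (hB _), ?_⟩
    ext x
    simp only [Set.mem_inter_iff, Set.mem_iUnion]
    constructor
    · rintro ⟨⟨i, h⟩, ⟨j, h'⟩⟩; exact ⟨Nat.pair i j, by simpa using ⟨h, h'⟩⟩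
    · rintro ⟨k, h, h'⟩; exact ⟨⟨_, h⟩, ⟨_, h'⟩⟩

theorem union_mem_Pi0 {n : ℕ} {A B : Set X} (hA : A ∈ Pi0 (n + 1) X)
    (hB : B ∈ Pi0 (n + 1) X) : A ∪ B ∈ Pi0 (n + 1) X := by
  rw [← compl_mem_Sigma0, Set.compl_union]
  exact inter_mem_Sigma0 (compl_mem_Sigma0.2 hA) (compl_mem_Sigma0.2 hB)

/-- Preimages of Borel sets under a function that is of the first class relative to `D`. -/
theorem exists_borel_preimage {f : X → Z} {D : Set X}
    (h : ∀ U : Set Z, IsOpen U → ∃ G ∈ Sigma0 2 X, ∀ x ∈ D, f x ∈ U ↔ x ∈ G) (n : ℕ) :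
    ∀ A : Set Z,
      (A ∈ Sigma0 (n + 1) Z → ∃ G ∈ Sigma0 (n + 2) X, ∀ x ∈ D, f x ∈ A ↔ x ∈ G) ∧
      (A ∈ Pi0 (n + 1) Z → ∃ G ∈ Pi0 (n + 2) X, ∀ x ∈ D, f x ∈ A ↔ x ∈ G) := by
  induction n with
  | zero =>
    intro A
    refine ⟨h A, fun hA => ?_⟩
    obtain ⟨G, hG, hD⟩ := h Aᶜ (mem_Pi0_one.1 hA).isOpen_compl
    refine ⟨Gᶜ, compl_mem_Pi0.2 hG, fun x hx => ?_⟩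
    rw [Set.mem_compl_iff, ← hD x hx, Set.mem_compl_iff, not_not]
  | succ n ih =>
    intro A
    constructor
    · rintro ⟨B, hB, rfl⟩
      choose G hG hD using fun i => (ih (B i)).2 (hB i)
      refine ⟨⋃ i, G i, ⟨G, hG, rfl⟩, fun x hx => ?_⟩
      simp only [Set.mem_iUnion, hD _ x hx]
    · rintro ⟨B, hB, rfl⟩
      choose G hG hD using fun i => (ih (B i)).1 (hB i)
      refine ⟨⋂ i, G i, ⟨G, hG, rfl⟩, fun x hx => ?_⟩
      simp only [Set.mem_iInter, hD _ x hx]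

end Borel

section Limits
variable {X : Type} [TopologicalSpace X]

open Classical in
/-- The sequence of truth values of membership. -/
noncomputable def characteristic (F : ℕ → Set X) (x : X) (k : ℕ) : Bool := decide (x ∈ F k)

/-- Every set of the next Borel class is the preimage of a set of the given class under the
characteristic map of a sequence of closed sets. -/
theorem exists_characteristic (n : ℕ) : ∀ A : Set X,
    (A ∈ Sigma0 (n + 2) X → ∃ F : ℕ → Set X, (∀ k, IsClosed (F k)) ∧
      ∃ A' ∈ Sigma0 (n + 1) (ℕ → Bool), ∀ x, x ∈ A ↔ characteristic F x ∈ A') ∧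
    (A ∈ Pi0 (n + 2) X → ∃ F : ℕ → Set X, (∀ k, IsClosed (F k)) ∧
      ∃ A' ∈ Pi0 (n + 1) (ℕ → Bool), ∀ x, x ∈ A ↔ characteristic F x ∈ A') := by
  induction n with
  | zero =>
    have hop : IsOpen {z : ℕ → Bool | ∃ k, z k = true} := by
      have : {z : ℕ → Bool | ∃ k, z k = true} = ⋃ k, (fun z : ℕ → Bool => z k) ⁻¹' {true} := by
        ext z; simp
      rw [this]
      exact isOpen_iUnion fun k => (isOpen_discrete _).preimage (continuous_apply k)
    intro A
    constructor
    · rintro ⟨B, hB, rfl⟩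
      exact ⟨B, hB, _, mem_Sigma0_one.2 hop, fun x => by simp [characteristic]⟩
    · rintro ⟨B, hB, rfl⟩
      refine ⟨fun k => (B k)ᶜ, fun k => (mem_Sigma0_one.1 (hB k)).isClosed_compl, _,
        mem_Pi0_one.2 hop.isClosed_compl, fun x => by simp [characteristic]⟩
  | succ n ih =>
    -- Countably many sequences of closed sets are interleaved by `Nat.pair`; the map that extracts
    -- row `i` again is continuous.
    have hr : ∀ i, Continuous fun (z : ℕ → Bool) (j : ℕ) => z (Nat.pair i j) := fun i =>
      continuous_pi fun j => continuous_apply _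
    have hc : ∀ (F : ℕ → ℕ → Set X) i x, (fun j => characteristic
        (fun k => F k.unpair.1 k.unpair.2) x (Nat.pair i j)) = characteristic (F i) x := by
      intro F i x
      funext j
      unfold characteristic
      beta_reduce
      rw [Nat.unpair_pair]
    intro A
    constructor
    · rintro ⟨B, hB, rfl⟩
      choose F hF A' hA' h using fun i => (ih (B i)).2 (hB i)
      refine ⟨fun k => F k.unpair.1 k.unpair.2, fun k => hF _ _, _,
        ⟨_, fun i => (preimage_borel (hr i) _ _).2 (hA' i), rfl⟩, fun x => ?_⟩
      simp only [Set.mem_iUnion, h, Set.mem_preimage, hc]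
    · rintro ⟨B, hB, rfl⟩
      choose F hF A' hA' h using fun i => (ih (B i)).1 (hB i)
      refine ⟨fun k => F k.unpair.1 k.unpair.2, fun k => hF _ _, _,
        ⟨_, fun i => (preimage_borel (hr i) _ _).1 (hA' i), rfl⟩, fun x => ?_⟩
      simp only [Set.mem_iInter, h, Set.mem_preimage, hc]

variable {Y : Type} [TopologicalSpace Y] [DiscreteTopology Y]

theorem exists_prefix_of_isOpen {U : Set (ℕ → Y)} (hU : IsOpen U) {y : ℕ → Y} (hy : y ∈ U) :
    ∃ t, ∀ y' : ℕ → Y, (∀ i < t, y' i = y i) → y' ∈ U := by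
  obtain ⟨_, ⟨x, n, rfl⟩, h1, h2⟩ :=
    (PiNat.isTopologicalBasis_cylinders (fun _ : ℕ => Y)).exists_subset_of_mem_open hy hU
  refine ⟨n, fun y' h => h2 ?_⟩
  rw [PiNat.mem_cylinder_iff] at h1 ⊢
  exact fun i hi => (h i hi).trans (h1 i hi)

theorem isLocallyConstant_of_prefix {T : Type*} {f : (ℕ → Y) → T} (t : ℕ)
    (h : ∀ y y' : ℕ → Y, (∀ i < t, y' i = y i) → f y' = f y) : IsLocallyConstant f := by
  rw [IsLocallyConstant.iff_eventually_eq]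
  intro y
  filter_upwards [(PiNat.isOpen_cylinder (fun _ : ℕ => Y) y t).mem_nhds
    (PiNat.self_mem_cylinder y t)] with y' hy'
  exact h _ _ (PiNat.mem_cylinder_iff.1 hy')

/-- Membership in a set of the next class is decided by a pointwise limit of continuous maps. -/
theorem exists_limit {S : Type} [TopologicalSpace S] [DiscreteTopology S] {K : Set (ℕ → S)}
    {A : Set (ℕ → Y)} {F : ℕ → Set (ℕ → Y)} (hF : ∀ k, IsClosed (F k)) {A' : Set (ℕ → Bool)}
    (hK : WadgeReducible A' K) (hA : ∀ x, x ∈ A ↔ characteristic F x ∈ A') :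
    ∃ (z : ℕ → (ℕ → Y) → ℕ → S) (l : (ℕ → Y) → ℕ → S), (∀ t, Continuous (z t)) ∧
      (∀ y p, ∀ᶠ t in Filter.atTop, z t y p = l y p) ∧ ∀ y, y ∈ A ↔ l y ∈ K := by
  classical
  obtain ⟨φ, hφ, rfl⟩ := hK
  -- Stage `t` asks whether some point of `F k` agrees with `y` below `t`. This depends on `t`
  -- letters only, and since `F k` is closed the answer is eventually the truth value of `y ∈ F k`.
  let e : ℕ → (ℕ → Y) → ℕ → Bool := fun t y k => decide (∃ y' ∈ F k, ∀ i < t, y' i = y i)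
  have he : ∀ t, Continuous (e t) := by
    intro t
    refine continuous_pi fun k => (isLocallyConstant_of_prefix t fun y y' h => ?_).continuous
    simp only [e]
    congr 1
    refine propext (exists_congr fun z => and_congr_right fun _ => forall₂_congr fun i hi => ?_)
    rw [h i hi]
  have hl : ∀ y, Filter.Tendsto (fun t => e t y) Filter.atTop (nhds (characteristic F y)) := by
    intro y
    rw [tendsto_pi_nhds]
    intro k
    refine tendsto_nhds_of_eventually_eq ?_
    by_cases hy : y ∈ F k
    · refine Filter.Eventually.of_forall fun t => ?_
      have : ∃ y' ∈ F k, ∀ i < t, y' i = y i := ⟨y, hy, fun _ _ => rfl⟩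
      simp [e, characteristic, this, hy]
    · obtain ⟨t, ht⟩ := exists_prefix_of_isOpen (hF k).isOpen_compl (y := y) hy
      filter_upwards [Filter.eventually_ge_atTop t] with s hs
      have : ¬ ∃ y' ∈ F k, ∀ i < s, y' i = y i := by
        rintro ⟨y', h1, h2⟩
        exact ht y' (fun i hi => h2 i (by omega)) h1
      simp only [e, characteristic, this, hy]
  refine ⟨fun t y => φ (e t y), fun y => φ (characteristic F y), fun t => hφ.comp (he t),
    fun y p => ?_, fun y => hA y⟩
  have h1 := ((continuous_apply p).comp hφ).tendsto (characteristic F y)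
  have h2 := h1.comp (hl y)
  rw [nhds_discrete] at h2
  exact Filter.tendsto_pure.1 h2

end Limits

section Complete
variable {S T : Type} [TopologicalSpace S] [TopologicalSpace T]

/-- Completeness is invariant under renaming of the letters. -/
theorem IsComplete.map {Γ : ∀ (X : Type) [TopologicalSpace X], Set (Set X)}
    (hΓ : ∀ {X Z : Type} [TopologicalSpace X] [TopologicalSpace Z] (f : X → Z), Continuous f →
      ∀ A ∈ Γ Z, f ⁻¹' A ∈ Γ X) {C : Set (ℕ → S)} {C' : Set (ℕ → T)} (e : T ≃ₜ S)
    (h : ∀ σ, σ ∈ C' ↔ (fun n => e (σ n)) ∈ C) (hC : IsComplete Γ C) : IsComplete Γ C' := by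
  have he : Continuous fun (σ : ℕ → T) n => e (σ n) :=
    continuous_pi fun n => e.continuous.comp (continuous_apply n)
  refine ⟨?_, fun Y _ _ _ A hA => ?_⟩
  · have : C' = (fun (σ : ℕ → T) n => e (σ n)) ⁻¹' C := Set.ext h
    rw [this]
    exact hΓ _ he _ hC.1
  · obtain ⟨f, hf, rfl⟩ := hC.2 Y A hA
    refine ⟨fun y n => e.symm (f y n), continuous_pi fun n =>
      e.symm.continuous.comp ((continuous_apply n).comp hf), ?_⟩
    ext y
    simp [h]

end Complete

end OmegaPower

/-! ### Stack histories as infinite words: encoding, parsing, local errors. -/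

namespace OmegaPower

universe u

/-- The alphabet of stack histories over the alphabet `α`. -/
inductive Sym (α : Type u) : Type u
  | hash : Sym α
  | tick : Sym α
  | dollar : Sym α
  | letter (a : α) : Sym α

namespace Sym
variable {α : Type u}

/-- A list of items (label in unary, letter) as a word. -/
def flat : List (ℕ × α) → List (Sym α)
  | [] => []
  | x :: l => List.replicate x.1 tick ++ letter x.2 :: flat l

/-- The word of a block: a header item followed by the items of a stack. -/
def block (B : List (ℕ × α)) : List (Sym α) := hash :: (flat B ++ [dollar])

/-- The pairs of letters that may follow each other. -/
def Adj : Sym α → Sym α → Prop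
  | hash, tick => True
  | hash, letter _ => True
  | tick, tick => True
  | tick, letter _ => True
  | letter _, tick => True
  | letter _, letter _ => True
  | letter _, dollar => True
  | dollar, hash => True
  | _, _ => False

/-- Validity of a single block: the stack is nonempty with increasing labels, and its last label is
the successor of the label of the header. -/
def Good (B : List (ℕ × α)) : Prop :=
  ∃ h b X a, B = (h, b) :: (X ++ [(h + 1, a)]) ∧ (X ++ [(h + 1, a)]).IsChain (·.1 < ·.1)

/-- Validity of two successive blocks: the label of the second header is the last label of the
first block, and the second stack without its last item is a prefix of the first stack. -/
def Good₂ (B B' : List (ℕ × α)) : Prop :=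
  (∃ x y, B.getLast? = some x ∧ B'.head? = some y ∧ x.1 = y.1) ∧
    flat B'.tail.dropLast <+: flat B.tail

/-- The words that do not occur in an encoded stack history. -/
def Bad : Set (List (Sym α)) :=
  {w | (∃ x y, ¬ Adj x y ∧ w = [x, y]) ∨ (∃ B, B ≠ [] ∧ ¬ Good B ∧ w = block B) ∨
    ∃ B B', B ≠ [] ∧ B' ≠ [] ∧ ¬ Good₂ B B' ∧ w = block B ++ block B'}

/-- Words from a block with header label `h` to a block with an item labelled `h` such that the
letters above this item form a word in `L`. -/
def edgeLang (L : Language α) : Language (Sym α) :=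
  {w | ∃ h b, (∃ I a s, w = block ((h, b) :: (I ++ (h, a) :: s)) ∧ s.map Prod.snd ∈ L) ∨
    ∃ z x I a s, w = hash :: (List.replicate h tick ++ letter b :: (z ++ block (x :: (I ++ (h,
      a) :: s))))
      ∧ s.map Prod.snd ∈ L}

/-- The language of stack histories over `L`. -/
def histLang (L : Language α) : Language (Sym α) :=
  {w | (∃ x l, w = x :: l ∧ x ∉ ({hash} : Set (Sym α))) ∨
    (∃ u b v, w = u ++ b ++ v ∧ b ∈ Bad) ∨ w ∈ edgeLang L}

/-! ### Parsing -/

theorem flat_append (l m : List (ℕ × α)) : flat (l ++ m) = flat l ++ flat m := by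
  induction l with
  | nil => rfl
  | cons x l ih => simp [flat, ih]

theorem mem_flat {l : List (ℕ × α)} {x : Sym α} (h : x ∈ flat l) : x ≠ hash ∧ x ≠ dollar := by
  induction l with
  | nil => simp [flat] at h
  | cons y l ih =>
    simp only [flat, List.mem_append, List.mem_replicate, List.mem_cons] at h
    rcases h with ⟨_, rfl⟩ | rfl | h
    · simp
    · simp
    · exact ih h

/-- The first letter after the ticks ends the unary number, so items form a prefix code. Unique
parsing of lists and blocks rests on this. -/
theorem ticks_inj {k k' : ℕ} {a a' : α} {u u' : List (Sym α)}
    (h : List.replicate k tick ++ letter a :: u = List.replicate k' tick ++ letter a' :: u') :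
    k = k' ∧ a = a' ∧ u = u' := by
  induction k generalizing k' with
  | zero =>
    cases k' with
    | zero => simpa using h
    | succ k' => simp [List.replicate_succ] at h
  | succ k ih =>
    cases k' with
    | zero => simp [List.replicate_succ] at h
    | succ k' =>
      simp only [List.replicate_succ, List.cons_append, List.cons.injEq, true_and] at h
      simpa using ih h

theorem ticks_ne_dollar {k : ℕ} {a : α} {u u' : List (Sym α)} :
    List.replicate k tick ++ letter a :: u ≠ dollar :: u' := by
  cases k <;> simp [List.replicate_succ]

theorem flat_dollar_inj {l l' : List (ℕ × α)} {u u' : List (Sym α)}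
    (h : flat l ++ dollar :: u = flat l' ++ dollar :: u') : l = l' ∧ u = u' := by
  induction l generalizing l' with
  | nil =>
    cases l' with
    | nil => simpa [flat] using h
    | cons y l' =>
      simp only [flat, List.nil_append, List.append_assoc, List.cons_append] at h
      exact absurd h.symm ticks_ne_dollar
  | cons x l ih =>
    cases l' with
    | nil =>
      simp only [flat, List.nil_append, List.append_assoc, List.cons_append] at h
      exact absurd h ticks_ne_dollar
    | cons y l' =>
      simp only [flat, List.append_assoc, List.cons_append] at h
      obtain ⟨h1, h2, h3⟩ := ticks_inj h
      obtain ⟨rfl, rfl⟩ := ih h3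
      exact ⟨by rw [Prod.ext h1 h2], rfl⟩

theorem flat_prefix {l l' : List (ℕ × α)} (h : flat l <+: flat l') : l <+: l' := by
  induction l generalizing l' with
  | nil => exact List.nil_prefix
  | cons x l ih =>
    obtain ⟨t, ht⟩ := h
    cases l' with
    | nil => simp [flat] at ht
    | cons y l' =>
      simp only [flat, List.append_assoc, List.cons_append] at ht
      obtain ⟨h1, h2, h3⟩ := ticks_inj ht
      obtain ⟨s, rfl⟩ := ih ⟨t, h3⟩
      exact ⟨s, by rw [Prod.ext h1 h2]; rfl⟩

theorem prefix_flat {l l' : List (ℕ × α)} (h : l <+: l') : flat l <+: flat l' := by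
  obtain ⟨t, rfl⟩ := h
  exact ⟨flat t, (flat_append _ _).symm⟩

/-- Every letter closes an item whose label is the run of ticks before it; the ticks at the end are
an item that has not been closed. -/
theorem exists_flat (w : List (Sym α)) (h : ∀ x ∈ w, x ≠ hash ∧ x ≠ dollar) :
    ∃ l k, w = flat l ++ List.replicate k tick := by
  induction w with
  | nil => exact ⟨[], 0, rfl⟩
  | cons x w ih =>
    simp only [List.mem_cons, forall_eq_or_imp] at h
    obtain ⟨l, k, rfl⟩ := ih h.2
    cases x with
    | hash => simp at h
    | dollar => simp at h
    | letter a => exact ⟨(0, a) :: l, k, rfl⟩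
    | tick =>
      cases l with
      | nil => exact ⟨[], k + 1, rfl⟩
      | cons y l => exact ⟨(y.1 + 1, y.2) :: l, k, by simp [flat, List.replicate_succ]⟩

/-- Of two blocks at one position the shorter is a prefix of the longer, and `dollar`, which does
not occur inside a list of items, ends both at the same place. -/
theorem at_block_inj {σ : ℕ → Sym α} {p : ℕ} {B B' : List (ℕ × α)} (h : At σ p (block B))
    (h' : At σ p (block B')) : B = B' := by
  have key : ∀ {B B' : List (ℕ × α)}, (block B).length ≤ (block B').length →
      At σ p (block B) → At σ p (block B') → B = B' := by
    intro B B' hl h h'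
    have e : block B' = block B ++ seg σ (p + (block B).length)
        ((block B').length - (block B).length) := by
      rw [← show seg σ p (block B').length = block B' from h']
      conv_lhs => rw [show (block B').length = (block B).length +
        ((block B').length - (block B).length) by omega, seg_add]
      rw [show seg σ p (block B).length = block B from h]
      simp
    simp only [block, List.cons_append, List.cons.injEq, true_and, List.append_assoc] at e
    exact (flat_dollar_inj e).1.symm
  rcases le_total (block B).length (block B').length with hl | hl
  · exact key hl h h'
  · exact (key hl h' h).symm

/-- The longer kind of word in `edgeLang` shows only the header of its first block; this identifies
it with the header of the block that really stands there. -/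
theorem at_header_inj {σ : ℕ → Sym α} {p : ℕ} {B : List (ℕ × α)} {h : ℕ} {b : α}
    (h1 : At σ p (block B)) (h2 : At σ p (hash :: (List.replicate h tick ++ [letter b])))
    : ∃ X, B = (h, b) :: X := by
  rcases le_total (block B).length (hash :: (List.replicate h tick ++
    [letter b])).length with hl | hl
  all_goals
    obtain ⟨d, hd⟩ := Nat.exists_eq_add_of_le hl
  · have e : (hash :: (List.replicate h tick ++ [letter b])) = block B ++
        seg σ (p + (block B).length) d := by
      rw [← show seg σ p _ = _ from h2, hd, seg_add, show seg σ p (block B).length =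
          block B from h1]
    have h3 : dollar ∈ (hash :: (List.replicate h tick ++ [letter b]) : List (Sym α)) := by
      rw [e]; simp [block]
    simp [List.mem_replicate] at h3
  · have e : block B = (hash :: (List.replicate h tick ++ [letter b])) ++
        seg σ (p + (hash :: (List.replicate h tick ++ [letter b]) : List (Sym α)).length) d := by
      rw [← show seg σ p _ = _ from h1, hd, seg_add, show seg σ p _ = _ from h2]
    cases B with
    | nil =>
      simp only [block, flat, List.nil_append, List.cons_append, List.cons.injEq, true_and,
        List.append_assoc] at e
      exact absurd e.symm ticks_ne_dollar
    | cons x X =>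
      simp only [block, flat, List.cons_append, List.cons.injEq, true_and,
        List.append_assoc, List.nil_append] at e
      obtain ⟨e1, e2, _⟩ := ticks_inj e
      exact ⟨X, by rw [← e1, ← e2]⟩

theorem block_ne_nil (B : List (ℕ × α)) : block B ≠ [] := by simp [block]

section Align
variable {σ : ℕ → Sym α} {B : ℕ → List (ℕ × α)}

/-- `σ` is the concatenation of the given blocks. -/
def Encodes (σ : ℕ → Sym α) (B : ℕ → List (ℕ × α)) : Prop :=
  (∀ k, B k ≠ []) ∧ ∀ k, At σ 0 (cum (fun k => block (B k)) k)

/-- The position of a block. -/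
def cut (B : ℕ → List (ℕ × α)) (k : ℕ) : ℕ := (cum (fun k => block (B k)) k).length

theorem cut_zero (B : ℕ → List (ℕ × α)) : cut B 0 = 0 := rfl

theorem cut_succ (B : ℕ → List (ℕ × α)) (k : ℕ) :
    cut B (k + 1) = cut B k + (block (B k)).length := by
  simp [cut, cum_succ]

theorem cut_strictMono (B : ℕ → List (ℕ × α)) : StrictMono (cut B) :=
  strictMono_nat_of_lt_succ fun k => by
    have := List.length_pos_iff.2 (block_ne_nil (B k))
    rw [cut_succ]; omega

theorem Encodes.at_block (h : Encodes σ B) (k : ℕ) : At σ (cut B k) (block (B k)) := by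
  have := h.2 (k + 1)
  rw [cum_succ, at_append, zero_add] at this
  exact this.2

/-- Inside a block `hash` occurs only as the first letter. -/
theorem Encodes.eq_cut_of_hash (h : Encodes σ B) {p : ℕ} (hp : σ p = hash) : ∃ k, p = cut B k := by
  classical
  have ex : ∃ k, p < cut B k := ⟨p + 1, Nat.lt_of_lt_of_le (Nat.lt_succ_self p)
    ((cut_strictMono B).id_le _)⟩
  obtain ⟨k, hk⟩ : ∃ k, Nat.find ex = k + 1 := by
    refine ⟨Nat.find ex - 1, ?_⟩
    have h1 := Nat.find_spec ex
    have : Nat.find ex ≠ 0 := by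
      intro h0
      rw [h0, cut_zero] at h1
      omega
    omega
  have h1 : p < cut B (k + 1) := hk ▸ Nat.find_spec ex
  have h2 : cut B k ≤ p := by
    by_contra hc
    have := Nat.find_min' ex (m := k) (by omega)
    omega
  refine ⟨k, ?_⟩
  by_contra hne
  have hb := h.at_block k
  rw [cut_succ] at h1
  obtain ⟨d, rfl⟩ := Nat.exists_eq_add_of_le h2
  have h3 := at_iff_getElem.1 hb d (by omega)
  rw [hp] at h3
  obtain ⟨d', rfl⟩ : ∃ d', d = d' + 1 := ⟨d - 1, by omega⟩
  have h4 : hash ∈ flat (B k) ++ [dollar] := by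
    rw [h3]
    simp only [block, List.getElem_cons_succ]
    exact List.getElem_mem _
  rcases List.mem_append.1 h4 with h5 | h5
  · exact (mem_flat h5).1 rfl
  · simp at h5

theorem Encodes.block_eq (h : Encodes σ B) {p : ℕ} {C : List (ℕ × α)} (hp : At σ p (block C)) :
    ∃ k, p = cut B k ∧ C = B k := by
  obtain ⟨k, rfl⟩ := h.eq_cut_of_hash (p := p) (at_cons.1 hp).1
  exact ⟨k, rfl, at_block_inj hp (h.at_block k)⟩

theorem Encodes.block₂_eq (h : Encodes σ B) {p : ℕ} {C C' : List (ℕ × α)}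
    (hp : At σ p (block C ++ block C')) : ∃ k, p = cut B k ∧ C = B k ∧ C' = B (k + 1) := by
  rw [at_append] at hp
  obtain ⟨k, rfl, rfl⟩ := h.block_eq hp.1
  refine ⟨k, rfl, rfl, ?_⟩
  rw [← cut_succ] at hp
  exact at_block_inj hp.2 (h.at_block (k + 1))

/-- The preceding letter is kept general so that the induction can move it through ticks and
letters. The second claim is what allows a `dollar` to follow a nonempty list. -/
theorem isChain_flat {l : List (ℕ × α)} {x : Sym α} (hx : x ≠ dollar) :
    (x :: flat l).IsChain Adj ∧ (∀ y ∈ (x :: flat l).getLast?, y = x ∨ ∃ a, y = letter a) := by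
  induction l generalizing x with
  | nil => simp [flat]
  | cons y l ih =>
    obtain ⟨k, a⟩ := y
    obtain ⟨h1, h2⟩ := ih (x := letter a) (by simp)
    constructor
    · induction k generalizing x with
      | zero =>
        simp only [flat, List.replicate_zero, List.nil_append, List.isChain_cons_cons]
        refine ⟨?_, h1⟩
        cases x <;> simp_all [Adj]
      | succ k ihk =>
        have := ihk (x := tick) (by simp)
        simp only [flat, List.replicate_succ, List.cons_append, List.isChain_cons_cons] at this ⊢
        refine ⟨?_, this⟩
        cases x <;> simp_all [Adj]
    · intro z hz
      have e : (x :: flat ((k, a) :: l)).getLast? = (letter a :: flat l).getLast? := by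
        simp [flat, List.getLast?_cons, List.getLast?_append]
      rw [e] at hz
      rcases h2 z hz with rfl | h
      · exact .inr ⟨a, rfl⟩
      · exact .inr h

theorem isChain_block {B : List (ℕ × α)} (hB : B ≠ []) : (block B).IsChain Adj := by
  obtain ⟨h1, h2⟩ := isChain_flat (l := B) (x := (hash : Sym α)) (by simp)
  rw [block, ← List.cons_append, List.isChain_append]
  refine ⟨h1, by simp, ?_⟩
  intro y hy z hz
  obtain rfl : z = dollar := by simpa using hz.symm
  rcases h2 y hy with rfl | ⟨a, rfl⟩
  · exfalso
    obtain ⟨x, l, rfl⟩ := List.exists_cons_of_ne_nil hB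
    have hm : hash ∈ flat (x :: l) := by
      rw [List.getLast?_cons] at hy
      have hne : flat (x :: l) ≠ [] := by simp [flat]
      rw [List.getLast?_eq_some_getLast hne] at hy
      simp at hy
      rw [← hy]
      exact List.getLast_mem hne
    exact (mem_flat hm).1 rfl
  · trivial

theorem Encodes.adj (h : Encodes σ B) (p : ℕ) : Adj (σ p) (σ (p + 1)) := by
  have hc : ∀ k, (cum (fun k => block (B k)) k).IsChain Adj ∧
      ∀ y ∈ (cum (fun k => block (B k)) k).getLast?, y = dollar := by
    intro k
    induction k with
    | zero => simp [cum_zero]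
    | succ k ih =>
      rw [cum_succ]
      constructor
      · rw [List.isChain_append]
        refine ⟨ih.1, isChain_block (h.1 k), ?_⟩
        intro y hy z hz
        obtain rfl := ih.2 y hy
        obtain rfl : z = hash := by simpa [block] using hz.symm
        trivial
      · intro y hy
        simp [block, List.getLast?_append, List.getLast?_cons] at hy
        exact hy.symm
  have hl : p + 2 ≤ (cum (fun k => block (B k)) (p + 2)).length := (cut_strictMono B).id_le _
  have h1 := List.isChain_iff_getElem.1 (hc (p + 2)).1 p (by omega)
  have h2 := at_iff_getElem.1 (h.2 (p + 2))
  have h3 := h2 p (by omega)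
  have h4 := h2 (p + 1) (by omega)
  rw [zero_add] at h3 h4
  rwa [h3, h4]

/-- A concatenation of blocks has no bad factor if and only if the blocks are valid. -/
theorem Encodes.no_bad_iff (h : Encodes σ B) : (¬ ∃ p, ∃ b ∈ Bad, At σ p b) ↔
    ∀ k, Good (B k) ∧ Good₂ (B k) (B (k + 1)) := by
  constructor
  · intro hb k
    constructor
    · by_contra hg
      exact hb ⟨_, _, .inr (.inl ⟨B k, h.1 k, hg, rfl⟩), h.at_block k⟩
    · by_contra hg
      refine hb ⟨cut B k, _, .inr (.inr ⟨B k, B (k + 1), h.1 k, h.1 _, hg, rfl⟩), ?_⟩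
      rw [at_append, ← cut_succ]
      exact ⟨h.at_block k, h.at_block _⟩
  · rintro hg ⟨p, b, ⟨x, y, hxy, rfl⟩ | ⟨C, _, hC, rfl⟩ | ⟨C, C', _, _, hC, rfl⟩, hp⟩
    · rw [at_cons, at_singleton] at hp
      obtain ⟨rfl, rfl⟩ := hp
      exact hxy (h.adj p)
    · obtain ⟨k, _, rfl⟩ := h.block_eq hp
      exact hC (hg k).1
    · obtain ⟨k, _, rfl, rfl⟩ := h.block₂_eq hp
      exact hC (hg k).2

/-- An infinite word without bad pairs of letters and with infinitely many ends of blocks is a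
concatenation of blocks. -/
theorem exists_encodes (h0 : σ 0 = hash) (hadj : ∀ p, Adj (σ p) (σ (p + 1)))
    (hinf : ∀ n, ∃ p, n ≤ p ∧ σ p = dollar) : ∃ B, Encodes σ B := by
  classical
  -- The block at `p` extends to the first `dollar` after `p`; there is no `hash` in between,
  -- because only `dollar` may precede `hash`.
  have step : ∀ p, σ p = hash → ∃ C : List (ℕ × α), C ≠ [] ∧ At σ p (block C) ∧
      σ (p + (block C).length) = hash := by
    intro p hp
    have ex : ∃ q, σ (p + 1 + q) = dollar := by
      obtain ⟨q, hq, hs⟩ := hinf (p + 1)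
      exact ⟨q - (p + 1), by rwa [show p + 1 + (q - (p + 1)) = q by omega]⟩
    obtain ⟨q, hq⟩ : ∃ q, q = Nat.find ex := ⟨_, rfl⟩
    have hs : σ (p + 1 + q) = dollar := hq ▸ Nat.find_spec ex
    have hmin : ∀ i < q, σ (p + 1 + i) ≠ dollar := fun i hi => Nat.find_min ex (hq ▸ hi)
    have hnh : ∀ i < q, σ (p + 1 + i) ≠ hash := by
      intro i hi he
      have ha := hadj (p + i)
      rw [show p + i + 1 = p + 1 + i by omega, he] at ha
      have hne : σ (p + i) ≠ dollar := by
        cases i with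
        | zero => simp [hp]
        | succ i =>
          have := hmin i (by omega)
          rwa [show p + (i + 1) = p + 1 + i by omega]
      generalize σ (p + i) = x at ha hne
      cases x <;> simp_all [Adj]
    obtain ⟨l, k, hl⟩ := exists_flat (seg σ (p + 1) q) (by
      intro x hx
      obtain ⟨i, hi, rfl⟩ := List.getElem_of_mem hx
      rw [getElem_seg]
      rw [length_seg] at hi
      exact ⟨hnh i hi, hmin i hi⟩)
    have hat := at_seg σ (p + 1) q
    have hlen := congrArg List.length hl
    rw [length_seg] at hlen
    have ha := hadj (p + q)
    rw [show p + q + 1 = p + 1 + q by omega, hs] at ha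
    -- A tick may not precede `dollar`, so no item is left unfinished.
    obtain rfl : k = 0 := by
      by_contra hk
      obtain ⟨k, rfl⟩ : ∃ j, k = j + 1 := ⟨k - 1, by omega⟩
      rw [hl, List.replicate_succ', at_append, at_append] at hat
      have h3 := at_singleton.1 hat.2.2
      simp at hlen h3
      rw [show p + 1 + (flat l).length + k = p + q by omega] at h3
      rw [h3] at ha
      exact ha
    simp only [List.replicate_zero, List.append_nil] at hl hlen
    refine ⟨l, ?_, ?_, ?_⟩
    -- The letter `hash` may not be followed by `dollar`, so the header is present.
    · rintro rfl
      simp [flat] at hlen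
      subst hlen
      rw [Nat.add_zero, hp] at ha
      exact ha
    · rw [block, at_cons, at_append, at_singleton, ← hl, length_seg]
      exact ⟨hp, hat, hs⟩
    · have h1 : p + (block l).length = p + 1 + q + 1 := by simp [block, hlen]; omega
      have h2 := hadj (p + 1 + q)
      rw [hs] at h2
      rw [h1]
      generalize σ (p + 1 + q + 1) = x at h2
      cases x <;> simp_all [Adj]
  choose! C hC1 hC2 hC3 using step
  let pos : ℕ → ℕ := fun k => Nat.rec 0 (fun _ p => p + (block (C p)).length) k
  have hpos : ∀ k, σ (pos k) = hash := by
    intro k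
    induction k with
    | zero => exact h0
    | succ k ih => exact hC3 _ ih
  refine ⟨fun k => C (pos k), fun k => hC1 _ (hpos k), ?_⟩
  have key : ∀ k, (cum (fun k => block (C (pos k))) k).length = pos k ∧
      At σ 0 (cum (fun k => block (C (pos k))) k) := by
    intro k
    induction k with
    | zero => exact ⟨rfl, rfl⟩
    | succ k ih =>
      rw [cum_succ, List.length_append, at_append, ih.1, zero_add]
      exact ⟨rfl, ih.2, hC2 _ (hpos k)⟩
  exact fun k => (key k).2

/-- For a concatenation of blocks, acceptance is the existence of an infinite path. -/
theorem Encodes.mem_edge_iff (h : Encodes σ B) {L : Language α} :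
    σ ∈ omegaPower (edgeLang L) ↔ ∃ i : ℕ → ℕ, i 0 = 0 ∧ StrictMono i ∧
      ∀ m, ∃ x b X I a s, B (i m) = (x, b) :: X ∧
        B (i (m + 1) - 1) = I ++ (x, a) :: s ∧ I ≠ [] ∧ s.map Prod.snd ∈ L := by
  rw [mem_omegaPower_iff]
  constructor
  · rintro ⟨f, f0, fm, hf⟩
    have hlt : ∀ k, f k < f (k + 1) := fun k => fm (Nat.lt_succ_self k)
    have hhash : ∀ k, σ (f k) = hash := by
      intro k
      obtain ⟨d, hd⟩ : ∃ d, f (k + 1) - f k = d + 1 :=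
        ⟨f (k + 1) - f k - 1, by have := hlt k; omega⟩
      have := hf k
      rw [hd, seg_succ] at this
      obtain ⟨x, b, ⟨I, a, s, hw, _⟩ | ⟨z, y, I, a, s, hw, _⟩⟩ := this
      · exact (List.cons.inj hw).1
      · exact (List.cons.inj hw).1
    choose i hi using fun k => h.eq_cut_of_hash (hhash k)
    have im : StrictMono i := by
      refine strictMono_nat_of_lt_succ fun k => ?_
      have := hlt k
      rw [hi, hi] at this
      exact (cut_strictMono B).lt_iff_lt.1 this
    refine ⟨i, (cut_strictMono B).injective (by rw [← hi, f0, cut_zero]), im, fun m => ?_⟩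
    have hat := at_seg σ (f m) (f (m + 1) - f m)
    have hlen := length_seg σ (f m) (f (m + 1) - f m)
    have hend : f m + (f (m + 1) - f m) = f (m + 1) := by have := hlt m; omega
    -- The two kinds of edge words: those that consist of a single block, and those that stretch
    -- over several.
    obtain ⟨x, b, ⟨I, a, s, hw, hs⟩ | ⟨z, y, I, a, s, hw, hs⟩⟩ := hf m
    · rw [hw] at hat hlen
      have hB := at_block_inj hat (by rw [hi]; exact h.at_block _)
      have hi' : i (m + 1) = i m + 1 := by
        apply (cut_strictMono B).injective
        rw [cut_succ, ← hi, ← hi, ← hB]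
        omega
      refine ⟨x, b, _, (x, b) :: I, a, s, hB.symm, ?_, by simp, hs⟩
      rw [hi', Nat.add_sub_cancel, ← hB]
      rfl
    · rw [hw] at hat hlen
      have hsplit : hash :: (List.replicate x tick ++ letter b :: (z ++ block (y :: (I ++ (x, a) ::
          s)))) =
        (hash :: (List.replicate x tick ++ [letter b])) ++ (z ++ block (y :: (I ++ (x, a) ::
          s))) := by
        simp
      rw [hsplit] at hat hlen
      rw [at_append, at_append] at hat
      obtain ⟨X, hX⟩ := at_header_inj (by rw [hi]; exact h.at_block _) hat.1
      obtain ⟨j, hj1, hj2⟩ := h.block_eq hat.2.2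
      have hi' : i (m + 1) = j + 1 := by
        apply (cut_strictMono B).injective
        rw [cut_succ, ← hi, ← hj1, ← hj2]
        rw [List.length_append, List.length_append] at hlen
        omega
      refine ⟨x, b, X, y :: I, a, s, hX, ?_, by simp, hs⟩
      rw [hi', Nat.add_sub_cancel, ← hj2]
      rfl
  · rintro ⟨i, i0, im, hi⟩
    refine ⟨fun m => cut B (i m), by simp [i0, cut_zero], (cut_strictMono B).comp im, fun m => ?_⟩
    obtain ⟨x, b, X, I, a, s, hX, hB, hI, hs⟩ := hi m
    have hlt : i m < i (m + 1) := im (Nat.lt_succ_self m)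
    -- The first entry of a block is its header, so `I ≠ []` says that the matched item belongs to
    -- the stack.
    obtain ⟨y, I, rfl⟩ := List.exists_cons_of_ne_nil hI
    obtain ⟨d, hd⟩ := Nat.exists_eq_add_of_lt hlt
    simp only
    cases d with
    | zero =>
      rw [hd, Nat.add_zero, cut_succ, Nat.add_sub_cancel_left,
        show seg σ _ _ = _ from h.at_block (i m)]
      rw [hd, Nat.add_zero, Nat.add_sub_cancel, hX] at hB
      obtain ⟨rfl, rfl⟩ := List.cons.inj hB
      rw [hX]
      exact ⟨x, b, .inl ⟨I, a, s, rfl, hs⟩⟩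
    | succ d =>
      rw [show i (m + 1) - 1 = i m + 1 + d by omega] at hB
      have hle : cut B (i m + 1) ≤ cut B (i m + 1 + d) := (cut_strictMono B).monotone (by omega)
      obtain ⟨e, he⟩ := Nat.exists_eq_add_of_le hle
      rw [hd, show i m + (d + 1) + 1 = (i m + 1 + d) + 1 by omega, cut_succ]
      have h1 := h.at_block (i m)
      have h2 := h.at_block (i m + 1 + d)
      have h3 := cut_succ B (i m)
      rw [show cut B (i m + 1 + d) + (block (B (i m + 1 + d))).length - cut B (i m) =
        (block (B (i m))).length + (e + (block (B (i m + 1 + d))).length) by omega, seg_add,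
        seg_add, show seg σ _ (block (B (i m))).length = _ from h1, ← h3, ← he,
        show seg σ _ (block (B (i m + 1 + d))).length = _ from h2, hB, hX]
      exact ⟨x, b, .inr ⟨flat X ++ dollar :: seg σ (cut B (i m + 1)) e, y, I, a, s,
        by simp [block, flat], hs⟩⟩

end Align

/-- Acceptance by the language of stack histories. -/
theorem mem_histLang_iff {L : Language α} {σ : ℕ → Sym α} : σ ∈ omegaPower (histLang L) ↔
    σ 0 ≠ hash ∨ (∃ p, ∃ b ∈ Bad, At σ p b) ∨ σ ∈ omegaPower (edgeLang L) := by
  have := mem_omegaPower_free (L := histLang L) (V := edgeLang L) (Bad := Bad) (H := {hash})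
    (σ := σ) (fun w => Iff.rfl) ?_ ?_
  · simpa using this
  · rintro x rfl y rfl
    exact .inl ⟨_, _, by simp [Adj], rfl⟩
  · rintro w ⟨h, b, ⟨I, a, s, rfl, _⟩ | ⟨z, y, I, a, s, rfl, _⟩⟩
    · refine ⟨hash :: flat ((h, b) :: (I ++ (h, a) :: s)), dollar, by simp [block],
          fun x hx => .inl ⟨_, _, ?_, rfl⟩⟩
      cases x <;> simp_all [Adj]
    · refine ⟨hash :: (List.replicate h tick ++ letter b ::
        (z ++ hash :: flat (y :: (I ++ (h, a) :: s)))), dollar, by simp [block],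
          fun x hx => .inl ⟨_, _, ?_, rfl⟩⟩
      cases x <;> simp_all [Adj]

end Sym

end OmegaPower

/-! ### Paths through a stack sequence and convergence of the stacks. -/

namespace OmegaPower

universe u

open Filter

section Stack
variable {α : Type u}

/-- Labels increase along a stack, so a label determines the place of its item. -/
theorem label_unique {l A A' B B' : List (ℕ × α)} {x y : ℕ × α} (hl : l.Pairwise (·.1 < ·.1))
    (h1 : l = A ++ x :: A') (h2 : l = B ++ y :: B') (h : x.1 = y.1) :
    A = B ∧ x = y ∧ A' = B' := by
  subst h1
  induction A generalizing B with
  | nil =>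
    cases B with
    | nil => simpa using h2
    | cons z B =>
      simp only [List.nil_append, List.cons_append, List.cons.injEq] at h2
      obtain ⟨rfl, rfl⟩ := h2
      have := (List.pairwise_cons.1 hl).1 y (by simp)
      omega
  | cons z A ih =>
    cases B with
    | nil =>
      simp only [List.nil_append, List.cons_append, List.cons.injEq] at h2
      obtain ⟨rfl, rfl⟩ := h2
      have := (List.pairwise_cons.1 hl).1 x (by simp)
      omega
    | cons z' B =>
      simp only [List.cons_append, List.cons.injEq] at h2
      obtain ⟨rfl, h2⟩ := h2
      obtain ⟨rfl, rfl, rfl⟩ := ih (List.pairwise_cons.1 hl).2 h2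
      exact ⟨rfl, rfl, rfl⟩

/-- A sequence of stacks where each step pops some items and pushes an item with a new label. -/
structure StackSeq (r : ℕ) (Z : ℕ → List (ℕ × α)) : Prop where
  top : ∀ k, ∃ l a, Z k = l ++ [(r + k, a)]
  increasing : ∀ k, (Z k).Pairwise (·.1 < ·.1)
  step : ∀ k, (Z (k + 1)).dropLast <+: Z k

namespace StackSeq
variable {r : ℕ} {Z : ℕ → List (ℕ × α)}

theorem label_le (h : StackSeq r Z) (k : ℕ) {x : ℕ × α} (hx : x ∈ Z k) : x.1 ≤ r + k := by
  obtain ⟨l, a, hl⟩ := h.top k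
  have hi := h.increasing k
  rw [hl] at hx hi
  rcases List.mem_append.1 hx with h1 | h1
  · exact ((List.pairwise_append.1 hi).2.2 x h1 (r + k, a) (by simp)).le
  · simp at h1; simp [h1]

/-- As long as the item pushed at time `k` is in the stack, so is everything below it. -/
theorem prefix_of_mem (h : StackSeq r Z) {k j : ℕ} (hkj : k ≤ j) (hj : ∃ x ∈ Z j, x.1 = r + k) :
    ∀ l, k ≤ l → l ≤ j → Z k <+: Z l := by
  induction j, hkj using Nat.le_induction with
  | base =>
    intro l h1 h2
    obtain rfl : l = k := le_antisymm h2 h1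
    exact List.prefix_rfl
  | succ j hkj ih =>
    obtain ⟨x, hx, hxl⟩ := hj
    obtain ⟨P, a, hP⟩ := h.top (j + 1)
    have hstep := h.step j
    rw [hP, List.dropLast_concat] at hstep
    -- The item pushed at this step has label `r + (j + 1)`, larger than `r + k`, so `x` was there
    -- before.
    have hxP : x ∈ P := by
      rw [hP] at hx
      rcases List.mem_append.1 hx with h1 | h1
      · exact h1
      · simp at h1; rw [h1] at hxl; simp at hxl; omega
    have ih' := ih ⟨x, hstep.subset hxP, hxl⟩
    intro l h1 h2
    rcases Nat.lt_or_ge j l with h3 | h3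
    swap
    · exact ih' l h1 h3
    obtain rfl : l = j + 1 := by omega
    rw [hP]
    refine List.IsPrefix.trans ?_ (List.prefix_append _ _)
    rcases le_total (Z k).length P.length with hl | hl
    · exact List.prefix_of_prefix_length_le (ih' j hkj le_rfl) hstep hl
    · have hPk := List.prefix_of_prefix_length_le hstep (ih' j hkj le_rfl) hl
      obtain ⟨Q, b, hQ⟩ := h.top k
      rw [hQ, List.prefix_concat_iff] at hPk
      rcases hPk with e | e
      · rw [hQ, e]
      -- Here the item labelled `r + k` would lie strictly below the top of `Z k`, which has that
      -- same label.
      · have hi := h.increasing k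
        rw [hQ] at hi
        have := (List.pairwise_append.1 hi).2.2 x (e.subset hxP) (r + k, b) (by simp)
        simp at this
        omega

/-- A path through the stack sequence exists if and only if the stacks converge to an infinite word
whose part above the first stack lies in the omega-power. -/
theorem path_iff (h : StackSeq r Z) {L : Language α} :
    (∃ i : ℕ → ℕ, i 0 = 0 ∧ StrictMono i ∧
      ∀ m, ∃ I a s, Z (i (m + 1)) = I ++ (r + i m, a) :: s ∧ s.map Prod.snd ∈ L) ↔
    (∀ k, (Z 0).length < (Z (k + 1)).length) ∧ ∃ τ ∈ omegaPower L,
      ∀ p, ∀ᶠ k in atTop, (Z k)[(Z 0).length + p]?.map Prod.snd = some (τ p) := by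
  constructor
  · rintro ⟨i, i0, im, hi⟩
    choose I a s hZ hs using hi
    have hlt : ∀ m, i m < i (m + 1) := fun m => im (Nat.lt_succ_self m)
    -- At time `i (n + 1)` the item pushed at time `i n` is still present, so `Z (i n)` is intact
    -- throughout this interval; chaining the intervals reaches all later times.
    have hpre : ∀ m l, i m ≤ l → Z (i m) <+: Z l := by
      intro m l hl
      have : ∀ n, m ≤ n → ∀ l, i m ≤ l → l ≤ i n → Z (i m) <+: Z l := by
        intro n hn
        induction n, hn using Nat.le_induction with
        | base =>
          intro l h1 h2
          rw [le_antisymm h2 h1]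
        | succ n hn ih =>
          intro l h1 h2
          rcases le_total l (i n) with h3 | h3
          · exact ih l h1 h3
          · refine (ih (i n) (im.monotone hn) le_rfl).trans ?_
            exact h.prefix_of_mem (hlt n).le ⟨(r + i n, a n), by rw [hZ]; simp, rfl⟩ l h3 h2
      exact this (max m l) (le_max_left _ _) l hl ((le_max_right _ _).trans (im.id_le _))
    have happ : ∀ m, Z (i (m + 1)) = Z (i m) ++ s m := by
      intro m
      obtain ⟨t, ht⟩ := hpre m _ (hlt m).le
      obtain ⟨Q, b, hQ⟩ := h.top (i m)
      obtain ⟨rfl, e2, e3⟩ := label_unique (h.increasing (i (m + 1))) (hZ m)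
        (B := Q) (y := (r + i m, b)) (B' := t) (by rw [← ht, hQ, List.append_assoc]; rfl) rfl
      rw [hZ, hQ, e2]
      simp
    -- With `s m` empty the stacks at two different times would coincide, but the later one contains
    -- a label too large for the earlier one.
    have hsne : ∀ m, s m ≠ [] := by
      intro m he
      have e := happ m
      rw [he, List.append_nil] at e
      obtain ⟨Q, b, hQ⟩ := h.top (i (m + 1))
      have := h.label_le (i m) (x := (r + i (m + 1), b)) (by rw [← e, hQ]; simp)
      have := hlt m
      simp at *
      omega
    have hwne : ∀ m, (s m).map Prod.snd ≠ [] := fun m => by simpa using hsne m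
    have hcum : ∀ m, (Z (i m)).map Prod.snd = (Z 0).map Prod.snd ++
        cum (fun m => (s m).map Prod.snd) m := by
      intro m
      induction m with
      | zero => simp [i0, cum_zero]
      | succ m ih => rw [happ, List.map_append, ih, cum_succ, List.append_assoc]
    refine ⟨fun k => ?_, concat _ hwne, concat_mem_omegaPower hwne hs, fun p => ?_⟩
    · have h1 := hpre 0 (k + 1) (by omega)
      rw [i0] at h1
      refine lt_of_le_of_ne h1.length_le fun he => ?_
      have e := h1.eq_of_length he
      obtain ⟨Q, b, hQ⟩ := h.top (k + 1)
      have := h.label_le 0 (x := (r + (k + 1), b)) (by rw [e, hQ]; simp)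
      simp at this
    · filter_upwards [eventually_ge_atTop (i (p + 1))] with k hk
      obtain ⟨t, ht⟩ := hpre (p + 1) k hk
      rw [← List.getElem?_map, ← ht, List.map_append, hcum, List.append_assoc,
        List.getElem?_append_right (by simp)]
      have hl := le_length_cum hwne (p + 1)
      rw [List.length_map, Nat.add_sub_cancel_left, List.getElem?_append_left (by omega),
        List.getElem?_eq_getElem (by omega)]
      rfl
  · rintro ⟨hlen, τ, hτ, hlim⟩
    obtain ⟨f, f0, fm, hf⟩ := mem_omegaPower_iff.1 hτ
    have hinf : ∀ d, ∀ᶠ k in atTop, d < (Z k).length := by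
      intro d
      filter_upwards [hlim d] with k hk
      rw [Option.map_eq_some_iff] at hk
      obtain ⟨x, hx, _⟩ := hk
      obtain ⟨h1, _⟩ := List.getElem?_eq_some_iff.1 hx
      omega
    -- The time sought is the last one with at most `d` items. A step adds at most one item, so
    -- there are exactly `d` of them, and none of these is popped afterwards.
    have last : ∀ d, (Z 0).length ≤ d → ∃ k, (Z k).length = d ∧ ∀ l, k < l → d < (Z l).length := by
      classical
      intro d hd
      obtain ⟨K, hK⟩ := eventually_atTop.1 (hinf d)
      obtain ⟨k, hk⟩ : ∃ k, k = Nat.findGreatest (fun k => (Z k).length ≤ d) K := ⟨_, rfl⟩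
      have h1 : (Z k).length ≤ d :=
        hk ▸ Nat.findGreatest_spec (P := fun k => (Z k).length ≤ d) (Nat.zero_le _) hd
      have h2 : ∀ l, k < l → d < (Z l).length := by
        intro l hl
        by_cases hlK : l ≤ K
        · have := Nat.findGreatest_is_greatest (P := fun k => (Z k).length ≤ d) (hk ▸ hl) hlK
          omega
        · exact hK l (by omega)
      have h3 := h2 (k + 1) (by omega)
      have h4 := (h.step k).length_le
      rw [List.length_dropLast] at h4
      exact ⟨k, by omega, h2⟩
    choose! κ hκ1 hκ2 using last
    have hpre : ∀ d, (Z 0).length ≤ d → ∀ l, κ d ≤ l → Z (κ d) <+: Z l := by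
      intro d hd l hl
      induction l, hl using Nat.le_induction with
      | base => exact List.prefix_rfl
      | succ l hl ih =>
        have h1 := hκ2 d hd (l + 1) (by omega)
        refine List.IsPrefix.trans (List.prefix_of_prefix_length_le ih (h.step l) ?_)
          (List.dropLast_prefix _)
        rw [List.length_dropLast, hκ1 d hd]
        omega
    have hmono : ∀ d d', (Z 0).length ≤ d → d < d' → κ d < κ d' := by
      intro d d' hd hdd
      by_contra hc
      have h1 := hκ1 d hd
      have h2 := hκ1 d' (by omega)
      rcases Nat.eq_or_lt_of_le (not_lt.1 hc) with e | e
      · rw [e] at h2; omega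
      · have := hκ2 d' (by omega) _ e
        omega
    have hlt : ∀ m, f m < f (m + 1) := fun m => fm (Nat.lt_succ_self m)
    refine ⟨fun m => κ ((Z 0).length + f m), ?_, strictMono_nat_of_lt_succ fun m => ?_, fun m => ?_⟩
    -- All stacks after time `0` are longer than `Z 0`, so the last time with this length is `0`.
    · simp only [f0, Nat.add_zero]
      by_contra hc
      obtain ⟨k, hk⟩ : ∃ k, κ (Z 0).length = k + 1 := ⟨κ (Z 0).length - 1, by omega⟩
      have h1 := hκ1 _ (le_refl (Z 0).length)
      rw [hk] at h1
      have := hlen k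
      omega
    · exact hmono _ _ (by omega) (by have := hlt m; omega)
    · simp only
      set d := (Z 0).length + f m with hd
      set d' := (Z 0).length + f (m + 1) with hd'
      have hdd : d < d' := by have := hlt m; omega
      obtain ⟨t, ht⟩ := hpre d (by omega) (κ d') (hmono d d' (by omega) hdd).le
      obtain ⟨Q, b, hQ⟩ := h.top (κ d)
      refine ⟨Q, b, t, by rw [← ht, hQ]; simp, ?_⟩
      have ht' : t = (Z (κ d')).drop d := by
        rw [← ht]; exact (List.drop_left' (hκ1 d (by omega))).symm
      have e : t.map Prod.snd = seg τ (f m) (f (m + 1) - f m) := by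
        have hlt' : t.length = f (m + 1) - f m := by
          rw [ht', List.length_drop, hκ1 d' (by omega)]; omega
        refine List.ext_getElem (by simpa using hlt') fun j h1 h2 => ?_
        rw [getElem_seg]
        -- A time so late that the letter has reached its limit value; the stack of time `κ d'` is
        -- still intact then, so the letter already stood in it.
        obtain ⟨k, hk1, hk2⟩ := ((hlim (f m + j)).and (eventually_ge_atTop (κ d'))).exists
        obtain ⟨t', ht''⟩ := hpre d' (by omega) k hk2
        rw [length_seg] at h2
        have hj : (Z 0).length + (f m + j) < (Z (κ d')).length := by
          rw [hκ1 d' (by omega)]; omega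
        rw [← ht'', List.getElem?_append_left hj, List.getElem?_eq_getElem hj] at hk1
        simp only [Option.map_some, Option.some.injEq] at hk1
        rw [← hk1]
        rw [List.getElem_map, List.getElem_of_eq ht', List.getElem_drop]
        congr 2
        omega
      rw [e]
      exact hf m

end StackSeq

namespace Sym

/-- The blocks converge to an infinite stack, and `τ` is its part above the root, which is the last
but one item of the first stack. -/
def Converges (B : ℕ → List (ℕ × α)) (τ : ℕ → α) : Prop :=
  (∃ r b A a x, B 0 = (r, b) :: (A ++ [(r, a), x])) ∧ (∀ k, (B 0).length ≤ (B k).length) ∧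
    ∀ p, ∀ᶠ k in atTop, (B k)[(B 0).length - 1 + p]?.map Prod.snd = some (τ p)

/-- The stack of block `k` is taken as `Z (k + 1)`, and the first stack without its pushed item is
put in front as `Z 0`. This absorbs the shift in `B (i (m + 1) - 1)` and reduces the claim to
`StackSeq.path_iff`. -/
theorem Encodes.mem_edge_iff_converges {σ : ℕ → Sym α} {B : ℕ → List (ℕ × α)} (h : Encodes σ B)
    (hg : ∀ k, Good (B k) ∧ Good₂ (B k) (B (k + 1))) {L : Language α} :
    σ ∈ omegaPower (edgeLang L) ↔ ∃ τ ∈ omegaPower L, Converges B τ := by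
  rw [h.mem_edge_iff]
  choose η b X a hB hX using fun k => (hg k).1
  -- Within a block the pushed label is the successor of the header label, and the next header
  -- repeats it; labels thus count the blocks.
  have hη : ∀ k, η (k + 1) = η k + 1 := by
    intro k
    obtain ⟨x, y, hx, hy, hxy⟩ := (hg k).2.1
    rw [hB, ← List.cons_append, List.getLast?_concat] at hx
    rw [hB, List.head?_cons] at hy
    obtain rfl := Option.some.inj hx
    obtain rfl := Option.some.inj hy
    exact hxy.symm
  obtain ⟨r, hr⟩ : ∃ r, r = η 0 := ⟨_, rfl⟩
  have hηk : ∀ k, η k = r + k := by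
    intro k
    induction k with
    | zero => exact hr.symm
    | succ k ih => rw [hη, ih]; rfl
  simp only [hηk] at hB hX
  have hinc : ∀ k, (X k ++ [(r + k + 1, a k)]).Pairwise (·.1 < ·.1) := fun k => by
    have : Trans (fun x y : ℕ × α => x.1 < y.1) (fun x y : ℕ × α => x.1 < y.1)
      (fun x y : ℕ × α => x.1 < y.1) := ⟨fun h1 h2 => lt_trans h1 h2⟩
    exact List.isChain_iff_pairwise.1 (hX k)
  have hstep : ∀ k, X (k + 1) <+: X k ++ [(r + k + 1, a k)] := by
    intro k
    have := flat_prefix (hg k).2.2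
    rwa [hB, hB, List.tail_cons, List.tail_cons, List.dropLast_concat] at this
  have mk : ∀ A c x, X 0 ++ [(r + 0 + 1, a 0)] = A ++ [(r, c), x] → ∃ Z : ℕ → List (ℕ × α),
      Z 0 = A ++ [(r, c)] ∧ (∀ k, Z (k + 1) = X k ++ [(r + k + 1, a k)]) ∧ StackSeq r Z := by
    intro A c x he
    have h2 : X 0 = A ++ [(r, c)] := by
      have := congrArg List.dropLast he
      rwa [List.dropLast_concat, show A ++ [(r, c), x] = (A ++ [(r, c)]) ++ [x] by simp,
        List.dropLast_concat] at this
    refine ⟨fun k => Nat.casesOn k (A ++ [(r, c)]) fun k => X k ++ [(r + k + 1, a k)], rfl,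
      fun k => rfl, ⟨fun k => ?_, fun k => ?_, fun k => ?_⟩⟩
    · cases k with
      | zero => exact ⟨A, c, rfl⟩
      | succ k => exact ⟨X k, a k, rfl⟩
    · cases k with
      | zero => rw [← h2]; exact (List.pairwise_append.1 (hinc 0)).1
      | succ k => exact hinc k
    · cases k with
      | zero => simp only [List.dropLast_concat]; rw [h2]; exact List.prefix_rfl
      | succ k => simp only [List.dropLast_concat]; exact hstep k
  -- The `2` accounts for the header and for the item pushed in block `0`.
  have len0 : ∀ {A c x}, X 0 ++ [(r + 0 + 1, a 0)] = A ++ [(r, c), x] →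
      (B 0).length = (A ++ [(r, c)]).length + 2 := by
    intro A c x he
    rw [hB, he]; simp
  have tr : ∀ Z : ℕ → List (ℕ × α), (∀ k, Z (k + 1) = X k ++ [(r + k + 1, a k)]) →
      (B 0).length = (Z 0).length + 2 → ∀ τ : ℕ → α,
      (((∀ k, (B 0).length ≤ (B k).length) ∧
        ∀ p, ∀ᶠ k in atTop, (B k)[(B 0).length - 1 + p]?.map Prod.snd = some (τ p)) ↔
      ((∀ k, (Z 0).length < (Z (k + 1)).length) ∧
        ∀ p, ∀ᶠ k in atTop, (Z k)[(Z 0).length + p]?.map Prod.snd = some (τ p))) := by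
    intro Z hZ hl τ
    refine and_congr (forall_congr' fun k => ?_) (forall_congr' fun p => ?_)
    · rw [hl, hB k, hZ, List.length_cons]; omega
    · have hev := eventually_map (f := atTop) (m := fun k : ℕ => k + 1)
        (P := fun k => (Z k)[(Z 0).length + p]?.map Prod.snd = some (τ p))
      rw [map_add_atTop_eq_nat] at hev
      rw [hev]
      refine eventually_congr (Eventually.of_forall fun k => ?_)
      rw [hl, hB k, hZ, show (Z 0).length + 2 - 1 + p = (Z 0).length + p + 1 by omega,
        List.getElem?_cons_succ]
  have edge : ∀ Z : ℕ → List (ℕ × α), (∀ k, Z (k + 1) = X k ++ [(r + k + 1, a k)]) →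
      ∀ i : ℕ → ℕ, StrictMono i → ∀ m, ((∃ x b X I a s, B (i m) = (x, b) :: X ∧
        B (i (m + 1) - 1) = I ++ (x, a) :: s ∧ I ≠ [] ∧ s.map Prod.snd ∈ L) ↔
        ∃ I a s, Z (i (m + 1)) = I ++ (r + i m, a) :: s ∧ s.map Prod.snd ∈ L) := by
    intro Z hZ i im m
    obtain ⟨j, hj⟩ : ∃ j, i (m + 1) = j + 1 :=
      ⟨i (m + 1) - 1, by have := im (Nat.lt_succ_self m); simp at this; omega⟩
    rw [hj, Nat.add_sub_cancel, hZ]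
    constructor
    · rintro ⟨x, b', X', I, c, s, e1, e2, hI, hs⟩
      rw [hB] at e1 e2
      obtain ⟨y, I, rfl⟩ := List.exists_cons_of_ne_nil hI
      simp only [List.cons_append, List.cons.injEq, Prod.mk.injEq] at e1 e2
      obtain ⟨⟨rfl, -⟩, -⟩ := e1
      exact ⟨I, c, s, e2.2, hs⟩
    · rintro ⟨I, c, s, e, hs⟩
      exact ⟨_, _, _, (r + j, b j) :: I, c, s, hB _, by rw [hB, e]; rfl, by simp, hs⟩
  constructor
  · rintro ⟨i, i0, im, hi⟩
    -- the root is in the first stack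
    have hroot : ∃ x ∈ X 0, x.1 = r := by
      obtain ⟨x, b', X', I, c, s, e1, e2, hI, hs⟩ := hi 0
      rw [i0, hB] at e1
      obtain ⟨⟨rfl, -⟩, -⟩ := by simpa using e1
      obtain ⟨y, I, rfl⟩ := List.exists_cons_of_ne_nil hI
      rw [hB] at e2
      simp only [List.cons_append, List.cons.injEq] at e2
      -- Labels pushed from block `0` on exceed `r`, so an item labelled `r` must have been in the
      -- stack from the beginning.
      have hback : ∀ j, (∃ x ∈ X j ++ [(r + j + 1, a j)], x.1 = r) → ∃ x ∈ X 0, x.1 = r := by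
        intro j
        induction j with
        | zero =>
          rintro ⟨x, hx, hxr⟩
          rcases List.mem_append.1 hx with h1 | h1
          · exact ⟨x, h1, hxr⟩
          · simp at h1; rw [h1] at hxr; simp at hxr
        | succ j ih =>
          rintro ⟨x, hx, hxr⟩
          rcases List.mem_append.1 hx with h1 | h1
          · exact ih ⟨x, (hstep j).subset h1, hxr⟩
          · simp at h1; rw [h1] at hxr; simp at hxr; omega
      exact hback _ ⟨(r + 0, c), by rw [e2.2]; simp, by simp⟩
    obtain ⟨⟨r', c⟩, hx, rfl⟩ := hroot
    obtain ⟨A, A', hA⟩ := List.append_of_mem hx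
    -- No label fits strictly between that of the root and its successor, the label of the item
    -- pushed in block `0`.
    obtain rfl : A' = [] := by
      have h1 := hinc 0
      rw [hA, List.append_assoc, List.cons_append] at h1
      have h2 := (List.pairwise_cons.1 (List.pairwise_append.1 h1).2.1)
      cases A' with
      | nil => rfl
      | cons y A' =>
        have h3 := h2.1 y (by simp)
        have h4 := (List.pairwise_cons.1 h2.2).1 (r' + 0 + 1, a 0) (by simp)
        simp at h3 h4
        omega
    have he : X 0 ++ [(r' + 0 + 1, a 0)] = A ++ [(r', c), (r' + 0 + 1, a 0)] := by rw [hA]; simp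
    obtain ⟨Z, hZ0, hZ, hS⟩ := mk A c _ he
    obtain ⟨h1, τ, hτ, h2⟩ := hS.path_iff.1 ⟨i, i0, im, fun m => (edge Z hZ i im m).1 (hi m)⟩
    have := (tr Z hZ (by rw [hZ0]; exact len0 he) τ).2 ⟨h1, h2⟩
    exact ⟨τ, hτ, ⟨r', b 0, A, c, _, by rw [hB, he]; rfl⟩, this.1, this.2⟩
  · rintro ⟨τ, hτ, ⟨r', b', A, c, x, e⟩, h1, h2⟩
    rw [hB] at e
    obtain ⟨e1, he⟩ := List.cons.inj e
    obtain rfl : r = r' := by simpa using (Prod.ext_iff.1 e1).1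
    obtain ⟨Z, hZ0, hZ, hS⟩ := mk A c x he
    obtain ⟨h3, h4⟩ := (tr Z hZ (by rw [hZ0]; exact len0 he) τ).1 ⟨h1, h2⟩
    obtain ⟨i, i0, im, hi⟩ := hS.path_iff.2 ⟨h3, τ, hτ, h4⟩
    exact ⟨i, i0, im, fun m => (edge Z hZ i im m).2 (hi m)⟩

end Sym

end Stack

end OmegaPower

/-! ### The Borel class of the omega-power of a history language. -/

namespace OmegaPower

open Filter

section Topology
variable {X : Type} [TopologicalSpace X]

theorem iUnion_countable_mem_Sigma0 {ι : Type*} [Countable ι] [Nonempty ι] {n : ℕ}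
    {A : ι → Set X} (h : ∀ i, A i ∈ Sigma0 (n + 1) X) : ⋃ i, A i ∈ Sigma0 (n + 1) X := by
  obtain ⟨f, hf⟩ := exists_surjective_nat ι
  rw [← hf.iUnion_comp]
  exact iUnion_mem_Sigma0 fun i => h _

/-- Borel sets of a subspace are traces of Borel sets. -/
theorem exists_borel_of_subtype {D : Set X} (n : ℕ) : ∀ A : Set D,
    (A ∈ Sigma0 n D → ∃ A' ∈ Sigma0 n X, A = Subtype.val ⁻¹' A') ∧
    (A ∈ Pi0 n D → ∃ A' ∈ Pi0 n X, A = Subtype.val ⁻¹' A') := by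
  induction n with
  | zero => exact fun A => ⟨fun h => h.elim, fun h => h.elim⟩
  | succ n ih =>
    intro A
    cases n with
    | zero =>
      constructor
      · intro h
        obtain ⟨U, hU, rfl⟩ := isOpen_induced_iff.1 (mem_Sigma0_one.1 h)
        exact ⟨U, hU, rfl⟩
      · intro h
        obtain ⟨U, hU, rfl⟩ := isClosed_induced_iff.1 (mem_Pi0_one.1 h)
        exact ⟨U, hU, rfl⟩
    | succ n =>
      constructor
      · rintro ⟨B, hB, rfl⟩
        choose B' hB' h using fun i => (ih _).2 (hB i)
        exact ⟨⋃ i, B' i, ⟨B', hB', rfl⟩, by simp only [h, Set.preimage_iUnion]⟩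
      · rintro ⟨B, hB, rfl⟩
        choose B' hB' h using fun i => (ih _).1 (hB i)
        exact ⟨⋂ i, B' i, ⟨B', hB', rfl⟩, by simp only [h, Set.preimage_iInter]⟩

theorem IsLocallyConstant.isClosed_setOf {T : Type*} {f : X → T} (hf : IsLocallyConstant f)
    (Q : T → Prop) : IsClosed {x | Q (f x)} :=
  ⟨hf {t | ¬ Q t}⟩

variable {S : Type} [TopologicalSpace S] [DiscreteTopology S]

theorem isLocallyConstant_seg (p n : ℕ) : IsLocallyConstant fun σ : ℕ → S => seg σ p n := by
  refine isLocallyConstant_of_prefix (p + n) fun σ σ' h => ?_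
  refine List.ext_getElem (by simp) fun i h1 h2 => ?_
  rw [length_seg] at h1
  rw [getElem_seg, getElem_seg, h _ (by omega)]

theorem isOpen_at (p : ℕ) (w : List S) : IsOpen {σ : ℕ → S | At σ p w} :=
  isLocallyConstant_seg p w.length {w}

end Topology

namespace Sym
variable {α : Type}

instance : TopologicalSpace (Sym α) := ⊥

instance : DiscreteTopology (Sym α) := ⟨rfl⟩

/-- The infinite words that are valid stack histories. -/
def valid : Set (ℕ → Sym α) :=
  {σ | σ 0 = hash ∧ (¬ ∃ p, ∃ b ∈ Bad, At σ p b) ∧ ∀ n, ∃ p, n ≤ p ∧ σ p = dollar}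

theorem isOpen_ne_hash : IsOpen {σ : ℕ → Sym α | σ 0 ≠ hash} :=
  (isOpen_discrete {x : Sym α | x ≠ hash}).preimage (f := fun σ : ℕ → Sym α => σ 0)
    (continuous_apply 0)

theorem isOpen_bad : IsOpen {σ : ℕ → Sym α | ∃ p, ∃ b ∈ Bad, At σ p b} := by
  have : {σ : ℕ → Sym α | ∃ p, ∃ b ∈ Bad, At σ p b} = ⋃ p, ⋃ b ∈ Bad, {σ | At σ p b} := by
    ext σ; simp
  rw [this]
  exact isOpen_iUnion fun p => isOpen_biUnion fun b _ => isOpen_at p b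

/-- Only the condition on `dollar` fails to be closed. It cannot be enforced by bad words, because a
block that never ends need not contain a finite error. -/
theorem valid_mem_Pi0 : (valid : Set (ℕ → Sym α)) ∈ Pi0 2 (ℕ → Sym α) := by
  have h1 : IsClosed {σ : ℕ → Sym α | σ 0 = hash} := by
    have := (isOpen_ne_hash (α := α)).isClosed_compl
    convert this using 1
    ext σ; simp
  have h2 := (isOpen_bad (α := α)).isClosed_compl
  have h3 : (⋂ n : ℕ, ⋃ p : ℕ, {σ : ℕ → Sym α | n ≤ p ∧ σ p = dollar}) ∈ Pi0 2 (ℕ → Sym α) := by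
    refine ⟨_, fun n => mem_Sigma0_one.2 (isOpen_iUnion fun p => ?_), rfl⟩
    by_cases h : n ≤ p
    · simp only [h, true_and]
      exact (isOpen_discrete {dollar}).preimage (f := fun σ : ℕ → Sym α => σ p) (continuous_apply p)
    · simp [h]
  have h12 := Pi0_mono le_rfl one_le_two (mem_Pi0_one.2 (h1.inter h2))
  convert inter_mem_Pi0 h12 h3 using 1
  ext σ
  simp [valid, and_assoc]

theorem exists_blocks (σ : (valid : Set (ℕ → Sym α))) : ∃ B, Encodes σ.1 B := by
  obtain ⟨σ, h0, hb, hinf⟩ := σ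
  refine exists_encodes h0 (fun p => ?_) hinf
  by_contra hc
  refine hb ⟨p, _, .inl ⟨_, _, hc, rfl⟩, ?_⟩
  simp [at_cons]

/-- The sequence of blocks of a valid stack history. -/
noncomputable def blocks (σ : (valid : Set (ℕ → Sym α))) : ℕ → List (ℕ × α) :=
  (exists_blocks σ).choose

theorem encodes_blocks (σ : (valid : Set (ℕ → Sym α))) : Encodes σ.1 (blocks σ) :=
  (exists_blocks σ).choose_spec

/-- Parsing proceeds from left to right, so a finite part of the word fixes the first blocks. Local
constancy of `blocks` follows from this. -/
theorem Encodes.congr {σ' : ℕ → Sym α} {B B' : ℕ → List (ℕ × α)} (h' : Encodes σ' B') (k : ℕ)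
    (hk : At σ' 0 (cum (fun k => block (B k)) k)) : ∀ j < k, B' j = B j := by
  have key : ∀ j ≤ k, cum (fun k => block (B' k)) j = cum (fun k => block (B k)) j ∧
      ∀ i < j, B' i = B i := by
    intro j
    induction j with
    | zero => simp [cum_zero]
    | succ j ih =>
      intro hj
      obtain ⟨ih1, ih2⟩ := ih (by omega)
      obtain ⟨t, ht⟩ := cum_prefix (fun k => block (B k)) hj
      rw [← ht, cum_succ, at_append, at_append, ← ih1] at hk
      have e := at_block_inj (h'.at_block j) (by rw [cut]; simpa using hk.1.2)
      refine ⟨by rw [cum_succ, cum_succ, ih1, e], fun i hi => ?_⟩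
      rcases Nat.lt_succ_iff_lt_or_eq.1 hi with h | rfl
      · exact ih2 i h
      · exact e
  exact (key k le_rfl).2

theorem isLocallyConstant_blocks (k : ℕ) :
    IsLocallyConstant fun σ : (valid : Set (ℕ → Sym α)) => blocks σ k := by
  rw [IsLocallyConstant.iff_eventually_eq]
  intro σ
  have ho : IsOpen {σ' : (valid : Set (ℕ → Sym α)) |
      At σ'.1 0 (cum (fun k => block (blocks σ k)) (k + 1))} :=
    (isOpen_at _ _).preimage continuous_subtype_val
  filter_upwards [ho.mem_nhds ((encodes_blocks σ).2 (k + 1))] with σ' hσ'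
  exact (encodes_blocks σ').congr (k + 1) hσ' k (Nat.lt_succ_self k)

theorem Converges.unique {B : ℕ → List (ℕ × α)} {τ τ' : ℕ → α} (h : Converges B τ)
    (h' : Converges B τ') : τ = τ' := by
  funext p
  obtain ⟨k, h1, h2⟩ := ((h.2.2 p).and (h'.2.2 p)).exists
  rw [h1] at h2
  exact Option.some.inj h2

theorem isClosed_blocks (k : ℕ) (Q : List (ℕ × α) → List (ℕ × α) → Prop) :
    IsClosed {σ : (valid : Set (ℕ → Sym α)) | Q (blocks σ 0) (blocks σ k)} :=
  IsLocallyConstant.isClosed_setOf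
    (f := fun σ : (valid : Set (ℕ → Sym α)) => (blocks σ 0, blocks σ k))
    ((isLocallyConstant_blocks 0).prodMk (isLocallyConstant_blocks k)) fun x => Q x.1 x.2

theorem exists_stop_of_mem_edge {L : Language α} {σ : ℕ → Sym α}
    (h : σ ∈ omegaPower (edgeLang L)) (n : ℕ) : ∃ p, n ≤ p ∧ σ p = dollar := by
  obtain ⟨f, f0, fm, hf⟩ := mem_omegaPower_iff.1 h
  have hm : dollar ∈ seg σ (f n) (f (n + 1) - f n) := by
    obtain ⟨x, b, ⟨I, a, s, hw, _⟩ | ⟨z, y, I, a, s, hw, _⟩⟩ := hf n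
    · rw [hw]; simp [block]
    · rw [hw]; simp [block]
  obtain ⟨i, hi, e⟩ := List.getElem_of_mem hm
  rw [getElem_seg] at e
  exact ⟨f n + i, (fm.id_le n).trans (Nat.le_add_right _ _), e⟩

/-- Every edge word contains `dollar`, so a factorization into edge words already forces infinitely
many blocks; validity is a consequence and not an extra demand. -/
theorem mem_histLang_iff_valid {L : Language α} {σ : ℕ → Sym α} : σ ∈ omegaPower (histLang L) ↔
    (σ 0 ≠ hash ∨ ∃ p, ∃ b ∈ Bad, At σ p b) ∨
      ∃ h : σ ∈ valid, ∃ τ ∈ omegaPower L, Converges (blocks ⟨σ, h⟩) τ := by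
  rw [mem_histLang_iff, ← or_assoc]
  by_cases h : σ 0 ≠ hash ∨ ∃ p, ∃ b ∈ Bad, At σ p b
  · simp [h]
  · simp only [h, false_or]
    push Not at h
    have hb : ¬ ∃ p, ∃ b ∈ Bad, At σ p b := by push Not; exact h.2
    have key : ∀ hv : σ ∈ valid, σ ∈ omegaPower (edgeLang L) ↔
        ∃ τ ∈ omegaPower L, Converges (blocks ⟨σ, hv⟩) τ := fun hv =>
      (encodes_blocks ⟨σ, hv⟩).mem_edge_iff_converges
        ((encodes_blocks ⟨σ, hv⟩).no_bad_iff.1 hb)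
    constructor
    · intro he
      have hv : σ ∈ valid := ⟨h.1, hb, exists_stop_of_mem_edge he⟩
      exact ⟨hv, (key hv).1 he⟩
    · rintro ⟨hv, he⟩
      exact (key hv).2 he

theorem isOpen_exit : IsOpen {σ : ℕ → Sym α | σ 0 ≠ hash ∨ ∃ p, ∃ b ∈ Bad, At σ p b} :=
  isOpen_ne_hash.union isOpen_bad

section
variable [Nonempty α]

open Classical in
/-- The limit of the stacks above the root. -/
noncomputable def limit (σ : (valid : Set (ℕ → Sym α))) : ℕ → α :=
  if h : ∃ τ, Converges (blocks σ) τ then h.choose else fun _ => Classical.arbitrary α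

theorem converges_limit {σ : (valid : Set (ℕ → Sym α))} (h : ∃ τ, Converges (blocks σ) τ) :
    Converges (blocks σ) (limit σ) := by
  rw [limit, dif_pos h]
  exact h.choose_spec

theorem histLang_eq (L : Language α) : omegaPower (histLang L) =
    {σ | σ 0 ≠ hash ∨ ∃ p, ∃ b ∈ Bad, At σ p b} ∪ Subtype.val ''
      ({σ : (valid : Set (ℕ → Sym α)) | ∃ τ, Converges (blocks σ) τ} ∩
        {σ | limit σ ∈ omegaPower L}) := by
  ext σ
  rw [mem_histLang_iff_valid]
  refine or_congr Iff.rfl ?_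
  constructor
  · rintro ⟨hv, τ, hτ, hc⟩
    refine ⟨⟨σ, hv⟩, ⟨⟨τ, hc⟩, ?_⟩, rfl⟩
    rwa [Set.mem_ofPred_eq, (converges_limit ⟨τ, hc⟩).unique hc]
  · rintro ⟨σ, ⟨h1, h2⟩, rfl⟩
    exact ⟨σ.2, _, h2, converges_limit h1⟩

end

section
variable [Countable α] [Nonempty α]

/-- That position `p` settles means that there are a letter and a time from which on the letter
stays, a countable union of closed conditions. The quantifier over `p` gives Π⁰₃, and the other two
conditions are closed. -/
theorem convergent_mem_Pi0 :
    {σ : (valid : Set (ℕ → Sym α)) | ∃ τ, Converges (blocks σ) τ} ∈ Pi0 3 valid := by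
  have h1 : {σ : (valid : Set (ℕ → Sym α)) | ∃ r b A a x,
      blocks σ 0 = (r, b) :: (A ++ [(r, a), x])} ∈ Pi0 3 valid :=
    Pi0_mono le_rfl (by omega) (mem_Pi0_one.2
      (isClosed_blocks 0 fun B _ => ∃ r b A a x, B = (r, b) :: (A ++ [(r, a), x])))
  have h2 : (⋂ k, {σ : (valid : Set (ℕ → Sym α)) | (blocks σ 0).length ≤ (blocks σ k).length}) ∈
      Pi0 3 valid :=
    Pi0_mono le_rfl (by omega) (mem_Pi0_one.2 (isClosed_iInter fun k =>
      isClosed_blocks k fun B B' => B.length ≤ B'.length))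
  have h3 : (⋂ p, ⋃ x : α × ℕ, ⋂ k, {σ : (valid : Set (ℕ → Sym α)) | x.2 ≤ k →
      (blocks σ k)[(blocks σ 0).length - 1 + p]?.map Prod.snd = some x.1}) ∈ Pi0 3 valid := by
    refine ⟨_, fun p => iUnion_countable_mem_Sigma0 (n := 1) fun x => ?_, rfl⟩
    refine Pi0_subset_Sigma0 le_rfl one_lt_two (mem_Pi0_one.2 (isClosed_iInter fun k => ?_))
    exact isClosed_blocks k fun B B' => x.2 ≤ k → B'[B.length - 1 + p]?.map Prod.snd = some x.1
  convert inter_mem_Pi0 (inter_mem_Pi0 h1 h2) h3 using 1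
  ext σ
  simp only [Set.mem_ofPred_eq, Set.mem_inter_iff, Set.mem_iInter, Set.mem_iUnion]
  constructor
  · rintro ⟨τ, h1, h2, h3⟩
    refine ⟨⟨h1, h2⟩, fun p => ?_⟩
    obtain ⟨K, hK⟩ := eventually_atTop.1 (h3 p)
    exact ⟨(τ p, K), hK⟩
  · rintro ⟨⟨h1, h2⟩, h3⟩
    choose x hx using h3
    exact ⟨fun p => (x p).1, h1, h2, fun p => eventually_atTop.2 ⟨_, hx p⟩⟩

variable [TopologicalSpace α] [DiscreteTopology α]

/-- Where the stacks converge, the limit lies in `U` exactly when some finite word whose cylinder is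
contained in `U` stands directly above the root at all sufficiently late times. This is a countable
union of closed conditions. -/
theorem limit_preimage (U : Set (ℕ → α)) (hU : IsOpen U) :
    ∃ G ∈ Sigma0 2 (valid : Set (ℕ → Sym α)),
      ∀ σ ∈ {σ : (valid : Set (ℕ → Sym α)) | ∃ τ, Converges (blocks σ) τ},
        limit σ ∈ U ↔ σ ∈ G := by
  refine ⟨⋃ x : List α × ℕ, ⋂ k, {σ : (valid : Set (ℕ → Sym α)) |
    (∀ τ, At τ 0 x.1 → τ ∈ U) ∧ (x.2 ≤ k →
      (((blocks σ k).drop ((blocks σ 0).length - 1)).map Prod.snd).take x.1.length = x.1)},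
    iUnion_countable_mem_Sigma0 fun x => ?_, fun σ hσ => ?_⟩
  · refine Pi0_subset_Sigma0 le_rfl one_lt_two (mem_Pi0_one.2 (isClosed_iInter fun k => ?_))
    exact isClosed_blocks k fun B B' => (∀ τ, At τ 0 x.1 → τ ∈ U) ∧ (x.2 ≤ k →
      ((B'.drop (B.length - 1)).map Prod.snd).take x.1.length = x.1)
  · have hlim := (converges_limit hσ).2.2
    simp only [Set.mem_iUnion, Set.mem_iInter, Set.mem_ofPred_eq]
    have hiff : ∀ w : List α, At (limit σ) 0 w ↔ ∀ᶠ k in atTop,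
        (((blocks σ k).drop ((blocks σ 0).length - 1)).map Prod.snd).take w.length = w := by
      intro w
      have hev : ∀ᶠ k in atTop, ∀ p ∈ Finset.range w.length,
          (blocks σ k)[(blocks σ 0).length - 1 + p]?.map Prod.snd = some (limit σ p) :=
        (Finset.eventually_all _).2 fun p _ => hlim p
      have hev' : ∀ᶠ k in atTop,
          (((blocks σ k).drop ((blocks σ 0).length - 1)).map Prod.snd).take w.length =
            seg (limit σ) 0 w.length := by
        filter_upwards [hev] with k hk
        refine List.ext_getElem? fun i => ?_
        rw [List.getElem?_take]
        by_cases hi : i < w.length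
        · rw [if_pos hi, List.getElem?_map, List.getElem?_drop, hk i (Finset.mem_range.2 hi),
            List.getElem?_eq_getElem (by simpa using hi), getElem_seg, zero_add]
        · rw [if_neg hi, List.getElem?_eq_none (by simpa using hi)]
      constructor
      · intro h
        filter_upwards [hev'] with k hk
        rw [hk]
        exact h
      · intro h
        obtain ⟨k, h1, h2⟩ := (h.and hev').exists
        exact (h1.symm.trans h2).symm
    constructor
    · intro h
      obtain ⟨t, ht⟩ := exists_prefix_of_isOpen hU h
      obtain ⟨K, hK⟩ := eventually_atTop.1 ((hiff (seg (limit σ) 0 t)).1 (at_seg _ _ _))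
      refine ⟨(_, K), fun k => ⟨fun τ hτ => ht τ fun i hi => ?_, hK k⟩⟩
      have h1 : i < (seg (limit σ) 0 t).length := by simpa using hi
      have h2 := at_iff_getElem.1 hτ i h1
      have h3 := getElem_seg (limit σ) 0 t i h1
      rw [zero_add] at h2 h3
      exact h2.trans h3
    · rintro ⟨⟨w, K⟩, h⟩
      exact (h 0).1 _ ((hiff w).2 (eventually_atTop.2 ⟨K, fun k hk => (h k).2 hk⟩))

/-- The preimage under `limit` costs one level. The Π⁰₃ domain of convergence fits into the target
class from level `3` on; on the additive side it fits only from level `4` on. -/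
theorem histLang_mem_Pi0 {L : Language α} {n : ℕ}
    (hL : omegaPower L ∈ Pi0 (n + 2) (ℕ → α)) :
    omegaPower (histLang L) ∈ Pi0 (n + 3) (ℕ → Sym α) := by
  rw [histLang_eq]
  refine union_mem_Pi0 (Sigma0_subset_Pi0 le_rfl (by omega) (mem_Sigma0_one.2 isOpen_exit)) ?_
  obtain ⟨G, hG, hD⟩ := (exists_borel_preimage limit_preimage (n + 1) _).2 hL
  have h1 := inter_mem_Pi0 (Pi0_mono (n := n + 3) (by omega) (by omega)
    (convergent_mem_Pi0 (α := α))) hG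
  obtain ⟨A', hA', he⟩ := (exists_borel_of_subtype _ _).2 h1
  have h2 : {σ : (valid : Set (ℕ → Sym α)) | ∃ τ, Converges (blocks σ) τ} ∩
      {σ | limit σ ∈ omegaPower L} = Subtype.val ⁻¹' A' := by
    rw [← he]
    ext σ
    exact and_congr_right fun h => hD σ h
  rw [h2, Subtype.image_preimage_coe]
  exact inter_mem_Pi0 (Pi0_mono (by omega) (by omega) valid_mem_Pi0) hA'

theorem histLang_mem_Sigma0 {L : Language α} {n : ℕ}
    (hL : omegaPower L ∈ Sigma0 (n + 3) (ℕ → α)) :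
    omegaPower (histLang L) ∈ Sigma0 (n + 4) (ℕ → Sym α) := by
  rw [histLang_eq]
  refine union_mem_Sigma0 (Sigma0_mono le_rfl (by omega) (mem_Sigma0_one.2 isOpen_exit)) ?_
  obtain ⟨G, hG, hD⟩ := (exists_borel_preimage limit_preimage (n + 2) _).1 hL
  have h1 := inter_mem_Sigma0 (Pi0_subset_Sigma0 (n := n + 4) (by omega) (by omega)
    (convergent_mem_Pi0 (α := α))) hG
  obtain ⟨A', hA', he⟩ := (exists_borel_of_subtype _ _).1 h1
  have h2 : {σ : (valid : Set (ℕ → Sym α)) | ∃ τ, Converges (blocks σ) τ} ∩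
      {σ | limit σ ∈ omegaPower L} = Subtype.val ⁻¹' A' := by
    rw [← he]
    ext σ
    exact and_congr_right fun h => hD σ h
  rw [h2, Subtype.image_preimage_coe]
  exact inter_mem_Sigma0 (Pi0_subset_Sigma0 (by omega) (by omega) valid_mem_Pi0) hA'

end

end Sym

end OmegaPower

/-! ### Hardness: stacks that follow a convergent sequence of infinite words. -/

namespace OmegaPower

open Filter

namespace Sym

section Construction
variable {α : Type}

/-- The length of the longest common prefix of the letters of a stack and a word. -/
noncomputable def agree (T : List (ℕ × α)) (s : List α) : ℕ :=
  @Nat.findGreatest (fun q => ∀ i < q, T[i]?.map Prod.snd = s[i]?) (Classical.decPred _) T.length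

theorem agree_le (T : List (ℕ × α)) (s : List α) : agree T s ≤ T.length :=
  @Nat.findGreatest_le _ (Classical.decPred _) _

theorem agree_spec (T : List (ℕ × α)) (s : List α) :
    ∀ i < agree T s, T[i]?.map Prod.snd = s[i]? := by
  exact @Nat.findGreatest_spec 0 (fun q => ∀ i < q, T[i]?.map Prod.snd = s[i]?)
    (Classical.decPred _) _ (Nat.zero_le _) (by simp)

theorem le_agree {T : List (ℕ × α)} {s : List α} {q : ℕ} (hq : q ≤ T.length)
    (h : ∀ i < q, T[i]?.map Prod.snd = s[i]?) : q ≤ agree T s := by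
  exact @Nat.le_findGreatest q (fun q => ∀ i < q, T[i]?.map Prod.snd = s[i]?)
    (Classical.decPred _) _ hq h

/-- Pop the items that disagree with `s` and push one more letter of `s`, with label `k`. -/
noncomputable def nextStack (a₀ : α) (k : ℕ) (T : List (ℕ × α)) (s : List α) : List (ℕ × α) :=
  T.take (agree T s) ++ [(k, s.getD (agree T s) a₀)]

/-- The stacks that follow a sequence of infinite words. -/
noncomputable def follow (a₀ : α) (z : ℕ → ℕ → α) : ℕ → List (ℕ × α)
  | 0 => []
  | k + 1 => nextStack a₀ (k + 1) (follow a₀ z k) (seg (z (k + 1)) 0 (k + 1))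

variable (a₀ : α) (z : ℕ → ℕ → α)

theorem length_follow_succ (k : ℕ) : (follow a₀ z (k + 1)).length =
    agree (follow a₀ z k) (seg (z (k + 1)) 0 (k + 1)) + 1 := by
  rw [follow, nextStack, List.length_append, List.length_take, min_eq_left (agree_le _ _)]
  rfl

theorem length_follow_le (k : ℕ) : (follow a₀ z k).length ≤ k := by
  induction k with
  | zero => simp [follow]
  | succ k ih =>
    rw [length_follow_succ]
    have := agree_le (follow a₀ z k) (seg (z (k + 1)) 0 (k + 1))
    omega

theorem getElem?_seg {σ : ℕ → α} {n i : ℕ} (h : i < n) : (seg σ 0 n)[i]? = some (σ i) := by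
  rw [List.getElem?_eq_getElem (by simpa using h), getElem_seg, zero_add]

/-- At each time the stack spells a prefix of the current approximation: the items kept agree with
it by the choice of `agree`, and the pushed letter is its next one. -/
theorem follow_getElem? (k i : ℕ) (hi : i < (follow a₀ z k).length) :
    (follow a₀ z k)[i]?.map Prod.snd = some (z k i) := by
  cases k with
  | zero => simp [follow] at hi
  | succ k =>
    have h1 := agree_le (follow a₀ z k) (seg (z (k + 1)) 0 (k + 1))
    have h2 := length_follow_le a₀ z k
    have h3 := agree_spec (follow a₀ z k) (seg (z (k + 1)) 0 (k + 1)) i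
    rw [length_follow_succ] at hi
    rw [follow, nextStack]
    generalize agree (follow a₀ z k) (seg (z (k + 1)) 0 (k + 1)) = q at *
    rcases Nat.lt_succ_iff_lt_or_eq.1 hi with h | rfl
    · rw [List.getElem?_append_left (by simp; omega), List.getElem?_take, if_pos h, h3 h,
        getElem?_seg (by omega)]
    · rw [List.getElem?_append_right (by simp)]
      simp only [List.length_take, min_eq_left h1, Nat.sub_self, List.getElem?_cons_zero,
        Option.map_some, Option.some.injEq]
      rw [List.getD_eq_getElem?_getD, getElem?_seg (by omega)]
      rfl

theorem follow_labels (k : ℕ) : (follow a₀ z k).Pairwise (·.1 < ·.1) ∧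
    ∀ x ∈ follow a₀ z k, 1 ≤ x.1 ∧ x.1 ≤ k := by
  induction k with
  | zero => simp [follow]
  | succ k ih =>
    rw [follow, nextStack]
    constructor
    · rw [List.pairwise_append]
      refine ⟨ih.1.sublist (List.take_sublist _ _), by simp, fun x hx y hy => ?_⟩
      obtain rfl := List.mem_singleton.1 hy
      have := (ih.2 x (List.mem_of_mem_take hx)).2
      simp only
      omega
    · intro x hx
      rcases List.mem_append.1 hx with h | h
      · have := ih.2 x (List.mem_of_mem_take h)
        omega
      · obtain rfl := List.mem_singleton.1 h
        simp

/-- The blocks that follow a sequence of infinite words. -/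
noncomputable def followBlock (k : ℕ) : List (ℕ × α) :=
  (k, a₀) :: (0, a₀) :: follow a₀ z (k + 1)

/-- The item `(0, a₀)` serves as root; it fits below the stack because the labels in `follow` start
at `1`. -/
theorem followBlock_good (k : ℕ) : Good (followBlock a₀ z k) := by
  obtain ⟨h1, h2⟩ := follow_labels a₀ z (k + 1)
  have h3 : ((0, a₀) :: follow a₀ z (k + 1)).IsChain (·.1 < ·.1) :=
    (List.pairwise_cons.2 ⟨fun x hx => (h2 x hx).1, h1⟩).isChain
  exact ⟨k, a₀, (0, a₀) :: (follow a₀ z k).take _, _, rfl, h3⟩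

theorem followBlock_good₂ (k : ℕ) : Good₂ (followBlock a₀ z k) (followBlock a₀ z (k + 1)) := by
  refine ⟨⟨(k + 1, (seg (z (k + 1)) 0 (k + 1)).getD
      (agree (follow a₀ z k) (seg (z (k + 1)) 0 (k + 1))) a₀), _, ?_, rfl, rfl⟩, prefix_flat ?_⟩
  · rw [followBlock, follow, nextStack, ← List.cons_append, ← List.cons_append,
      List.getLast?_concat]
  · rw [followBlock, followBlock, List.tail_cons, List.tail_cons, follow.eq_2 a₀ z (k + 1),
      nextStack, ← List.cons_append, List.dropLast_concat, List.prefix_cons_inj]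
    exact List.take_prefix _ _

variable {z}

/-- Once an initial part of the approximations is constant, the stack is never popped below what it
has reached of this part, and it grows until the part is complete. -/
theorem followBlock_converges {l : ℕ → α} (h : ∀ p, ∀ᶠ t in atTop, z t p = l p) :
    Converges (followBlock a₀ z) l := by
  have h1 : follow a₀ z 1 = [(1, (seg (z 1) 0 1).getD 0 a₀)] := by
    simp [follow, nextStack, agree]
  have h0 : followBlock a₀ z 0 = [(0, a₀), (0, a₀), (1, (seg (z 1) 0 1).getD 0 a₀)] := by
    rw [followBlock, h1]
  refine ⟨⟨0, a₀, [], a₀, _, h0⟩, fun k => ?_, fun p => ?_⟩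
  · rw [h0, followBlock]
    simp [length_follow_succ]
  · have hK : ∀ᶠ t in atTop, ∀ i ∈ Finset.range (p + 1), z t i = l i :=
      (Finset.eventually_all _).2 fun i _ => h i
    obtain ⟨K, hK⟩ := eventually_atTop.1 hK
    -- From time `K` on the approximations agree with the limit on `p + 1` letters, so each further
    -- step secures one more of them.
    have hgrow : ∀ j, min j (p + 1) ≤ (follow a₀ z (K + j)).length := by
      intro j
      induction j with
      | zero => simp
      | succ j ih =>
        rw [← Nat.add_assoc, length_follow_succ]
        have h2 := length_follow_le a₀ z (K + j)
        have h3 : min j (p + 1) ≤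
            agree (follow a₀ z (K + j)) (seg (z (K + j + 1)) 0 (K + j + 1)) := by
          refine le_agree ih fun i hi => ?_
          rw [follow_getElem? a₀ z _ _ (by omega), getElem?_seg (by omega),
            hK (K + j) (by omega) i (by simp; omega), hK (K + j + 1) (by omega) i (by simp; omega)]
        omega
    filter_upwards [eventually_ge_atTop (K + (p + 1))] with k hk
    obtain ⟨j, rfl⟩ := Nat.exists_eq_add_of_le (show K ≤ k by omega)
    have h4 := hgrow (j + 1)
    rw [← Nat.add_assoc] at h4
    rw [h0, followBlock, List.length_cons, List.length_cons, List.length_singleton,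
      show 0 + 1 + 1 + 1 - 1 + p = p + 1 + 1 by omega, List.getElem?_cons_succ,
      List.getElem?_cons_succ, follow_getElem? a₀ z _ _ (by omega),
      hK _ (by omega) p (by simp)]

end Construction

variable {α : Type} [TopologicalSpace α] [DiscreteTopology α] [Nonempty α]

/-- The blocks are always valid and converge to `l y`, so acceptance is decided by the limit alone.
Continuity holds because each block depends on finitely many letters of finitely many
approximations. -/
theorem reduce_histLang {L : Language α} {Y : Type} [TopologicalSpace Y]
    {A : Set (ℕ → Y)} {z : ℕ → (ℕ → Y) → ℕ → α} {l : (ℕ → Y) → ℕ → α}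
    (hz : ∀ t, Continuous (z t)) (hl : ∀ y p, ∀ᶠ t in atTop, z t y p = l y p)
    (hA : ∀ y, y ∈ A ↔ l y ∈ omegaPower L) : WadgeReducible A (omegaPower (histLang L)) := by
  obtain ⟨a₀⟩ := ‹Nonempty α›
  let B : (ℕ → Y) → ℕ → List (ℕ × α) := fun y => followBlock a₀ fun t => z t y
  have hne : ∀ y k, block (B y k) ≠ [] := fun y k => block_ne_nil _
  have hT : ∀ k, IsLocallyConstant fun y => follow a₀ (fun t => z t y) k := by
    intro k
    induction k with
    | zero => exact IsLocallyConstant.const _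
    | succ k ih =>
      have h1 : IsLocallyConstant fun y => seg (z (k + 1) y) 0 (k + 1) :=
        (isLocallyConstant_seg 0 (k + 1)).comp_continuous (hz (k + 1))
      exact ih.comp₂ h1 (nextStack a₀ (k + 1))
  refine ⟨fun y => concat (fun k => block (B y k)) (hne y), continuous_concat hne fun k =>
    (hT (k + 1)).comp fun T => block ((k, a₀) :: (0, a₀) :: T), ?_⟩
  ext y
  have henc : Encodes (concat (fun k => block (B y k)) (hne y)) (B y) :=
    ⟨fun k => by simp [B, followBlock], fun k => at_cum (hne y) k⟩
  have hg : ∀ k, Good (B y k) ∧ Good₂ (B y k) (B y (k + 1)) := fun k =>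
    ⟨followBlock_good a₀ _ k, followBlock_good₂ a₀ _ k⟩
  have h0 : concat (fun k => block (B y k)) (hne y) 0 = hash := (at_cons.1 (henc.at_block 0)).1
  have hconv : Converges (B y) (l y) := followBlock_converges a₀ (hl y)
  rw [Set.mem_preimage, mem_histLang_iff, henc.mem_edge_iff_converges hg, hA]
  have hb := henc.no_bad_iff.2 hg
  simp only [h0, hb, ne_eq, not_true_eq_false, false_or]
  constructor
  · intro h
    exact ⟨_, h, hconv⟩
  · rintro ⟨τ, hτ, hc⟩
    rwa [hconv.unique hc]

variable [Countable α]

theorem isComplete_histLang_Pi0 {L : Language α} {n : ℕ}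
    (h : IsComplete (Pi0 (n + 2)) (omegaPower L)) :
    IsComplete (Pi0 (n + 3)) (omegaPower (histLang L)) := by
  refine ⟨histLang_mem_Pi0 h.1, fun Y _ _ _ A hA => ?_⟩
  obtain ⟨F, hF, A', hA', hiff⟩ := (exists_characteristic (n + 1) A).2 hA
  obtain ⟨z, l, h1, h2, h3⟩ := exists_limit hF (h.2 Bool A' hA') hiff
  exact reduce_histLang h1 h2 h3

theorem isComplete_histLang_Sigma0 {L : Language α} {n : ℕ}
    (h : IsComplete (Sigma0 (n + 3)) (omegaPower L)) :
    IsComplete (Sigma0 (n + 4)) (omegaPower (histLang L)) := by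
  refine ⟨histLang_mem_Sigma0 h.1, fun Y _ _ _ A hA => ?_⟩
  obtain ⟨F, hF, A', hA', hiff⟩ := (exists_characteristic (n + 2) A).1 hA
  obtain ⟨z, l, h1, h2, h3⟩ := exists_limit hF (h.2 Bool A' hA') hiff
  exact reduce_histLang h1 h2 h3

end Sym

end OmegaPower

/-! ### Fragments that read items and stacks. -/

namespace OmegaPower

namespace Sym

open Frag

local infixr:65 " ⬝ " => Frag.seq

/-- The letters of a history alphabet as numbers. -/
def code {m : ℕ} : Sym (Fin m) → ℕ
  | hash => 0
  | tick => 1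
  | dollar => 2
  | letter a => a + 3

/-- The codes of the proper letters. -/
def letters (m : ℕ) : List ℕ := (List.range m).map (· + 3)

/-- Reads an item. -/
def item (m : ℕ) : Frag := star (keep [1]) ⬝ keep (letters m)

/-- Reads a list of items. -/
def items (m : ℕ) : Frag := star (item m)

/-- Reads a list of items and adds its length to the counter. -/
def pushItems (m : ℕ) : Frag := star (star (push [1]) ⬝ push (letters m))

/-- Reads a list of items and subtracts its length from the counter. -/
def popItems (m : ℕ) : Frag := star (star (pop [1]) ⬝ pop (letters m))

/-- Reads a letter `z` inside of a list of items and the rest of this list. -/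
def tailFrom (m z : ℕ) : Frag :=
  keep [z] ⬝ if z = 1 then item m ⬝ items m else items m

/-- Reads any word. -/
def anyWord (m : ℕ) : Frag := star (keep (0 :: 1 :: 2 :: letters m))

section Rel
variable {m : ℕ} {c c' : ℕ} {w : List (Sym (Fin m))} {G : Frag}

theorem code_injective : Function.Injective (code (m := m)) := by
  intro x y h
  cases x <;> cases y <;> (simp [code, Fin.ext_iff] at h ⊢; try omega)

theorem code_mem_letters {x : Sym (Fin m)} : code x ∈ letters m ↔ ∃ a, x = letter a := by
  cases x <;> simp [code, letters]

theorem code_eq_zero {x : Sym (Fin m)} : code x = 0 ↔ x = hash :=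
  code_injective.eq_iff (b := hash)

theorem code_eq_one {x : Sym (Fin m)} : code x = 1 ↔ x = tick :=
  code_injective.eq_iff (b := tick)

theorem code_eq_two {x : Sym (Fin m)} : code x = 2 ↔ x = dollar :=
  code_injective.eq_iff (b := dollar)

theorem wf_item : (item m).WF := by simp [item]
theorem wf_items : (items m).WF := by simp [items, wf_item]
theorem wf_pushItems : (pushItems m).WF := wf_star (wf_seq (wf_star (wf_push _)) (wf_push _))
theorem wf_popItems : (popItems m).WF := wf_star (wf_seq (wf_star (wf_pop _)) (wf_pop _))
theorem wf_anyWord : (anyWord m).WF := by simp [anyWord]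
theorem wf_tailFrom {z : ℕ} : (tailFrom m z).WF := by
  unfold tailFrom
  split_ifs <;> simp [wf_item, wf_items]

attribute [simp] wf_item wf_items wf_pushItems wf_popItems wf_anyWord wf_tailFrom

theorem rel_hash_seq : rel code (keep [0] ⬝ G) c w c' ↔ ∃ v, w = hash :: v ∧ rel code G c v c' := by
  rw [rel_seq (wf_keep _)]
  simp only [rel_keep, List.mem_singleton, code_eq_zero]
  constructor
  · rintro ⟨_, v, _, rfl, ⟨_, rfl, rfl, rfl⟩, h⟩
    exact ⟨v, rfl, h⟩
  · rintro ⟨v, rfl, h⟩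
    exact ⟨_, v, _, rfl, ⟨_, rfl, rfl, rfl⟩, h⟩

theorem rel_tick_seq : rel code (keep [1] ⬝ G) c w c' ↔ ∃ v, w = tick :: v ∧ rel code G c v c' := by
  rw [rel_seq (wf_keep _)]
  simp only [rel_keep, List.mem_singleton, code_eq_one]
  constructor
  · rintro ⟨_, v, _, rfl, ⟨_, rfl, rfl, rfl⟩, h⟩
    exact ⟨v, rfl, h⟩
  · rintro ⟨v, rfl, h⟩
    exact ⟨_, v, _, rfl, ⟨_, rfl, rfl, rfl⟩, h⟩

theorem rel_dollar_seq :
    rel code (keep [2] ⬝ G) c w c' ↔ ∃ v, w = dollar :: v ∧ rel code G c v c' := by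
  rw [rel_seq (wf_keep _)]
  simp only [rel_keep, List.mem_singleton, code_eq_two]
  constructor
  · rintro ⟨_, v, _, rfl, ⟨_, rfl, rfl, rfl⟩, h⟩
    exact ⟨v, rfl, h⟩
  · rintro ⟨v, rfl, h⟩
    exact ⟨_, v, _, rfl, ⟨_, rfl, rfl, rfl⟩, h⟩

theorem rel_dollar : rel code (keep [2]) c w c' ↔ w = [dollar] ∧ c' = c := by
  simp [rel_keep, code_eq_two]

theorem rel_letter_seq : rel code (keep (letters m) ⬝ G) c w c' ↔
    ∃ a v, w = letter a :: v ∧ rel code G c v c' := by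
  rw [rel_seq (wf_keep _)]
  simp only [rel_keep, code_mem_letters]
  constructor
  · rintro ⟨_, v, _, rfl, ⟨_, ⟨a, rfl⟩, rfl, rfl⟩, h⟩
    exact ⟨a, v, rfl, h⟩
  · rintro ⟨a, v, rfl, h⟩
    exact ⟨_, v, _, rfl, ⟨_, ⟨a, rfl⟩, rfl, rfl⟩, h⟩

theorem forall_code_tick : (∀ x ∈ w, code x ∈ [1]) ↔ ∃ k, w = List.replicate k tick := by
  simp only [List.mem_singleton, code_eq_one]
  exact ⟨fun h => ⟨_, List.eq_replicate_iff.2 ⟨rfl, h⟩⟩, by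
    rintro ⟨k, rfl⟩ x hx
    exact (List.mem_replicate.1 hx).2⟩

theorem rel_pushTicks_seq : rel code (star (push [1]) ⬝ G) c w c' ↔
    ∃ k v, w = List.replicate k tick ++ v ∧ rel code G (c + k) v c' := by
  rw [rel_seq (wf_star (wf_push _))]
  simp only [rel_star_push, forall_code_tick]
  constructor
  · rintro ⟨_, v, _, rfl, ⟨⟨k, rfl⟩, rfl⟩, h⟩
    exact ⟨k, v, rfl, by simpa using h⟩
  · rintro ⟨k, v, rfl, h⟩
    exact ⟨_, v, _, rfl, ⟨⟨k, rfl⟩, rfl⟩, by simpa using h⟩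

theorem rel_popTicks_seq : rel code (star (pop [1]) ⬝ G) c w c' ↔
    ∃ k v d, c = d + k ∧ w = List.replicate k tick ++ v ∧ rel code G d v c' := by
  rw [rel_seq (wf_star (wf_pop _))]
  simp only [rel_star_pop, forall_code_tick]
  constructor
  · rintro ⟨_, v, d, rfl, ⟨⟨k, rfl⟩, rfl⟩, h⟩
    exact ⟨k, v, d, by simp, rfl, h⟩
  · rintro ⟨k, v, d, rfl, rfl, h⟩
    exact ⟨_, v, d, rfl, ⟨⟨k, rfl⟩, by simp⟩, h⟩

theorem rel_ticks_seq : rel code (star (keep [1]) ⬝ G) c w c' ↔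
    ∃ k v, w = List.replicate k tick ++ v ∧ rel code G c v c' := by
  rw [rel_seq (wf_star (wf_keep _))]
  simp only [rel_star_keep, forall_code_tick]
  constructor
  · rintro ⟨_, v, _, rfl, ⟨⟨k, rfl⟩, rfl⟩, h⟩
    exact ⟨k, v, rfl, h⟩
  · rintro ⟨k, v, rfl, h⟩
    exact ⟨_, v, _, rfl, ⟨⟨k, rfl⟩, rfl⟩, h⟩

theorem rel_zero_seq : rel code (zero ⬝ G) c w c' ↔ c = 0 ∧ rel code G 0 w c' := by
  rw [rel_seq wf_zero]
  simp only [rel_zero]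
  constructor
  · rintro ⟨_, v, d, rfl, ⟨rfl, rfl, rfl⟩, h⟩
    exact ⟨rfl, h⟩
  · rintro ⟨rfl, h⟩
    exact ⟨[], w, 0, rfl, ⟨rfl, rfl, rfl⟩, h⟩

theorem rel_pos_seq : rel code (pos ⬝ G) c w c' ↔ 0 < c ∧ rel code G c w c' := by
  rw [rel_seq wf_pos]
  simp only [rel_pos]
  constructor
  · rintro ⟨_, v, d, rfl, ⟨rfl, hc, rfl⟩, h⟩
    exact ⟨hc, h⟩
  · rintro ⟨hc, h⟩
    exact ⟨[], w, c, rfl, ⟨rfl, hc, rfl⟩, h⟩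

theorem flat_cons {α : Type*} (x : ℕ × α) (l : List (ℕ × α)) :
    flat (x :: l) = flat [x] ++ flat l := flat_append [x] l

theorem rel_item : rel code (item m) c w c' ↔ c' = c ∧ ∃ x, w = flat [x] := by
  rw [item, rel_ticks_seq]
  simp only [rel_keep, code_mem_letters]
  constructor
  · rintro ⟨k, _, rfl, _, ⟨a, rfl⟩, rfl, rfl⟩
    exact ⟨rfl, (k, a), rfl⟩
  · rintro ⟨rfl, ⟨k, a⟩, rfl⟩
    exact ⟨k, _, rfl, _, ⟨a, rfl⟩, rfl, rfl⟩

theorem rel_items : rel code (items m) c w c' ↔ c' = c ∧ ∃ l, w = flat l := by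
  rw [items, rel_star wf_item]
  constructor
  · intro h
    induction h with
    | nil => exact ⟨rfl, [], rfl⟩
    | cons h _ ih =>
      obtain ⟨rfl, x, rfl⟩ := rel_item.1 h
      obtain ⟨rfl, l, rfl⟩ := ih
      exact ⟨rfl, x :: l, (flat_cons x l).symm⟩
  · rintro ⟨rfl, l, rfl⟩
    induction l with
    | nil => exact .nil _
    | cons x l ih =>
      rw [flat_cons]
      exact .cons (rel_item.2 ⟨rfl, x, rfl⟩) ih

theorem rel_pushItems : rel code (pushItems m) c w c' ↔ c' = c + w.length ∧ ∃ l, w = flat l := by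
  have hi : ∀ {c w c'}, rel code (star (push [1]) ⬝ push (letters m)) c w c' ↔
      c' = c + w.length ∧ ∃ x, w = flat (α := Fin m) [x] := by
    intro c w c'
    rw [rel_pushTicks_seq]
    simp only [rel_push, code_mem_letters]
    constructor
    · rintro ⟨k, _, rfl, _, ⟨a, rfl⟩, rfl, rfl⟩
      exact ⟨by simp [add_assoc], (k, a), rfl⟩
    · rintro ⟨rfl, ⟨k, a⟩, rfl⟩
      exact ⟨k, _, rfl, _, ⟨a, rfl⟩, rfl, by simp [flat, add_assoc]⟩
  rw [pushItems, rel_star (wf_seq (wf_star (wf_push _)) (wf_push _))]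
  constructor
  · intro h
    induction h with
    | nil => exact ⟨rfl, [], rfl⟩
    | cons h _ ih =>
      obtain ⟨rfl, x, rfl⟩ := hi.1 h
      obtain ⟨rfl, l, rfl⟩ := ih
      exact ⟨by simp [add_assoc], x :: l, (flat_cons x l).symm⟩
  · rintro ⟨rfl, l, rfl⟩
    induction l generalizing c with
    | nil => exact .nil _
    | cons x l ih =>
      rw [flat_cons, List.length_append, ← add_assoc]
      exact .cons (hi.2 ⟨rfl, x, rfl⟩) ih

theorem rel_popItems : rel code (popItems m) c w c' ↔ c = c' + w.length ∧ ∃ l, w = flat l := by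
  have hi : ∀ {c w c'}, rel code (star (pop [1]) ⬝ pop (letters m)) c w c' ↔
      c = c' + w.length ∧ ∃ x, w = flat (α := Fin m) [x] := by
    intro c w c'
    rw [rel_popTicks_seq]
    simp only [rel_pop, code_mem_letters]
    constructor
    · rintro ⟨k, _, _, rfl, rfl, _, ⟨a, rfl⟩, rfl, rfl⟩
      exact ⟨by simp; omega, (k, a), rfl⟩
    · rintro ⟨rfl, ⟨k, a⟩, rfl⟩
      exact ⟨k, _, _, by simp [flat]; omega, rfl, _, ⟨a, rfl⟩, rfl, rfl⟩
  rw [popItems, rel_star (wf_seq (wf_star (wf_pop _)) (wf_pop _))]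
  constructor
  · intro h
    induction h with
    | nil => exact ⟨rfl, [], rfl⟩
    | cons h _ ih =>
      obtain ⟨rfl, x, rfl⟩ := hi.1 h
      obtain ⟨rfl, l, rfl⟩ := ih
      exact ⟨by simp; omega, x :: l, (flat_cons x l).symm⟩
  · rintro ⟨rfl, l, rfl⟩
    induction l with
    | nil => exact .nil _
    | cons x l ih =>
      rw [flat_cons, List.length_append,
        add_comm (flat [x]).length, ← add_assoc]
      exact .cons (hi.2 ⟨rfl, x, rfl⟩) ih

theorem rel_item_seq : rel code (item m ⬝ G) c w c' ↔
    ∃ x v, w = flat [x] ++ v ∧ rel code G c v c' := by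
  rw [rel_seq wf_item]
  simp only [rel_item]
  constructor
  · rintro ⟨_, v, _, rfl, ⟨rfl, x, rfl⟩, h⟩
    exact ⟨x, v, rfl, h⟩
  · rintro ⟨x, v, rfl, h⟩
    exact ⟨_, v, _, rfl, ⟨rfl, x, rfl⟩, h⟩

theorem rel_items_seq : rel code (items m ⬝ G) c w c' ↔
    ∃ l v, w = flat l ++ v ∧ rel code G c v c' := by
  rw [rel_seq wf_items]
  simp only [rel_items]
  constructor
  · rintro ⟨_, v, _, rfl, ⟨rfl, x, rfl⟩, h⟩
    exact ⟨x, v, rfl, h⟩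
  · rintro ⟨x, v, rfl, h⟩
    exact ⟨_, v, _, rfl, ⟨rfl, x, rfl⟩, h⟩

theorem rel_pushItems_seq : rel code (pushItems m ⬝ G) c w c' ↔
    ∃ l v, w = flat l ++ v ∧ rel code G (c + (flat l).length) v c' := by
  rw [rel_seq wf_pushItems]
  simp only [rel_pushItems]
  constructor
  · rintro ⟨_, v, _, rfl, ⟨rfl, x, rfl⟩, h⟩
    exact ⟨x, v, rfl, h⟩
  · rintro ⟨x, v, rfl, h⟩
    exact ⟨_, v, _, rfl, ⟨rfl, x, rfl⟩, h⟩

theorem rel_popItems_seq : rel code (popItems m ⬝ G) c w c' ↔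
    ∃ l v d, c = d + (flat l).length ∧ w = flat l ++ v ∧ rel code G d v c' := by
  rw [rel_seq wf_popItems]
  simp only [rel_popItems]
  constructor
  · rintro ⟨_, v, d, rfl, ⟨rfl, x, rfl⟩, h⟩
    exact ⟨x, v, d, rfl, rfl, h⟩
  · rintro ⟨x, v, d, rfl, rfl, h⟩
    exact ⟨_, v, _, rfl, ⟨rfl, x, rfl⟩, h⟩

theorem rel_anyWord : rel code (anyWord m) c w c' ↔ c' = c := by
  rw [anyWord, rel_star_keep, and_iff_right]
  intro x _
  cases x <;> simp [code, letters]

theorem rel_anyWord_seq : rel code (anyWord m ⬝ G) c w c' ↔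
    ∃ u v, w = u ++ v ∧ rel code G c v c' := by
  rw [rel_seq wf_anyWord]
  simp only [rel_anyWord]
  constructor
  · rintro ⟨u, v, _, rfl, rfl, h⟩
    exact ⟨u, v, rfl, h⟩
  · rintro ⟨u, v, rfl, h⟩
    exact ⟨u, v, _, rfl, rfl, h⟩

/-- The letter `z` may be followed by the list of items `l` inside of a list of items. -/
def Follows (z : Sym (Fin m)) (l : List (ℕ × Fin m)) : Prop :=
  (z = tick ∧ l ≠ []) ∨ ∃ a, z = letter a

/-- After a tick the current item is unfinished and has to be completed, while after a letter the
list may end at once. -/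
theorem rel_tailFrom {z : Sym (Fin m)} (hz : z = tick ∨ ∃ a, z = letter a) :
    rel code (tailFrom m (code z)) c w c' ↔
      c' = c ∧ ∃ l, w = z :: flat l ∧ Follows z l := by
  rw [tailFrom, rel_seq (wf_keep _)]
  simp only [rel_keep, List.mem_singleton, code_injective.eq_iff]
  rcases hz with rfl | ⟨a, rfl⟩
  · rw [if_pos (show code (tick : Sym (Fin m)) = 1 from rfl)]
    simp only [rel_item_seq, rel_items, Follows]
    constructor
    · rintro ⟨_, _, _, rfl, ⟨_, rfl, rfl, rfl⟩, x, _, rfl, rfl, l, rfl⟩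
      exact ⟨rfl, x :: l, by rw [flat_cons x l]; rfl, by simp⟩
    · rintro ⟨rfl, l, rfl, h⟩
      obtain ⟨x, l, rfl⟩ := List.exists_cons_of_ne_nil (by simpa using h : l ≠ [])
      exact ⟨[tick], flat (x :: l), _, rfl, ⟨_, rfl, rfl, rfl⟩, x, flat l,
        flat_cons x l, rfl, l, rfl⟩
  · rw [if_neg (by simp [code])]
    simp only [rel_items, Follows]
    constructor
    · rintro ⟨_, _, _, rfl, ⟨_, rfl, rfl, rfl⟩, rfl, l, rfl⟩
      exact ⟨rfl, l, rfl, by simp⟩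
    · rintro ⟨rfl, l, rfl, _⟩
      exact ⟨[letter a], flat l, _, rfl, ⟨_, rfl, rfl, rfl⟩, rfl, l, rfl⟩

theorem rel_tailFrom_seq {z : Sym (Fin m)} (hz : z = tick ∨ ∃ a, z = letter a) :
    rel code (tailFrom m (code z) ⬝ G) c w c' ↔
      ∃ l v, w = z :: (flat l ++ v) ∧ Follows z l ∧ rel code G c v c' := by
  rw [rel_seq wf_tailFrom]
  simp only [rel_tailFrom hz]
  constructor
  · rintro ⟨_, v, _, rfl, ⟨rfl, l, rfl, hl⟩, h⟩
    exact ⟨l, v, rfl, hl, h⟩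
  · rintro ⟨l, v, rfl, hl, h⟩
    exact ⟨_, v, _, rfl, ⟨rfl, l, rfl, hl⟩, h⟩

end Rel

end Sym

end OmegaPower

/-! ### The fragment for a history language. -/

namespace OmegaPower

namespace Sym

open Frag

local infixr:65 " ⬝ " => Frag.seq

/-- Reads two letters that may not follow each other. -/
def badPair (m : ℕ) : Frag := unions [keep [0, 1] ⬝ keep [0, 2], keep (letters m) ⬝ keep [0],
  keep [2] ⬝ keep (1 :: 2 :: letters m)]

/-- Reads a single block that is not valid. -/
def badBlock (m : ℕ) : Frag := unions
  [keep [0] ⬝ item m ⬝ keep [2],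
    keep [0] ⬝ star (push [1]) ⬝ keep (letters m) ⬝ items m ⬝ star (pop [1]) ⬝ keep (letters m) ⬝
      keep [2],
    keep [0] ⬝ star (push [1]) ⬝ keep (letters m) ⬝ items m ⬝ star (pop [1]) ⬝ zero ⬝ keep [1] ⬝
      keep [1] ⬝ star (keep [1]) ⬝ keep (letters m) ⬝ keep [2],
    keep [0] ⬝ item m ⬝ items m ⬝ star (push [1]) ⬝ keep (letters m) ⬝ star (pop [1]) ⬝
      keep (letters m) ⬝ items m ⬝ keep [2]]

/-- Reads two blocks such that the label of the second header is wrong. -/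
def badHeader (m : ℕ) : Frag := keep [0] ⬝ items m ⬝ star (push [1]) ⬝ keep (letters m) ⬝
  keep [2] ⬝ keep [0] ⬝ star (pop [1]) ⬝ unions
    [pos ⬝ keep (letters m) ⬝ items m ⬝ keep [2],
      zero ⬝ keep [1] ⬝ star (keep [1]) ⬝ keep (letters m) ⬝ items m ⬝ keep [2]]

/-- Reads two blocks such that the stack of the second one, without its last item, has a letter `z`
at a position where the first stack has ended (if `y = z`), or has a letter `y ≠ z`. -/
def mismatch (m z y : ℕ) : Frag :=
  let G := keep [0] ⬝ item m ⬝ popItems m ⬝ star (pop [1]) ⬝ zero ⬝ tailFrom m z ⬝ item m ⬝ keep [2]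
  keep [0] ⬝ item m ⬝ pushItems m ⬝
    if y = z then keep [2] ⬝ G else star (push [1]) ⬝ tailFrom m y ⬝ keep [2] ⬝ G

/-- Reads two blocks such that the second stack, without its last item, is not a prefix of the first
one. -/
def badStack (m : ℕ) : Frag := unions ((1 :: letters m).flatMap fun z =>
  (1 :: letters m).map fun y => mismatch m z y)

/-- Reads a bad word. -/
def bad (m : ℕ) : Frag := unions [badPair m, badBlock m, badHeader m, badStack m]

/-- Reads a word of the edge language. -/
def edge (m : ℕ) (F : Frag) : Frag :=
  keep [0] ⬝ star (push [1]) ⬝ keep (letters m) ⬝ unions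
    [items m ⬝ star (pop [1]) ⬝ zero ⬝ keep (letters m) ⬝ subst F ⬝ keep [2],
      anyWord m ⬝ keep [0] ⬝ item m ⬝ items m ⬝ star (pop [1]) ⬝ zero ⬝ keep (letters m) ⬝
        subst F ⬝ keep [2]]

/-- Reads a word of the language of stack histories. -/
def hist (m : ℕ) (F : Frag) : Frag := unions
  [keep (1 :: 2 :: letters m) ⬝ anyWord m, anyWord m ⬝ bad m ⬝ anyWord m, edge m F]

theorem wf_badPair {m : ℕ} : (badPair m).WF := by simp (maxDischargeDepth := 40) [badPair]
theorem wf_badBlock {m : ℕ} : (badBlock m).WF := by simp (maxDischargeDepth := 40) [badBlock]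
theorem wf_badHeader {m : ℕ} : (badHeader m).WF := by simp (maxDischargeDepth := 40) [badHeader]
theorem wf_mismatch {m z y : ℕ} : (mismatch m z y).WF := by
  unfold mismatch
  split_ifs <;> simp (maxDischargeDepth := 40)
theorem wf_mismatches {m : ℕ} : ∀ F ∈ ((1 :: letters m).flatMap fun z =>
    (1 :: letters m).map fun y => mismatch m z y), F.WF := by
  simp only [List.mem_flatMap, List.mem_map]
  rintro _ ⟨z, _, y, _, rfl⟩
  exact wf_mismatch
theorem wf_badStack {m : ℕ} : (badStack m).WF := wf_unions wf_mismatches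
attribute [simp] wf_badPair wf_badBlock wf_badHeader wf_mismatch wf_badStack
theorem wf_bad {m : ℕ} : (bad m).WF := by simp [bad]
theorem wf_edge {m : ℕ} {F : Frag} (hF : F.WF) : (edge m F).WF := by
  simp (maxDischargeDepth := 40) [edge, hF]
attribute [simp] wf_bad
theorem wf_hist {m : ℕ} {F : Frag} (hF : F.WF) : (hist m F).WF := by
  simp (maxDischargeDepth := 40) [hist, wf_edge hF]

section
variable {α : Type*}

/-- Failure is split into cases that one counter can confirm after a guess: no stack at all, a wrong
last label, or neighbours whose labels do not increase. -/
theorem not_good_iff {x : ℕ × α} {S : List (ℕ × α)} : ¬ Good (x :: S) ↔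
    S = [] ∨ (∃ I p, S = I ++ [p] ∧ p.1 ≠ x.1 + 1) ∨
      ∃ I p q J, S = I ++ p :: q :: J ∧ q.1 ≤ p.1 := by
  constructor
  · intro h
    by_contra hc
    push Not at hc
    obtain ⟨h1, h2, h3⟩ := hc
    obtain ⟨I, p, rfl⟩ := (List.eq_nil_or_concat S).resolve_left h1
    have hp := h2 I p (by simp)
    refine h ⟨x.1, x.2, I, p.2, by rw [← hp]; simp, ?_⟩
    rw [← hp, List.isChain_iff_forall_rel_of_append_cons_cons]
    intro a b l l' he
    exact h3 l a b l' (by simpa using he)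
  · rintro h ⟨k, b, X, a, hB, hc⟩
    obtain ⟨rfl, rfl⟩ := List.cons.inj hB
    rcases h with h | ⟨I, p, h, hp⟩ | ⟨I, p, q, J, h, hp⟩
    · simp at h
    · obtain ⟨_, h⟩ := List.append_inj' h rfl
      simp only [List.cons.injEq, and_true] at h
      exact hp (h ▸ rfl)
    · have := List.isChain_iff_forall_rel_of_append_cons_cons.1 hc h
      omega

/-- At the first place of disagreement either `s` has ended or the two letters differ; this is the
place that the automaton guesses. -/
theorem exists_mismatch {s t : List α} (h : ¬ t <+: s) : ∃ u z v, t = u ++ z :: v ∧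
    (s = u ∨ ∃ y v', s = u ++ y :: v' ∧ y ≠ z) := by
  induction t generalizing s with
  | nil => exact absurd List.nil_prefix h
  | cons z t ih =>
    cases s with
    | nil => exact ⟨[], z, t, rfl, .inl rfl⟩
    | cons y s =>
      by_cases hy : y = z
      · subst hy
        obtain ⟨u, z, v, rfl, h'⟩ := ih fun h' => h (List.prefix_cons_inj _ |>.2 h')
        refine ⟨y :: u, z, v, rfl, ?_⟩
        rcases h' with rfl | ⟨y', v', rfl, h'⟩
        · exact .inl rfl
        · exact .inr ⟨y', v', rfl, h'⟩
      · exact ⟨[], z, t, rfl, .inr ⟨y, s, rfl, hy⟩⟩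

end

section
variable {m : ℕ} {F : Frag} {c c' : ℕ} {w : List (Sym (Fin m))}

/-- The separated ticks merge with what follows into a single longer label. -/
theorem exists_flat_follows (l : List (ℕ × Fin m)) (k : ℕ) {z : Sym (Fin m)}
    {l' : List (ℕ × Fin m)} (h : Follows z l') :
    ∃ S, flat S = flat l ++ (List.replicate k tick ++ z :: flat l') := by
  rcases h with ⟨rfl, hl⟩ | ⟨a, rfl⟩
  · obtain ⟨x, l', rfl⟩ := List.exists_cons_of_ne_nil hl
    refine ⟨l ++ (k + 1 + x.1, x.2) :: l', ?_⟩
    rw [flat_append]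
    simp [flat, List.replicate_add, -List.replicate_append_replicate]
  · refine ⟨l ++ (k, a) :: l', ?_⟩
    rw [flat_append]
    simp [flat]

theorem flat_getLast {l : List (ℕ × Fin m)} {u : List (Sym (Fin m))} : flat l ≠ u ++ [tick] := by
  intro h
  rcases List.eq_nil_or_concat l with rfl | ⟨l, x, rfl⟩
  · simp [flat] at h
  · rw [List.concat_eq_append, flat_append] at h
    have h2 := congrArg List.getLast? h
    simp [flat] at h2

/-- A cut in a list of items may fall inside a label; `k` counts the ticks of the current label
before the cut, and `Follows` says that the rest can be completed. -/
theorem exists_of_flat_eq {S : List (ℕ × Fin m)} {u v : List (Sym (Fin m))} {z : Sym (Fin m)}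
    (h : flat S = u ++ z :: v) : (z = tick ∨ ∃ a, z = letter a) ∧
      ∃ l k l', u = flat l ++ List.replicate k tick ∧ v = flat l' ∧ Follows z l' := by
  have hz := mem_flat (l := S) (x := z) (by rw [h]; simp)
  obtain ⟨l, k, rfl⟩ := exists_flat u fun x hx => mem_flat (l := S) (by rw [h]; simp [hx])
  obtain ⟨l', k', rfl⟩ := exists_flat v fun x hx => mem_flat (l := S) (by rw [h]; simp [hx])
  obtain rfl : k' = 0 := by
    rcases Nat.eq_zero_or_pos k' with h0 | h0
    · exact h0
    · obtain ⟨k', rfl⟩ := Nat.exists_eq_succ_of_ne_zero h0.ne'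
      refine absurd (h.trans ?_) (flat_getLast (u := (flat l ++ List.replicate k tick) ++
        z :: (flat l' ++ List.replicate k' tick)))
      simp [List.replicate_succ']
  have hz' : z = tick ∨ ∃ a, z = letter a := by
    cases z <;> simp at hz ⊢
  refine ⟨hz', l, k, l', rfl, by simp, ?_⟩
  rcases hz' with rfl | hz'
  · refine .inl ⟨rfl, ?_⟩
    rintro rfl
    exact flat_getLast (u := flat l ++ List.replicate k tick) (h.trans (by simp [flat]))
  · exact .inr hz'

theorem ticks_add_two {k j : ℕ} : List.replicate (k + 2 + j) (tick : Sym (Fin m)) =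
    List.replicate k tick ++ tick :: tick :: List.replicate j tick := by
  rw [add_assoc, List.replicate_add, add_comm 2 j]
  rfl

theorem rel_badPair : (∃ c', rel code (badPair m) c w c') ↔ ∃ x y, ¬ Adj x y ∧ w = [x, y] := by
  rw [badPair]
  simp (maxDischargeDepth := 40) only [wf_seq, wf_keep, rel_unions_cons, rel_unions_nil, or_false,
      rel_seq (wf_keep _), rel_keep]
  constructor
  · rintro ⟨c', h⟩
    rcases h with h | h | h <;> obtain ⟨_, _, _, rfl, ⟨x, hx, rfl, rfl⟩, y, hy, rfl, rfl⟩ := h <;>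
    refine ⟨x, y, ?_, rfl⟩ <;> cases x <;> simp [code, letters] at hx <;> cases y <;>
    simp [code, letters] at hy <;> simp [Adj]
  · rintro ⟨x, y, h, rfl⟩
    refine ⟨c, ?_⟩
    have key : ∀ l l' : List ℕ, code x ∈ l → code y ∈ l' → ∃ u v d, [x, y] = u ++ v ∧
        (∃ x, code x ∈ l ∧ u = [x] ∧ d = c) ∧ ∃ x, code x ∈ l' ∧ v = [x] ∧ c = d :=
      fun l l' h1 h2 => ⟨[x], [y], c, rfl, ⟨x, h1, rfl, rfl⟩, y, h2, rfl, rfl⟩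
    cases x <;> cases y <;> simp only [Adj, not_true_eq_false] at h
    case hash.hash => exact .inl (key _ _ (by simp [code]) (by simp [code]))
    case hash.dollar => exact .inl (key _ _ (by simp [code]) (by simp [code]))
    case tick.hash => exact .inl (key _ _ (by simp [code]) (by simp [code]))
    case tick.dollar => exact .inl (key _ _ (by simp [code]) (by simp [code]))
    case letter.hash => exact .inr (.inl (key _ _ (by simp [code, letters]) (by simp [code])))
    all_goals exact .inr (.inr (key _ _ (by simp [code]) (by simp [code, letters])))

theorem rel_badBlock : (∃ c', rel code (badBlock m) 0 w c') ↔
    ∃ B, B ≠ [] ∧ ¬ Good B ∧ w = block B := by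
  rw [badBlock]
  simp (maxDischargeDepth := 40) only [wf_seq, wf_star, wf_keep, wf_push, wf_pop,
    wf_zero, wf_item, wf_items, rel_unions_cons, rel_unions_nil, or_false, rel_hash_seq,
      rel_item_seq, rel_dollar, rel_items_seq,
    rel_pushTicks_seq, rel_popTicks_seq, rel_letter_seq, rel_zero_seq, rel_tick_seq, rel_ticks_seq]
  constructor
  · rintro ⟨c', h⟩
    rcases h with ⟨_, rfl, x, _, rfl, rfl, _⟩ |
      ⟨_, rfl, h, _, rfl, b, _, rfl, I, _, rfl, l, _, d, hd, rfl, a, _, rfl, rfl, _⟩ |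
      ⟨_, rfl, h, _, rfl, b, _, rfl, I, _, rfl, l, _, d, hd, rfl, rfl, _, rfl, _, rfl, j, _, rfl,
        a, _, rfl, rfl, _⟩ |
      ⟨_, rfl, x, _, rfl, I, _, rfl, p, _, rfl, a, _, rfl, q, _, d, hd, rfl, b, _, rfl, J, _, rfl,
        rfl, _⟩
    · exact ⟨[x], by simp, not_good_iff.2 (.inl rfl), by simp [block]⟩
    · refine ⟨(h, b) :: (I ++ [(l, a)]), by simp, not_good_iff.2 (.inr (.inl ⟨I, _, rfl, ?_⟩)), ?_⟩
      · simp only; omega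
      · simp [block, flat, flat_append]
    · refine ⟨(h, b) :: (I ++ [(l + 2 + j, a)]), by simp,
        not_good_iff.2 (.inr (.inl ⟨I, _, rfl, ?_⟩)), ?_⟩
      · simp only; omega
      · simp [block, flat, flat_append, ticks_add_two]
    · refine ⟨x :: (I ++ (p, a) :: (q, b) :: J), by simp,
        not_good_iff.2 (.inr (.inr ⟨I, _, _, J, rfl, ?_⟩)), ?_⟩
      · simp only; omega
      · simp [block, flat, flat_append]
  · rintro ⟨B, hB, hG, rfl⟩
    obtain ⟨⟨h, b⟩, S, rfl⟩ := List.exists_cons_of_ne_nil hB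
    rcases not_good_iff.1 hG with rfl | ⟨I, ⟨l, a⟩, rfl, hl⟩ | ⟨I, ⟨p, a⟩, ⟨q, b'⟩, J, rfl, hq⟩
    · exact ⟨0, .inl ⟨_, rfl, (h, b), [dollar], rfl, rfl, rfl⟩⟩
    · simp only [ne_eq] at hl
      -- A label that is too large is at least `h + 2`: the counter is empty and two more ticks
      -- follow. A label that is too small leaves a remainder in the counter, which need not be
      -- tested since any final value is accepted.
      rcases Nat.lt_or_ge h l with hlt | hge
      · obtain ⟨j, rfl⟩ := Nat.exists_eq_add_of_le (show h + 2 ≤ l by omega)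
        refine ⟨0, .inr (.inr (.inl ⟨_, rfl, h, letter b :: (flat I ++
          (List.replicate (h + 2 + j) tick ++ [letter a, dollar])), by simp [flat, flat_append], b, _,
          rfl, I, _, rfl, h, tick :: tick :: (List.replicate j tick ++ [letter a, dollar]), 0,
            by simp,
          by simp [ticks_add_two], rfl, _, rfl, _, rfl, j, _, rfl, a, _,
          rfl, rfl, rfl⟩))⟩
      · refine ⟨h - l, .inr (.inl ⟨_, rfl, h, letter b :: (flat I ++
          (List.replicate l tick ++ [letter a, dollar])), by simp [flat, flat_append], b, _,
          rfl, I, _, rfl, l, [letter a, dollar], h - l, by omega, rfl, a, _, rfl, rfl, rfl⟩)⟩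
    · simp only at hq
      refine ⟨p - q, .inr (.inr (.inr ⟨_, rfl, (h, b), flat I ++ (List.replicate p tick ++
        letter a ::
        (List.replicate q tick ++ letter b' :: (flat J ++ [dollar]))), by simp [flat, flat_append],
        I, _, rfl, p, _, rfl, a, _, rfl, q, _, p - q, by omega, rfl, b', _, rfl, J, _, rfl,
        rfl, rfl⟩))⟩

theorem rel_badHeader : (∃ c', rel code (badHeader m) 0 w c') ↔
    ∃ I p y S, p.1 ≠ y.1 ∧ w = block (I ++ [p]) ++ block (y :: S) := by
  rw [badHeader]
  simp (maxDischargeDepth := 40) only [wf_seq, wf_star, wf_keep,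
    wf_zero, wf_pos, wf_items, rel_unions_cons, rel_unions_nil, or_false, rel_hash_seq, rel_dollar,
      rel_dollar_seq, rel_items_seq,
    rel_pushTicks_seq, rel_popTicks_seq, rel_letter_seq, rel_zero_seq, rel_tick_seq, rel_ticks_seq,
    rel_pos_seq]
  constructor
  · rintro ⟨c', _, rfl, I, _, rfl, p, _, rfl, a, _, rfl, _, rfl, _, rfl, q, _, d, hd, rfl, h⟩
    rcases h with ⟨hp, b, _, rfl, S, _, rfl, rfl, _⟩ |
      ⟨rfl, _, rfl, j, _, rfl, b, _, rfl, S, _, rfl, rfl, _⟩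
    · exact ⟨I, (p, a), (q, b), S, by simp only; omega, by simp [block, flat, flat_append]⟩
    · exact ⟨I, (p, a), (q + 1 + j, b), S, by simp only; omega,
        by simp [block, flat, flat_append, List.replicate_add, -List.replicate_append_replicate]⟩
  · rintro ⟨I, ⟨p, a⟩, ⟨q, b⟩, S, hpq, rfl⟩
    simp only [ne_eq] at hpq
    rcases Nat.lt_or_ge p q with h | h
    · obtain ⟨j, rfl⟩ := Nat.exists_eq_add_of_le (show p + 1 ≤ q by omega)
      exact ⟨0, _, rfl, I, List.replicate p tick ++ letter a :: dollar :: block ((p + 1 + j, b) ::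
          S),
        by simp [block, flat, flat_append], p, _, rfl, a, _, rfl, _, rfl, _, rfl, p,
        tick :: (List.replicate j tick ++ letter b :: (flat S ++ [dollar])), 0, by simp,
        by simp [flat, List.replicate_add, -List.replicate_append_replicate], .inr ⟨rfl, _, rfl, j,
          _, rfl, b, _, rfl, S, _, rfl,
          rfl, rfl⟩⟩
    · exact ⟨p - q, _, rfl, I, List.replicate p tick ++ letter a :: dollar :: block ((q, b) :: S),
        by simp [block, flat, flat_append], p, _, rfl, a, _, rfl, _, rfl, _, rfl, q,
        letter b :: (flat S ++ [dollar]), p - q, by omega,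
        by simp [flat], .inl ⟨by omega, b, _, rfl, S, _, rfl, rfl, rfl⟩⟩

theorem mem_codes {z : ℕ} : z ∈ 1 :: letters m ↔
    ∃ x : Sym (Fin m), (x = tick ∨ ∃ a, x = letter a) ∧ code x = z := by
  constructor
  · intro h
    rcases List.mem_cons.1 h with rfl | h
    · exact ⟨tick, .inl rfl, rfl⟩
    · obtain ⟨a, ha, rfl⟩ := List.mem_map.1 h
      exact ⟨letter ⟨a, List.mem_range.1 ha⟩, .inr ⟨_, rfl⟩, rfl⟩
  · rintro ⟨x, rfl | ⟨a, rfl⟩, rfl⟩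
    · simp [code]
    · exact List.mem_cons_of_mem _ (code_mem_letters.2 ⟨a, rfl⟩)

/-- The counter compares offsets: it counts every symbol of the first stack before the guessed
place, ticks included, and is emptied on the second stack. The case `y = z` is free to stand for the
end of the first stack, as equal letters are no disagreement. -/
theorem rel_mismatch {z y : Sym (Fin m)} (hz : z = tick ∨ ∃ a, z = letter a)
    (hy : y = tick ∨ ∃ a, y = letter a) : (∃ c', rel code (mismatch m (code z) (code y)) 0 w c') ↔
    ∃ x S x' l k l' v, Follows z l' ∧
      w = hash :: (flat [x] ++ (flat S ++ dollar :: hash :: (flat [x'] ++ (flat l ++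
        (List.replicate k tick ++ z :: (flat l' ++ (flat [v] ++ [dollar]))))))) ∧
      ((y = z ∧ (flat S).length = (flat l).length + k) ∨
        (y ≠ z ∧ ∃ a j a', Follows y a' ∧
          flat S = flat a ++ (List.replicate j tick ++ y :: flat a') ∧
          (flat a).length + j = (flat l).length + k)) := by
  by_cases hyz : y = z
  · subst hyz
    rw [mismatch, if_pos rfl]
    simp only [rel_hash_seq, rel_item_seq, rel_pushItems_seq, rel_dollar_seq, rel_popItems_seq,
      rel_popTicks_seq, rel_zero_seq, rel_tailFrom_seq hy, rel_dollar]
    constructor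
    · rintro ⟨c', _, rfl, x, _, rfl, S, _, rfl, _, rfl, _, rfl, x', _, rfl, l, _, d, hd, rfl, k, _,
        d', rfl, rfl, rfl, l', _, rfl, hl, v, _, rfl, rfl, -⟩
      exact ⟨x, S, x', l, k, l', v, hl, rfl, .inl ⟨trivial, by omega⟩⟩
    · rintro ⟨x, S, x', l, k, l', v, hl, rfl, ⟨_, h⟩ | ⟨h, _⟩⟩
      · exact ⟨0, _, rfl, x, _, rfl, S, _, rfl, _, rfl, _, rfl, x', _, rfl, l, _, k, by omega, rfl,
          k, _, 0, by omega, rfl, rfl, l', _, rfl, hl, v, _, rfl, rfl, rfl⟩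
      · exact absurd rfl h
  · rw [mismatch, if_neg fun h => hyz (code_injective h)]
    simp only [rel_hash_seq, rel_item_seq, rel_pushItems_seq, rel_dollar_seq, rel_popItems_seq,
      rel_popTicks_seq, rel_zero_seq, rel_tailFrom_seq hy, rel_tailFrom_seq hz, rel_dollar,
      rel_pushTicks_seq]
    constructor
    · rintro ⟨c', _, rfl, x, _, rfl, a, _, rfl, j, _, rfl, a', _, rfl, ha, _, rfl, _, rfl, x', _,
        rfl, l, _, d, hd, rfl, k, _, d', rfl, rfl, rfl, l', _, rfl, hl, v, _, rfl, rfl, -⟩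
      obtain ⟨S, hS⟩ := exists_flat_follows a j ha
      exact ⟨x, S, x', l, k, l', v, hl, by simp [hS], .inr ⟨hyz, a, j, a', ha, hS, by omega⟩⟩
    · rintro ⟨x, S, x', l, k, l', v, hl, rfl, ⟨h, _⟩ | ⟨_, a, j, a', ha, hS, h⟩⟩
      · exact absurd h hyz
      · exact ⟨0, _, rfl, x, _, rfl, a, List.replicate j tick ++ y :: (flat a' ++ _),
          by rw [hS]; simp, j, _, rfl, a', _, rfl, ha, _, rfl, _, rfl, x', _, rfl, l, _, k,
          by omega, rfl, k, _, 0, by omega, rfl, rfl, l', _, rfl, hl, v, _, rfl, rfl, rfl⟩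

/-- Prefixes are compared as words and not item by item, so one offset in the counter suffices; the
finitely many pairs of guessed letters are kept in the states. -/
theorem rel_badStack : (∃ c', rel code (badStack m) 0 w c') ↔
    ∃ x S x' T v, ¬ flat T <+: flat S ∧ w = block (x :: S) ++ block (x' :: (T ++ [v])) := by
  have h0 : (∃ c', rel code (badStack m) 0 w c') ↔
      ∃ z y : Sym (Fin m), (z = tick ∨ ∃ a, z = letter a) ∧ (y = tick ∨ ∃ a, y = letter a) ∧
        ∃ c', rel code (mismatch m (code z) (code y)) 0 w c' := by
    simp only [badStack, rel_unions wf_mismatches, List.mem_flatMap, List.mem_map, mem_codes]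
    constructor
    · rintro ⟨c', _, ⟨_, ⟨z, hz, rfl⟩, _, ⟨y, hy, rfl⟩, rfl⟩, h⟩
      exact ⟨z, y, hz, hy, c', h⟩
    · rintro ⟨z, y, hz, hy, c', h⟩
      exact ⟨c', _, ⟨_, ⟨z, hz, rfl⟩, _, ⟨y, hy, rfl⟩, rfl⟩, h⟩
  rw [h0]
  constructor
  · rintro ⟨z, y, hz, hy, h⟩
    obtain ⟨x, S, x', l, k, l', v, hl, rfl, hm⟩ := (rel_mismatch hz hy).1 h
    obtain ⟨T, hT⟩ := exists_flat_follows l k hl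
    refine ⟨x, S, x', T, v, ?_, ?_⟩
    · rw [hT]
      rintro ⟨t, ht⟩
      rcases hm with ⟨-, h⟩ | ⟨hyz, a, j, a', ha, hS, h⟩
      · have := congrArg List.length ht
        simp at this
        omega
      · rw [hS, ← List.append_assoc, ← List.append_assoc, List.append_assoc _ _ t] at ht
        have := (List.append_inj ht (by simp; omega)).2
        simp only [List.cons_append, List.cons.injEq] at this
        exact hyz this.1.symm
    · simp only [block, flat_cons x S, flat_cons x' (T ++ [v]), flat_append, hT]
      simp
  · rintro ⟨x, S, x', T, v, h, rfl⟩
    obtain ⟨u, z, r, hT, hm⟩ := exists_mismatch h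
    obtain ⟨hz, l, k, l', rfl, rfl, hl⟩ := exists_of_flat_eq hT
    have hw : block (x :: S) ++ block (x' :: (T ++ [v])) =
        hash :: (flat [x] ++ (flat S ++ dollar :: hash :: (flat [x'] ++ (flat l ++
        (List.replicate k tick ++ z :: (flat l' ++ (flat [v] ++ [dollar]))))))) := by
      simp only [block, flat_cons x S, flat_cons x' (T ++ [v]), flat_append, hT]
      simp
    rcases hm with h | ⟨y, r, h, hyz⟩
    · exact ⟨z, z, hz, hz, (rel_mismatch hz hz).2 ⟨x, S, x', l, k, l', v, hl, hw,
        .inl ⟨rfl, by simp [h]⟩⟩⟩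
    · obtain ⟨hy, a, j, a', ha, rfl, hy'⟩ := exists_of_flat_eq h
      have := congrArg List.length ha
      exact ⟨z, y, hz, hy, (rel_mismatch hz hy).2 ⟨x, S, x', l, k, l', v, hl, hw,
        .inr ⟨hyz, a, j, a', hy', by rw [h, ha, List.append_assoc], by simpa using this.symm⟩⟩⟩

theorem rel_bad : (∃ c', rel code (bad m) 0 w c') ↔ w ∈ Bad := by
  rw [bad]
  simp only [wf_badPair, wf_badBlock, wf_badHeader, wf_badStack, rel_unions_cons, rel_unions_nil,
    or_false, exists_or, rel_badPair, rel_badBlock, rel_badHeader, rel_badStack]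
  refine or_congr_right (or_congr_right ?_)
  constructor
  · rintro (⟨I, p, y, S, h, rfl⟩ | ⟨x, S, x', T, v, h, rfl⟩)
    · refine ⟨_, _, by simp, by simp, ?_, rfl⟩
      rintro ⟨⟨x, y', h1, h2, h3⟩, -⟩
      simp only [List.getLast?_append, List.getLast?_singleton, List.head?_cons, Option.some.injEq,
        Option.some_or] at h1 h2
      subst h1 h2
      exact h h3
    · refine ⟨_, _, by simp, by simp, ?_, rfl⟩
      rintro ⟨-, h'⟩
      simp only [List.tail_cons, List.dropLast_concat] at h'
      exact h h'
  · rintro ⟨B, B', hB, hB', h, rfl⟩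
    obtain ⟨I, p, rfl⟩ := (List.eq_nil_or_concat B).resolve_left hB
    obtain ⟨y, S, rfl⟩ := List.exists_cons_of_ne_nil hB'
    by_cases hp : p.1 = y.1
    · right
      have h' : ¬ flat S.dropLast <+: flat (I.concat p).tail := fun h' =>
        h ⟨⟨p, y, by simp, rfl, hp⟩, h'⟩
      obtain ⟨x, R, hR⟩ := List.exists_cons_of_ne_nil hB
      rcases List.eq_nil_or_concat S with rfl | ⟨T, v, rfl⟩
      · exact absurd List.nil_prefix h'
      · rw [hR] at h' ⊢
        exact ⟨x, R, y, T, v, by simpa using h', by simp⟩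
    · exact .inl ⟨I, p, y, S, hp, by simp⟩

/-- The letters above the matched item are interleaved with their labels, and these ticks are
skipped. Superfluous ticks after the last letter cannot be excluded at this point. -/
theorem rel_subst (hF : F.WF) : rel code (subst F) c w c' ↔
    ∃ s k, w = flat s ++ List.replicate k tick ∧ F.Sem c ((s.map Prod.snd).map Fin.val) c' := by
  have hfilter : ∀ s k, (((flat s ++ List.replicate k tick).map (code (m := m))).filter
      (3 ≤ ·)).map (· - 3) = (s.map Prod.snd).map Fin.val := by
    intro s k
    induction s with
    | nil => simp [flat, code]
    | cons x s ih =>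
      rw [flat_cons, List.append_assoc, List.map_append, List.filter_append, List.map_append, ih]
      simp [flat, code]
  rw [rel, sem_subst hF]
  constructor
  · rintro ⟨h1, h2⟩
    obtain ⟨s, k, rfl⟩ := exists_flat w fun x hx => by
      have := h1 _ (List.mem_map_of_mem hx)
      cases x <;> simp [code] at this ⊢
    exact ⟨s, k, rfl, by rwa [hfilter] at h2⟩
  · rintro ⟨s, k, rfl, h⟩
    refine ⟨?_, by rwa [hfilter]⟩
    simp only [List.mem_map]
    rintro _ ⟨x, hx, rfl⟩
    have : x ≠ hash ∧ x ≠ dollar := by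
      rcases List.mem_append.1 hx with hx | hx
      · exact mem_flat hx
      · simp [(List.mem_replicate.1 hx).2]
    cases x <;> simp [code] at this ⊢

/-- The fragment `edge m F` accepts slightly more than the edge language, since ticks may remain
before the final `dollar`. Such words contain the bad pair of a tick and `dollar`, so they belong to
the history language anyway. -/
theorem rel_hist (hF : F.WF) : (∃ c', rel code (hist m F) 0 w c') ↔
    w ∈ histLang {w : List (Fin m) | ∃ c', F.Sem 0 (w.map Fin.val) c'} := by
  have hedge1 : (∃ c', rel code (edge m F) 0 w c') → w ∈ histLang {w : List (Fin m) |
      ∃ c', F.Sem 0 (w.map Fin.val) c'} := by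
    simp (maxDischargeDepth := 40) only [edge, wf_seq, wf_keep, wf_zero, wf_items, wf_star, wf_pop,
        wf_subst, hF,
      wf_item, wf_anyWord, rel_unions_cons, rel_unions_nil, or_false, rel_hash_seq,
      rel_pushTicks_seq, rel_letter_seq, rel_items_seq, rel_popTicks_seq, rel_zero_seq,
      rel_anyWord_seq, rel_item_seq, rel_seq (wf_subst hF), rel_subst hF, rel_dollar]
    have hbad : ∀ u k, u ++ (List.replicate (k + 1) tick ++ [dollar]) ∈ histLang {w : List (Fin m) |
        ∃ c', F.Sem 0 (w.map Fin.val) c'} := fun u k =>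
      .inr (.inl ⟨u ++ List.replicate k tick, [tick, dollar], [],
        by simp [List.replicate_succ'], .inl ⟨_, _, by simp [Adj], rfl⟩⟩)
    rintro ⟨c', _, rfl, h, _, rfl, b, _, rfl, ⟨I, _, rfl, l, _, d, hd, rfl, rfl, a, _, rfl, _, _, e,
      rfl, ⟨s, k, rfl, hs⟩, rfl, rfl⟩ | ⟨z, _, rfl, _, rfl, x, _, rfl, I, _, rfl, l, _, d, hd, rfl,
      rfl, a, _, rfl, _, _, e, rfl, ⟨s, k, rfl, hs⟩, rfl, rfl⟩⟩
    -- The zero test after the pops forces equal labels and hands over an empty counter to `F`.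
    · obtain rfl : l = h := by omega
      cases k with
      | zero =>
        exact .inr (.inr ⟨l, b, .inl ⟨I, a, s, by simp [block, flat, flat_append], _, hs⟩⟩)
      | succ k =>
        have := hbad (hash :: (List.replicate l tick ++ letter b :: (flat I ++
            (List.replicate l tick
          ++ letter a :: flat s)))) k
        simpa using this
    · obtain rfl : l = h := by omega
      cases k with
      | zero =>
        refine .inr (.inr ⟨l, b, .inr ⟨z, x, I, a, s, ?_, _, hs⟩⟩)
        rw [block, flat_cons x]
        simp [flat, flat_append]
      | succ k =>
        have := hbad (hash :: (List.replicate l tick ++ letter b :: (z ++ hash :: (flat [x] ++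
          (flat I ++ (List.replicate l tick ++ letter a :: flat s)))))) k
        simpa using this
  have hedge2 : w ∈ edgeLang {w : List (Fin m) | ∃ c', F.Sem 0 (w.map Fin.val) c'} →
      ∃ c', rel code (edge m F) 0 w c' := by
    simp (maxDischargeDepth := 40) only [edge, wf_seq, wf_keep, wf_zero, wf_items, wf_star, wf_pop,
        wf_subst, hF,
      wf_item, wf_anyWord, rel_unions_cons, rel_unions_nil, or_false, rel_hash_seq,
      rel_pushTicks_seq, rel_letter_seq, rel_items_seq, rel_popTicks_seq, rel_zero_seq,
      rel_anyWord_seq, rel_item_seq, rel_seq (wf_subst hF), rel_subst hF, rel_dollar]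
    rintro ⟨h, b, ⟨I, a, s, rfl, c', hs⟩ | ⟨z, x, I, a, s, rfl, c', hs⟩⟩
    · exact ⟨c', _, rfl, h, letter b :: (flat I ++ (List.replicate h tick ++ letter a ::
        (flat s ++ [dollar]))), by simp [flat, flat_append], b, _, rfl, .inl ⟨I, _, rfl, h, _, 0,
          rfl,
        rfl, rfl, a, _, rfl, _, _, c', rfl, ⟨s, 0, by simp, hs⟩, rfl, rfl⟩⟩
    · refine ⟨c', _, rfl, h, _, rfl, b, _, rfl, .inr ⟨z, _, rfl, _, rfl, x, flat I ++
        (List.replicate h tick ++ letter a :: (flat s ++ [dollar])), ?_, I, _, rfl, h, _, 0, rfl,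
        rfl, rfl, a, _, rfl, _, _, c', rfl, ⟨s, 0, by simp, hs⟩, rfl, rfl⟩⟩
      rw [flat_cons x]
      simp [flat, flat_append]
  have hfr : (∃ c', rel code (keep (1 :: 2 :: letters m) ⬝ anyWord m) 0 w c') ↔
      ∃ x l, w = x :: l ∧ x ∉ ({hash} : Set (Sym (Fin m))) := by
    simp only [rel_seq (wf_keep _), rel_keep, rel_anyWord]
    constructor
    · rintro ⟨_, _, v, _, rfl, ⟨x, hx, rfl, rfl⟩, rfl⟩
      refine ⟨x, v, rfl, ?_⟩
      rintro rfl
      simp [code, letters] at hx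
    · rintro ⟨x, v, rfl, hx⟩
      refine ⟨0, [x], v, 0, rfl, ⟨x, ?_, rfl, rfl⟩, rfl⟩
      cases x <;> simp [code, letters] at hx ⊢
  have hbad : (∃ c', rel code (anyWord m ⬝ bad m ⬝ anyWord m) 0 w c') ↔
      ∃ u b v, w = u ++ b ++ v ∧ b ∈ Bad := by
    simp only [rel_anyWord_seq, rel_seq wf_bad, rel_anyWord, ← rel_bad]
    constructor
    · rintro ⟨c', u, _, rfl, b, v, _, rfl, hb, rfl⟩
      exact ⟨u, b, v, by simp, _, hb⟩
    · rintro ⟨u, b, v, rfl, c', hb⟩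
      exact ⟨c', u, b ++ v, by simp, b, v, c', rfl, hb, rfl⟩
  rw [hist]
  simp (maxDischargeDepth := 10) only [wf_seq, wf_keep, wf_anyWord, wf_bad, rel_unions_cons,
      rel_unions_nil, or_false,
    exists_or, wf_edge hF, hfr, hbad]
  constructor
  · rintro (h | h | h)
    · exact .inl h
    · exact .inr (.inl h)
    · exact hedge1 h
  · rintro (h | h | h)
    · exact .inl h
    · exact .inr (.inl h)
    · exact .inr (.inr (hedge2 h))

end

end Sym

end OmegaPower

/-! ### Primitive recursiveness of the history construction. -/

namespace OmegaPower

theorem Frag.primrec_unions_cons {α : Type} [Primcodable α] {f : α → Frag} {l : α → List Frag}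
    (hf : Primrec f) (hl : Primrec fun x => unions (l x)) :
    Primrec fun x => unions (f x :: l x) := primrec_union hf hl

namespace Sym

open Frag

theorem primrec_letters : Primrec letters :=
  Primrec.list_map Primrec.list_range
    (Primrec.nat_add.comp Primrec.snd (Primrec.const 3)).to₂

theorem primrec_item : Primrec item :=
  primrec_seq (Primrec.const _) (primrec_keep primrec_letters)

theorem primrec_items : Primrec items := primrec_star primrec_item

theorem primrec_pushItems : Primrec pushItems :=
  primrec_star (primrec_seq (Primrec.const _) (primrec_push primrec_letters))

theorem primrec_popItems : Primrec popItems :=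
  primrec_star (primrec_seq (Primrec.const _) (primrec_pop primrec_letters))

theorem primrec_anyWord : Primrec anyWord :=
  primrec_star (primrec_keep (Primrec.list_cons.comp (Primrec.const 0) (Primrec.list_cons.comp
    (Primrec.const 1) (Primrec.list_cons.comp (Primrec.const 2) primrec_letters))))

section
variable {α : Type} [Primcodable α] {m z y : α → ℕ}

theorem primrec_tailFrom (hm : Primrec m) (hz : Primrec z) :
    Primrec fun x => tailFrom (m x) (z x) :=
  primrec_seq (primrec_keep (Primrec.list_cons.comp hz (Primrec.const [])))
    (Primrec.ite (Primrec.eq.comp hz (Primrec.const 1))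
      (primrec_seq (primrec_item.comp hm) (primrec_items.comp hm)) (primrec_items.comp hm))

theorem primrec_mismatch (hm : Primrec m) (hz : Primrec z) (hy : Primrec y) :
    Primrec fun x => mismatch (m x) (z x) (y x) := by
  have hG := primrec_seq (Primrec.const (keep [0])) <| primrec_seq (primrec_item.comp hm) <|
    primrec_seq (primrec_popItems.comp hm) <| primrec_seq (Primrec.const (star (pop [1]))) <|
    primrec_seq (Primrec.const zero) <| primrec_seq (primrec_tailFrom hm hz) <|
    primrec_seq (primrec_item.comp hm) (Primrec.const (keep [2]))
  have hG' := primrec_seq (Primrec.const (keep [2])) hG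
  exact primrec_seq (Primrec.const _) <| primrec_seq (primrec_item.comp hm) <|
    primrec_seq (primrec_pushItems.comp hm) <| Primrec.ite (Primrec.eq.comp hy hz) hG' <|
    primrec_seq (Primrec.const _) <| primrec_seq (primrec_tailFrom hm hy) hG'

end

theorem primrec_badPair : Primrec badPair := by
  refine primrec_unions_cons (Primrec.const _) <| primrec_unions_cons
    (primrec_seq (primrec_keep primrec_letters) (Primrec.const _)) <| primrec_unions_cons
    (primrec_seq (Primrec.const _) (primrec_keep ?_)) (Primrec.const (unions []))
  exact Primrec.list_cons.comp (Primrec.const 1) (Primrec.list_cons.comp (Primrec.const 2)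
    primrec_letters)

theorem primrec_badBlock : Primrec badBlock := by
  unfold badBlock
  repeat' first
    | with_reducible exact Primrec.const _
    | with_reducible exact primrec_item
    | with_reducible exact primrec_items
    | with_reducible exact primrec_letters
    | with_reducible apply primrec_unions_cons
    | with_reducible apply primrec_seq
    | with_reducible apply primrec_keep

theorem primrec_badHeader : Primrec badHeader := by
  unfold badHeader
  repeat' first
    | with_reducible exact Primrec.const _
    | with_reducible exact primrec_items
    | with_reducible exact primrec_letters
    | with_reducible apply primrec_unions_cons
    | with_reducible apply primrec_seq
    | with_reducible apply primrec_keep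

theorem primrec_badStack : Primrec badStack := by
  have h : ∀ {α : Type} [Primcodable α] {m : α → ℕ}, Primrec m →
      Primrec fun x => 1 :: letters (m x) := fun hm =>
    Primrec.list_cons.comp (Primrec.const 1) (primrec_letters.comp hm)
  have h' : Primrec₂ fun (x : ℕ × ℕ) y => mismatch x.1 x.2 y :=
    primrec_mismatch (Primrec.fst.comp Primrec.fst) (Primrec.snd.comp Primrec.fst) Primrec.snd
  have h'' : Primrec₂ fun m z => (1 :: letters m).map fun y => mismatch m z y :=
    Primrec.list_map (h Primrec.fst) h'
  exact primrec_unions (Primrec.list_flatMap (h Primrec.id) h'')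

theorem primrec_bad : Primrec bad :=
  primrec_unions_cons primrec_badPair <| primrec_unions_cons primrec_badBlock <|
    primrec_unions_cons primrec_badHeader <| primrec_unions_cons primrec_badStack
      (Primrec.const (unions []))

theorem primrec_hist {α : Type} [Primcodable α] {m : α → ℕ} {F : α → Frag} (hm : Primrec m)
    (hF : Primrec F) : Primrec fun x => hist (m x) (F x) := by
  have hl := primrec_letters.comp hm
  have hi := primrec_item.comp hm
  have his := primrec_items.comp hm
  have ha := primrec_anyWord.comp hm
  refine primrec_unions_cons (primrec_seq (primrec_keep (Primrec.list_cons.comp (Primrec.const 1)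
    (Primrec.list_cons.comp (Primrec.const 2) hl))) ha) (primrec_unions_cons (primrec_seq ha
      (primrec_seq (primrec_bad.comp hm) ha)) (primrec_unions_cons ?_
        (Primrec.const (unions []))))
  unfold edge
  repeat' first
    | with_reducible exact Primrec.const _
    | with_reducible exact hi
    | with_reducible exact his
    | with_reducible exact hl
    | with_reducible exact ha
    | with_reducible exact primrec_subst hF
    | with_reducible apply primrec_unions_cons
    | with_reducible apply primrec_seq
    | with_reducible apply primrec_keep

end Sym

end OmegaPower

/-! ### Normal forms of sets of low level, and the first base languages. -/

namespace OmegaPower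

open Filter

section NormalForm
variable {Y : Type} [TopologicalSpace Y] [DiscreteTopology Y] {A : Set (ℕ → Y)}

/-- Take `b t y` to say that the first `t` letters of `y` already force membership. -/
theorem exists_increasing (hA : IsOpen A) : ∃ b : ℕ → (ℕ → Y) → Prop,
    (∀ t, IsLocallyConstant (b t)) ∧ (∀ y, Monotone fun t => b t y) ∧ ∀ y, y ∈ A ↔ ∃ t, b t y := by
  refine ⟨fun t y => ∀ y' : ℕ → Y, (∀ i < t, y' i = y i) → y' ∈ A, fun t => ?_, fun y => ?_,
    fun y => ?_⟩
  · refine isLocallyConstant_of_prefix t fun y y' h => propext ?_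
    refine forall_congr' fun z => imp_congr_left (forall₂_congr fun i hi => ?_)
    rw [h i hi]
  · exact fun s t hst h y' hy' => h y' fun i hi => hy' i (hi.trans_le hst)
  · exact ⟨exists_prefix_of_isOpen hA, fun ⟨t, ht⟩ => ht y fun _ _ => rfl⟩

theorem isLocallyConstant_diag {X T : Type*} [TopologicalSpace X] {g : X → ℕ}
    (hg : IsLocallyConstant g) {c : ℕ → X → T} (hc : ∀ i, IsLocallyConstant (c i)) :
    IsLocallyConstant fun x => c (g x) x := by
  rw [IsLocallyConstant.iff_eventually_eq] at hg ⊢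
  intro x
  filter_upwards [hg x, (IsLocallyConstant.iff_eventually_eq _).1 (hc (g x)) x] with x' h1 h2
  rw [h1, h2]

-- The current guess `k t y` is an index `i` for which `y` is hoped to lie in the `i`-th closed set.
-- It moves on whenever it is refuted, and the refutations are the events `b`; they stop exactly
-- when some closed set contains `y`.
open Classical in
theorem exists_eventually (hA : A ∈ Sigma0 2 (ℕ → Y)) : ∃ b : ℕ → (ℕ → Y) → Prop,
    (∀ t, IsLocallyConstant (b t)) ∧ ∀ y, y ∈ A ↔ ∀ᶠ t in atTop, ¬ b t y := by
  obtain ⟨B, hB, rfl⟩ := hA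
  choose c hc hmono hiff using fun i => exists_increasing (mem_Pi0_one.1 (hB i)).isOpen_compl
  let k : ℕ → (ℕ → Y) → ℕ := fun t y =>
    Nat.rec 0 (fun s q => if c q s y then q + 1 else q) t
  have hk : ∀ t y, k (t + 1) y = if c (k t y) t y then k t y + 1 else k t y := fun _ _ => rfl
  have hkl : ∀ t, IsLocallyConstant (k t) := by
    intro t
    induction t with
    | zero => exact IsLocallyConstant.const 0
    | succ t ih =>
      exact isLocallyConstant_diag (c := fun i y => if c i t y then i + 1 else i) ih fun i =>
        (hc i t).comp fun P : Prop => if P then i + 1 else i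
  refine ⟨fun t y => c (k t y) t y, fun t => isLocallyConstant_diag (hkl t) fun i => hc i t,
    fun y => ?_⟩
  have hkm : Monotone fun t => k t y := monotone_nat_of_le_succ fun t => by
    rw [hk]; split_ifs <;> omega
  constructor
  · intro hy
    obtain ⟨i, hi⟩ := Set.mem_iUnion.1 hy
    -- A correct index is never refuted, so the guess cannot pass it.
    have hle : ∀ t, k t y ≤ i := by
      intro t
      induction t with
      | zero => exact Nat.zero_le _
      | succ t ih =>
        rw [hk]
        split_ifs with h
        · rcases ih.lt_or_eq with h' | h'
          · exact h'
          · rw [h'] at h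
            exact absurd hi ((hiff i y).2 ⟨t, h⟩)
        · exact ih
    by_contra hcon
    have hf : ∃ᶠ t in atTop, c (k t y) t y := hcon
    have : ∀ n, ∃ t, n ≤ k t y := by
      intro n
      induction n with
      | zero => exact ⟨0, Nat.zero_le _⟩
      | succ n ih =>
        obtain ⟨t, ht⟩ := ih
        obtain ⟨s, hs, h⟩ := frequently_atTop.1 hf t
        refine ⟨s + 1, ?_⟩
        rw [hk, if_pos h]
        have := hkm hs
        simp only at this
        omega
    obtain ⟨t, ht⟩ := this (i + 1)
    have := hle t
    omega
  · intro h
    obtain ⟨T, hT⟩ := eventually_atTop.1 h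
    have hconst : ∀ t, T ≤ t → k t y = k T y := by
      intro t ht
      induction t, ht using Nat.le_induction with
      | base => rfl
      | succ t ht ih => rw [hk, if_neg (hT t ht), ih]
    refine Set.mem_iUnion.2 ⟨k T y, ?_⟩
    by_contra hn
    obtain ⟨t, ht⟩ := (hiff (k T y) y).1 hn
    -- Refutations persist: a wrong final guess would still be refuted after stage `T`, where it can
    -- no longer change.
    have h1 := hmono (k T y) y (le_max_left t T) ht
    have h2 : ¬ c (k (max t T) y) (max t T) y := hT (max t T) (le_max_right _ _)
    rw [hconst _ (le_max_right _ _)] at h2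
    exact h2 h1

theorem exists_frequently (hA : A ∈ Pi0 2 (ℕ → Y)) : ∃ b : ℕ → (ℕ → Y) → Prop,
    (∀ t, IsLocallyConstant (b t)) ∧ ∀ y, y ∈ A ↔ ∃ᶠ t in atTop, b t y := by
  obtain ⟨b, h1, h2⟩ := exists_eventually (compl_mem_Sigma0.2 hA)
  refine ⟨b, h1, fun y => ?_⟩
  rw [← not_iff_not, Filter.not_frequently, ← h2, Set.mem_compl_iff]

theorem exists_exists_frequently (hA : A ∈ Sigma0 3 (ℕ → Y)) : ∃ b : ℕ → ℕ → (ℕ → Y) → Prop,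
    (∀ i t, IsLocallyConstant (b i t)) ∧ ∀ y, y ∈ A ↔ ∃ i, ∃ᶠ t in atTop, b i t y := by
  obtain ⟨B, hB, rfl⟩ := hA
  choose b h1 h2 using fun i => exists_frequently (hB i)
  exact ⟨b, h1, fun y => by simp only [Set.mem_iUnion, h2]⟩

end NormalForm

section Seg
variable {S : Type}

theorem seg_concat {σ : ℕ → S} {p q : ℕ} (h : p < q) :
    seg σ p (q - p) = seg σ p (q - 1 - p) ++ [σ (q - 1)] := by
  rw [show q - p = q - 1 - p + 1 by omega, seg_add, seg_one, show p + (q - 1 - p) = q - 1 by omega]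

theorem isClopen_apply [TopologicalSpace S] [DiscreteTopology S] (p : ℕ) (P : S → Prop) :
    IsClopen {σ : ℕ → S | P (σ p)} :=
  (isClopen_discrete {x | P x}).preimage (f := fun σ : ℕ → S => σ p) (continuous_apply p)

theorem isOpen_free [TopologicalSpace S] [DiscreteTopology S] (H : Set S) (Bad : Set (List S)) :
    IsOpen {σ : ℕ → S | σ 0 ∉ H ∨ ∃ p, ∃ b ∈ Bad, At σ p b} := by
  have h1 : IsOpen {σ : ℕ → S | σ 0 ∉ H} := (isClopen_apply 0 (· ∉ H)).isOpen
  have h2 : IsOpen (⋃ p, ⋃ b ∈ Bad, {σ : ℕ → S | At σ p b}) :=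
    isOpen_iUnion fun p => isOpen_biUnion fun b _ => isOpen_at p b
  convert h1.union h2 using 1
  ext σ
  simp

end Seg

namespace Sym

open Frag

local infixr:65 " ⬝ " => Frag.seq

/-- The language accepted by a fragment. -/
def accepted {m : ℕ} (F : Frag) : Language (Sym (Fin m)) := {w | ∃ c', rel code F 0 w c'}

/-- Accepts all words that start with a letter from `l` or have a factor accepted by `B`, and all
words accepted by `V`. -/
def free (m : ℕ) (l : List ℕ) (B V : Frag) : Frag :=
  unions [keep l ⬝ anyWord m, anyWord m ⬝ B ⬝ anyWord m, V]

theorem wf_free {m : ℕ} {l : List ℕ} {B V : Frag} (hB : B.WF) (hV : V.WF) : (free m l B V).WF := by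
  simp (maxDischargeDepth := 10) [free, hB, hV]

/-- The right side has the shape that `mem_omegaPower_free` expects, with `H` the letters outside
`l`. -/
theorem mem_accepted_free {m : ℕ} {l : List ℕ} {B V : Frag} (hB : B.WF) (hV : V.WF)
    (w : List (Sym (Fin m))) : w ∈ accepted (free m l B V) ↔
      (∃ x v, w = x :: v ∧ x ∉ {x : Sym (Fin m) | code x ∉ l}) ∨
      (∃ u b v, w = u ++ b ++ v ∧ b ∈ {b | ∃ c', rel code B 0 b c'}) ∨ w ∈ accepted V := by
  simp (maxDischargeDepth := 10) only [free, accepted, Set.mem_ofPred_eq, wf_seq, wf_keep,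
    wf_anyWord, hB, hV, rel_unions_cons, rel_unions_nil, or_false, exists_or, rel_seq hB,
    rel_seq (wf_keep _), rel_keep, rel_anyWord, rel_anyWord_seq, not_not]
  refine or_congr ?_ (or_congr ?_ Iff.rfl)
  · constructor
    · rintro ⟨_, _, v, _, rfl, ⟨x, hx, rfl, rfl⟩, rfl⟩
      exact ⟨x, v, rfl, hx⟩
    · rintro ⟨x, v, rfl, hx⟩
      exact ⟨0, [x], v, 0, rfl, ⟨x, hx, rfl, rfl⟩, rfl⟩
  · constructor
    · rintro ⟨c', u, _, rfl, b, v, _, rfl, hb, rfl⟩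
      exact ⟨u, b, v, by simp, _, hb⟩
    · rintro ⟨u, b, v, rfl, c', hb⟩
      exact ⟨c', u, b ++ v, by simp, b, v, c', rfl, hb, rfl⟩

theorem rel_pair {m c : ℕ} {l l' : List ℕ} {w : List (Sym (Fin m))} :
    (∃ c', rel code (keep l ⬝ keep l') c w c') ↔ ∃ x y, code x ∈ l ∧ code y ∈ l' ∧ w = [x, y] := by
  simp only [rel_seq (wf_keep _), rel_keep]
  constructor
  · rintro ⟨_, _, _, _, rfl, ⟨x, hx, rfl, rfl⟩, y, hy, rfl, rfl⟩
    exact ⟨x, y, hx, hy, rfl⟩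
  · rintro ⟨x, y, hx, hy, rfl⟩
    exact ⟨c, [x], [y], c, rfl, ⟨x, hx, rfl, rfl⟩, y, hy, rfl, rfl⟩

theorem at_pair {m p : ℕ} {σ : ℕ → Sym (Fin m)} {x y : Sym (Fin m)} :
    At σ p [x, y] ↔ σ p = x ∧ σ (p + 1) = y := by
  rw [at_cons, at_singleton]

/-! ### The base cases of finite level at most two -/

/-- A single point suffices: the omega-power contains only the constant word `hash`, and the
reduction deviates from it once the prefix read forces the complement. -/
theorem isComplete_closed :
    IsComplete (Pi0 1) (omegaPower (accepted (m := 2) (keep [0]))) := by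
  have hL : ∀ σ : ℕ → Sym (Fin 2), σ ∈ omegaPower (accepted (keep [0])) ↔ ∀ n, σ n = hash := by
    have hm : ∀ w : List (Sym (Fin 2)), w ∈ accepted (keep [0]) ↔ w = [hash] := by
      intro w
      change (∃ c', rel code _ 0 w c') ↔ _
      simp [rel_keep, code_eq_zero]
    intro σ
    constructor
    · intro h
      obtain ⟨f, h0, -, h⟩ := mem_omegaPower_iff.1 h
      have hf : ∀ k, f k = k := by
        intro k
        induction k with
        | zero => exact h0
        | succ k ih =>
          have := congrArg List.length ((hm _).1 (h k))
          simp at this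
          omega
      intro n
      have := (hm _).1 (h n)
      rw [hf, hf, show n + 1 - n = 1 by omega, seg_one] at this
      simpa using this
    · intro h
      refine mem_omegaPower_of_step (fun _ => True) trivial fun p _ => ⟨p + 1, by omega, trivial,
        ?_⟩
      rw [hm, show p + 1 - p = 1 by omega, seg_one, h]
  have hS : omegaPower (accepted (m := 2) (keep [0])) = ⋂ n, {σ | σ n = hash} := by
    ext σ
    simp [hL]
  refine ⟨?_, fun Y _ _ _ A hA => ?_⟩
  · rw [hS]
    exact isClosed_iInter fun n => (isClopen_apply n (· = hash)).isClosed
  · classical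
    obtain ⟨b, h1, -, h3⟩ := exists_increasing (mem_Pi0_one.1 hA).isOpen_compl
    refine ⟨fun y t => if b t y then tick else hash, continuous_pi fun t =>
      ((h1 t).comp fun P : Prop => if P then tick else hash).continuous, ?_⟩
    ext y
    rw [Set.mem_preimage, hL, ← not_iff_not, ← Set.mem_compl_iff, h3, not_forall]
    refine exists_congr fun t => ?_
    by_cases h : b t y <;> simp [h]

/-- Each factor ends with `hash`, so the omega-power consists of the words with infinitely many
`hash`. -/
theorem isComplete_frequently :
    IsComplete (Pi0 2) (omegaPower (accepted (m := 2) (anyWord 2 ⬝ keep [0]))) := by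
  have hL : ∀ σ : ℕ → Sym (Fin 2), σ ∈ omegaPower (accepted (anyWord 2 ⬝ keep [0])) ↔
      ∀ n, ∃ p, n ≤ p ∧ σ p = hash := by
    have hm : ∀ w : List (Sym (Fin 2)), w ∈ accepted (anyWord 2 ⬝ keep [0]) ↔
        ∃ u, w = u ++ [hash] := by
      intro w
      change (∃ c', rel code _ 0 w c') ↔ _
      simp [rel_anyWord_seq, rel_keep, code_eq_zero]
    intro σ
    constructor
    · intro h n
      obtain ⟨f, h0, hf, h⟩ := mem_omegaPower_iff.1 h
      have h1 := hf (Nat.lt_succ_self n)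
      have h2 := hf.le_apply (x := n)
      obtain ⟨u, hu⟩ := (hm _).1 (h n)
      rw [seg_concat h1] at hu
      exact ⟨f (n + 1) - 1, by simp only [Nat.succ_eq_add_one] at h1; omega,
        by simpa using (List.append_inj' hu rfl).2⟩
    · intro h
      refine mem_omegaPower_of_step (fun _ => True) trivial fun p _ => ?_
      obtain ⟨q, hq, hs⟩ := h p
      refine ⟨q + 1, by omega, trivial, ?_⟩
      rw [hm, seg_concat (by omega), Nat.add_sub_cancel, hs]
      exact ⟨_, rfl⟩
  have hS : omegaPower (accepted (m := 2) (anyWord 2 ⬝ keep [0])) =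
      ⋂ n, ⋃ p, ⋃ (_ : n ≤ p), {σ | σ p = hash} := by
    ext σ
    simp [hL]
  refine ⟨?_, fun Y _ _ _ A hA => ?_⟩
  · rw [hS]
    refine ⟨_, fun n => mem_Sigma0_one.2 ?_, rfl⟩
    exact isOpen_iUnion fun p => isOpen_iUnion fun _ => (isClopen_apply p (· = hash)).isOpen
  · classical
    obtain ⟨b, h1, h2⟩ := exists_frequently hA
    refine ⟨fun y t => if b t y then hash else tick, continuous_pi fun t =>
      ((h1 t).comp fun P : Prop => if P then hash else tick).continuous, ?_⟩
    ext y
    rw [Set.mem_preimage, hL, h2, frequently_atTop]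
    refine forall_congr' fun n => exists_congr fun t => and_congr_right fun _ => ?_
    by_cases h : b t y <;> simp [h]

/-- A fragment for an open set. -/
def openFrag : Frag := free 2 [1, 2, 3, 4] (keep [0] ⬝ keep [0]) (prim [])

theorem wf_openFrag : openFrag.WF := wf_free (by simp) (by simp)

/-- With `V` empty only free words remain: acceptance means a first letter other than `hash`, or two
adjacent letters `hash`. -/
theorem isComplete_open : IsComplete (Sigma0 1) (omegaPower (accepted (m := 2) openFrag)) := by
  have hL : ∀ σ : ℕ → Sym (Fin 2), σ ∈ omegaPower (accepted openFrag) ↔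
      σ 0 ∉ {x : Sym (Fin 2) | code x ∉ [1, 2, 3, 4]} ∨
        ∃ p, ∃ b ∈ {b : List (Sym (Fin 2)) | ∃ c', rel code (keep [0] ⬝ keep [0]) 0 b c'},
          At σ p b := by
    intro σ
    have hV : ∀ w : List (Sym (Fin 2)), w ∉ accepted (prim []) := by
      rintro w ⟨c', h⟩
      simp [rel, sem_prim] at h
    have h0 : ∀ x : Sym (Fin 2), x ∈ {x : Sym (Fin 2) | code x ∉ [1, 2, 3, 4]} → x = hash := by
      intro x
      rcases x with _ | _ | _ | a
      · simp
      · simp [code]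
      · simp [code]
      · fin_cases a <;> simp [code]
    rw [openFrag, mem_omegaPower_free (mem_accepted_free (m := 2) (l := [1, 2, 3, 4])
      (B := keep [0] ⬝ keep [0]) (V := prim []) (by simp) (by simp))]
    · refine or_congr_right (or_iff_left ?_)
      rintro ⟨w, hw, -⟩
      exact hV _ (hw 0)
    · intro x hx y hy
      rw [h0 x hx, h0 y hy]
      exact rel_pair.2 ⟨hash, hash, by simp [code], by simp [code], rfl⟩
    · exact fun w hw => absurd hw (hV w)
  refine ⟨?_, fun Y _ _ _ A hA => ?_⟩
  · rw [show omegaPower (accepted openFrag) = _ from Set.ext hL]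
    exact isOpen_free _ _
  · classical
    obtain ⟨b, h1, h2, h3⟩ := exists_increasing (mem_Sigma0_one.1 hA)
    -- The first letter is `hash` to prevent acceptance at the start. As `b` is monotone, one
    -- certificate produces two adjacent letters `hash`, and conversely the second of two such
    -- letters has positive index.
    refine ⟨fun y n => if n = 0 ∨ b n y then hash else tick, continuous_pi fun n =>
      ((h1 n).comp fun P : Prop => if n = 0 ∨ P then hash else tick).continuous, ?_⟩
    ext y
    rw [Set.mem_preimage, hL, h3]
    have e : ∀ n, (if n = 0 ∨ b n y then hash else tick : Sym (Fin 2)) = hash ↔ n = 0 ∨ b n y := by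
      intro n
      split_ifs with h <;> simp [h]
    constructor
    · rintro ⟨t, ht⟩
      refine .inr ⟨t + 1, _, rel_pair.2 ⟨hash, hash, by simp [code], by simp [code], rfl⟩,
        at_pair.2 ⟨(e _).2 (.inr ?_), (e _).2 (.inr ?_)⟩⟩
      · exact h2 y (by omega) ht
      · exact h2 y (show t ≤ t + 1 + 1 by omega) ht
    · rintro (h | ⟨p, b, h, hp⟩)
      · simp [code] at h
      · obtain ⟨x, x', -, hx, rfl⟩ := rel_pair.1 h
        have := (at_pair.1 hp).2
        rw [code_eq_zero.1 (List.mem_singleton.1 hx), e] at this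
        exact ⟨p + 1, this.resolve_left (by omega)⟩

end Sym

end OmegaPower

/-! ### Framed words and the language for the second additive level. -/

namespace OmegaPower

open Filter

namespace Sym

open Frag

local infixr:65 " ⬝ " => Frag.seq

/-- The letter that occurs at the start of an infinite word only. -/
def mark : Sym (Fin 2) := letter 0

/-- The infinite words that start with `mark` or `hash`, where `mark` occurs only at the start,
`dollar` is followed by `hash`, and `hash` does not follow `mark` or `hash`. -/
def Framed (σ : ℕ → Sym (Fin 2)) : Prop :=
  (σ 0 = hash ∨ σ 0 = mark) ∧ ∀ p, (σ p = dollar → σ (p + 1) = hash) ∧ σ (p + 1) ≠ mark ∧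
    (σ (p + 1) = hash → σ p ≠ hash ∧ σ p ≠ mark)

/-- Reads a pair of letters that does not occur in a framed infinite word. -/
def pairFrag : Frag := unions
  [keep [2] ⬝ keep [1, 2, 3, 4], keep [0, 1, 2, 3, 4] ⬝ keep [3], keep [0, 3] ⬝ keep [0]]

theorem wf_pairFrag : pairFrag.WF := by
  simp (maxDischargeDepth := 10) [pairFrag]

theorem code_mem (x : Sym (Fin 2)) : code x ∈ [0, 1, 2, 3, 4] := by
  rcases x with _ | _ | _ | a
  on_goal 4 => fin_cases a
  all_goals simp [code]

theorem code_eq_three {x : Sym (Fin 2)} : code x = 3 ↔ x = mark :=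
  code_injective.eq_iff (b := mark)

theorem code_mem_iff_ne_hash (x : Sym (Fin 2)) : code x ∈ [1, 2, 3, 4] ↔ x ≠ hash := by
  have := code_mem x
  rw [ne_eq, ← code_eq_zero]
  simp only [List.mem_cons, List.not_mem_nil, or_false] at this ⊢
  omega

theorem code_mem_iff_not_start (x : Sym (Fin 2)) :
    code x ∈ [1, 2, 4] ↔ ¬ (x = hash ∨ x = mark) := by
  have := code_mem x
  rw [← code_eq_zero, ← code_eq_three]
  simp only [List.mem_cons, List.not_mem_nil, or_false] at this ⊢
  omega

theorem rel_pairFrag {w : List (Sym (Fin 2))} :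
    (∃ c', rel code pairFrag 0 w c') ↔ ∃ x y, w = [x, y] ∧
      ((x = dollar ∧ y ≠ hash) ∨ y = mark ∨ ((x = hash ∨ x = mark) ∧ y = hash)) := by
  simp (maxDischargeDepth := 10) only [pairFrag, wf_seq, wf_keep, rel_unions_cons, rel_unions_nil,
    or_false, exists_or, rel_pair, code_mem, code_mem_iff_ne_hash, true_and]
  simp only [List.mem_cons, code_eq_two, code_eq_zero, code_eq_three, List.not_mem_nil, or_false]
  constructor
  · rintro (⟨x, y, hx, hy, rfl⟩ | ⟨x, y, hy, rfl⟩ | ⟨x, y, hx, hy, rfl⟩)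
    · exact ⟨x, y, rfl, .inl ⟨hx, hy⟩⟩
    · exact ⟨x, y, rfl, .inr (.inl hy)⟩
    · exact ⟨x, y, rfl, .inr (.inr ⟨hx, hy⟩)⟩
  · rintro ⟨x, y, rfl, ⟨hx, hy⟩ | hy | ⟨hx, hy⟩⟩
    · exact .inl ⟨x, y, hx, hy, rfl⟩
    · exact .inr (.inl ⟨x, y, hy, rfl⟩)
    · exact .inr (.inr ⟨x, y, hx, hy, rfl⟩)

/-- Being framed is a condition on the first letter and on pairs of neighbours. That `hash` may not
follow `hash` or `mark` makes any two possible first letters a bad pair, as `mem_omegaPower_free`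
requires. -/
theorem not_framed_iff {σ : ℕ → Sym (Fin 2)} : ¬ Framed σ ↔
    σ 0 ∉ {x : Sym (Fin 2) | code x ∉ [1, 2, 4]} ∨
      ∃ p, ∃ b ∈ {b | ∃ c', rel code pairFrag 0 b c'}, At σ p b := by
  simp only [Set.mem_ofPred_eq, code_mem_iff_not_start, rel_pairFrag, not_not]
  constructor
  · intro h
    by_contra! hc
    obtain ⟨h0, hp⟩ := hc
    refine h ⟨by tauto, fun p => ?_⟩
    have := mt (fun h => (⟨_, _, rfl, h⟩ : ∃ x y, [σ p, σ (p + 1)] = [x, y] ∧ _))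
      fun h => hp p _ h (at_pair.2 ⟨rfl, rfl⟩)
    tauto
  · rintro (h | ⟨p, _, ⟨x, y, rfl, h⟩, hp⟩) ⟨h0, hf⟩
    · exact h h0
    · obtain ⟨rfl, rfl⟩ := at_pair.1 hp
      have := hf p
      tauto

/-- Accepts the words in `V`, and all words that are not part of a framed infinite word without
factors in `B`. -/
def framed (B V : Frag) : Frag := free 2 [1, 2, 4] (unions [pairFrag, B]) V

section
variable {B V : Frag}

theorem wf_framed (hB : B.WF) (hV : V.WF) : (framed B V).WF :=
  wf_free (by simp [wf_pairFrag, hB]) hV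

/-- A final `dollar` can be followed only by `hash` in a framed word. Hence, as long as no defect
occurs, a factor from `V` is never followed by a free one. -/
theorem mem_omegaPower_framed (hB : B.WF) (hV : V.WF)
    (h : ∀ w, w ∈ accepted (m := 2) V → ∃ u, w = u ++ [dollar]) {σ : ℕ → Sym (Fin 2)} :
    σ ∈ omegaPower (accepted (framed B V)) ↔ ¬ Framed σ ∨ (∃ p, ∃ b ∈ accepted B, At σ p b) ∨
      σ ∈ omegaPower (accepted V) := by
  have hW : (unions [pairFrag, B]).WF := by simp [wf_pairFrag, hB]
  have hbad : ∀ b : List (Sym (Fin 2)), b ∈ {b | ∃ c', rel code (unions [pairFrag, B]) 0 b c'} ↔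
      b ∈ {b | ∃ c', rel code pairFrag 0 b c'} ∨ b ∈ accepted B := by
    intro b
    change (∃ c', rel code (unions [pairFrag, B]) 0 b c') ↔
      (∃ c', rel code pairFrag 0 b c') ∨ ∃ c', rel code B 0 b c'
    simp only [rel_unions_cons wf_pairFrag, rel_unions_cons hB, rel_unions_nil, or_false, exists_or]
  rw [framed, mem_omegaPower_free (mem_accepted_free hW hV), not_framed_iff, or_assoc]
  · refine or_congr_right ?_
    rw [← or_assoc]
    refine or_congr_left ?_
    simp only [hbad, or_and_right, exists_or]
  · intro x hx y hy
    simp only [Set.mem_ofPred_eq, code_mem_iff_not_start, not_not] at hx hy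
    refine (hbad _).2 (.inl (rel_pairFrag.2 ⟨x, y, rfl, ?_⟩))
    tauto
  · intro w hw
    obtain ⟨u, rfl⟩ := h w hw
    refine ⟨u, dollar, rfl, fun x hx => (hbad _).2 (.inl (rel_pairFrag.2 ⟨_, x, rfl, ?_⟩))⟩
    simp only [Set.mem_ofPred_eq, code_mem_iff_not_start, not_not] at hx
    tauto

theorem isOpen_not_framed : IsOpen {σ | ¬ Framed σ} := by
  simp only [not_framed_iff]
  exact isOpen_free _ _

end

/-! ### The base case of the second existential level -/

/-- Words that start with `mark` and end with `dollar`, and the word `hash dollar`. -/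
def tailFrag : Frag := unions [keep [3] ⬝ anyWord 2 ⬝ keep [2], keep [0] ⬝ keep [2]]

theorem wf_tailFrag : tailFrag.WF := by simp (maxDischargeDepth := 10) [tailFrag]

theorem mem_tailFrag {w : List (Sym (Fin 2))} : w ∈ accepted tailFrag ↔
    (∃ u, w = mark :: (u ++ [dollar])) ∨ w = [hash, dollar] := by
  change (∃ c', rel code tailFrag 0 w c') ↔ _
  simp (maxDischargeDepth := 10) only [tailFrag, wf_seq, wf_keep, wf_anyWord, rel_unions_cons,
    rel_unions_nil, or_false, exists_or, List.mem_singleton, code_eq_two, code_eq_zero,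
    rel_seq (wf_keep _), rel_anyWord_seq, rel_keep, code_eq_three]
  refine or_congr ?_ ?_
  · constructor
    · rintro ⟨_, _, _, _, rfl, ⟨_, rfl, rfl, rfl⟩, u, _, rfl, _, rfl, rfl, rfl⟩
      exact ⟨u, rfl⟩
    · rintro ⟨u, rfl⟩
      exact ⟨0, [mark], _, 0, rfl, ⟨_, rfl, rfl, rfl⟩, u, _, rfl, _, rfl, rfl, rfl⟩
  · constructor
    · rintro ⟨_, _, _, _, rfl, ⟨_, rfl, rfl, rfl⟩, _, rfl, rfl, rfl⟩
      rfl
    · rintro rfl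
      exact ⟨0, [hash], _, 0, rfl, ⟨_, rfl, rfl, rfl⟩, _, rfl, rfl, rfl⟩

/-- From position `p` on, the infinite word is periodic. -/
def Periodic (σ : ℕ → Sym (Fin 2)) (p : ℕ) : Prop :=
  ∀ n, σ (p + 2 * n) = hash ∧ σ (p + 2 * n + 1) = dollar

/-- A factor beginning with `mark` can swallow any finite part, but only once, since `mark` occurs
only at the start of a framed word. Every later factor is `hash dollar`. -/
theorem mem_omegaPower_tail {σ : ℕ → Sym (Fin 2)} (hσ : Framed σ) :
    σ ∈ omegaPower (accepted tailFrag) ↔ Periodic σ 0 ∨ σ 0 = mark ∧ ∃ p, Periodic σ p := by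
  constructor
  · intro h
    obtain ⟨f, h0, hf, hw⟩ := mem_omegaPower_iff.1 h
    simp only [mem_tailFrag] at hw
    have hstep : ∀ k, seg σ (f k) (f (k + 1) - f k) = [hash, dollar] →
        f (k + 1) = f k + 2 ∧ σ (f k) = hash ∧ σ (f k + 1) = dollar := by
      intro k h
      have h1 := congrArg List.length h
      simp at h1
      rw [show f (k + 1) - f k = 1 + 1 by omega, seg_succ, seg_one] at h
      simp only [List.cons.injEq, and_true] at h
      exact ⟨by omega, h⟩
    have h1 : ∀ k, seg σ (f (k + 1)) (f (k + 1 + 1) - f (k + 1)) = [hash, dollar] := by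
      intro k
      refine (hw (k + 1)).resolve_left ?_
      rintro ⟨u, hu⟩
      have h2 := hf (Nat.lt_succ_self (k + 1))
      have h3 := hf (Nat.succ_pos k)
      simp only [Nat.succ_eq_add_one] at h2 h3
      obtain ⟨d, hd⟩ : ∃ d, f (k + 1 + 1) - f (k + 1) = d + 1 :=
          ⟨_, (Nat.sub_add_cancel (by omega)).symm⟩
      rw [hd, seg_succ] at hu
      refine (hσ.2 (f (k + 1) - 1)).2.1 ?_
      rw [Nat.sub_add_cancel (by omega)]
      exact (List.cons.inj hu).1
    have h2 : ∀ n, f (n + 1) = f 1 + 2 * n := by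
      intro n
      induction n with
      | zero => rfl
      | succ n ih => rw [(hstep _ (h1 n)).1, ih]; ring
    have h3 : Periodic σ (f 1) := fun n => by
      rw [← h2 n]
      exact (hstep _ (h1 n)).2
    rcases hw 0 with ⟨u, hu⟩ | h4
    · right
      refine ⟨?_, _, h3⟩
      have h4 := hf (Nat.succ_pos 0)
      rw [Nat.succ_eq_add_one] at h4
      obtain ⟨d, hd⟩ : ∃ d, f (0 + 1) - f 0 = d + 1 := ⟨_, (Nat.sub_add_cancel (by omega)).symm⟩
      rw [hd, seg_succ, h0] at hu
      exact (List.cons.inj hu).1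
    · left
      obtain ⟨h5, h6⟩ := hstep 0 h4
      rw [h0] at h5 h6
      intro n
      cases n with
      | zero => exact h6
      | succ n =>
        have := h3 n
        rw [zero_add] at h5
        rw [h5] at this
        rwa [show 0 + 2 * (n + 1) = 2 + 2 * n by ring]
  · have hseg : ∀ p, σ p = hash → σ (p + 1) = dollar → seg σ p (p + 2 - p) = [hash, dollar] := by
      intro p h1 h2
      rw [show p + 2 - p = 1 + 1 by omega, seg_succ, seg_one, h1, h2]
    rintro (h | ⟨h0, p, h⟩)
    · refine mem_omegaPower_of_step (fun q => ∃ n, q = 2 * n) ⟨0, rfl⟩ ?_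
      rintro _ ⟨n, rfl⟩
      have := h n
      rw [zero_add] at this
      exact ⟨2 * n + 2, by omega, ⟨n + 1, by omega⟩, mem_tailFrag.2 (.inr (hseg _ this.1 this.2))⟩
    · refine mem_omegaPower_of_step (fun q => q = 0 ∨ ∃ n, q = p + 2 * n + 2) (.inl rfl) ?_
      rintro q hq
      rcases hq with rfl | ⟨n, rfl⟩
      · refine ⟨p + 2, by omega, .inr ⟨0, rfl⟩, mem_tailFrag.2 (.inl ⟨seg σ (0 + 1) p, ?_⟩)⟩
        rw [show p + 2 - 0 = p + 1 + 1 by omega, seg_succ, seg_add, seg_one, h0,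
          show 0 + 1 + p = p + 2 * 0 + 1 by omega, (h 0).2]
      · have := h (n + 1)
        rw [show p + 2 * (n + 1) = p + 2 * n + 2 by ring] at this
        exact ⟨p + 2 * n + 2 + 2, by omega, .inr ⟨n + 1, by ring⟩,
          mem_tailFrag.2 (.inr (hseg _ this.1 this.2))⟩

/-- A fragment for the second existential level. -/
def eventuallyFrag : Frag := framed (prim []) tailFrag

theorem wf_eventuallyFrag : eventuallyFrag.WF := wf_framed (by simp) wf_tailFrag

theorem mem_omegaPower_eventuallyFrag {σ : ℕ → Sym (Fin 2)} :
    σ ∈ omegaPower (accepted eventuallyFrag) ↔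
      ¬ Framed σ ∨ Periodic σ 0 ∨ σ 0 = mark ∧ ∃ p, Periodic σ p := by
  rw [eventuallyFrag, mem_omegaPower_framed (by simp) wf_tailFrag]
  · have h : ¬ ∃ p, ∃ b ∈ accepted (m := 2) (prim []), At σ p b := by
      rintro ⟨p, b, ⟨c', h⟩, -⟩
      simp [rel, sem_prim] at h
    simp only [h, false_or]
    by_cases hσ : Framed σ
    · rw [mem_omegaPower_tail hσ]
    · simp [hσ]
  · intro w hw
    rcases mem_tailFrag.1 hw with ⟨u, rfl⟩ | rfl
    · exact ⟨mark :: u, rfl⟩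
    · exact ⟨[hash], rfl⟩

open Classical in
/-- An infinite word that is periodic from some position on if and only if `b` eventually fails. -/
noncomputable def changes (b : ℕ → Prop) (n : ℕ) : Sym (Fin 2) :=
  if n = 0 then mark else if n % 4 = 0 then hash else if n % 4 = 3 then dollar else
    if n < 4 ∨ b (n / 4) then tick else if n % 4 = 1 then dollar else hash

/-- The word consists of groups of four letters. The first is `mark tick tick dollar`; group `t`
after it is `hash tick tick dollar` if `b t` holds and `hash dollar hash dollar` otherwise. -/
theorem framed_changes (b : ℕ → Prop) : Framed (changes b) := by
  classical
  have h0 : ∀ n, n ≠ 0 → n % 4 = 0 → changes b n = hash := fun n h1 h2 => by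
    rw [changes, if_neg h1, if_pos h2]
  have h3 : ∀ n, n % 4 = 3 → changes b n = dollar := fun n h => by
    rw [changes, if_neg (by omega), if_neg (by omega), if_pos h]
  have h1 : ∀ n, n % 4 = 1 → (changes b n = tick ∧ changes b (n + 1) = tick) ∨
      (changes b n = dollar ∧ changes b (n + 1) = hash) := fun n h => by
    have e1 : changes b n = if n < 4 ∨ b (n / 4) then tick else dollar := by
      rw [changes, if_neg (by omega), if_neg (by omega), if_neg (by omega), if_pos h]
    have e2 : changes b (n + 1) = if n + 1 < 4 ∨ b ((n + 1) / 4) then tick else hash := by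
      rw [changes, if_neg (by omega), if_neg (by omega), if_neg (by omega),
        if_neg (show ¬ (n + 1) % 4 = 1 by omega)]
    have e3 : (n + 1 < 4 ∨ b ((n + 1) / 4)) ↔ (n < 4 ∨ b (n / 4)) := by
      rw [show (n + 1) / 4 = n / 4 by omega]
      exact or_congr_left (by omega)
    rw [e1, e2]
    simp only [e3]
    split_ifs <;> simp
  refine ⟨.inr rfl, fun p => ?_⟩
  have hp : p % 4 = 0 ∨ p % 4 = 1 ∨ p % 4 = 2 ∨ p % 4 = 3 := by omega
  rcases hp with hp | hp | hp | hp
  · have h2 : changes b p = hash ∨ changes b p = mark := by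
      rcases Nat.eq_zero_or_pos p with rfl | h
      · exact .inr rfl
      · exact .inl (h0 p h.ne' hp)
    rcases h1 (p + 1) (by omega) with h4 | h4 <;> rcases h2 with h2 | h2 <;> simp [h2, h4, mark]
  · rcases h1 p hp with h4 | h4 <;> simp [h4, mark]
  · obtain ⟨q, rfl⟩ : ∃ q, p = q + 1 := ⟨p - 1, by omega⟩
    rcases h1 q (by omega) with h4 | h4 <;> simp [h4, mark, h3 (q + 1 + 1) (by omega)]
  · simp [h3 p hp, mark, h0 (p + 1) (by omega) (by omega)]

theorem periodic_changes {b : ℕ → Prop} :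
    (∃ p, Periodic (changes b) p) ↔ ∀ᶠ t in atTop, ¬ b t := by
  constructor
  · rintro ⟨p, hp⟩
    have h : ∀ n, p ≤ n → changes b n ≠ tick := by
      intro n hn h
      obtain ⟨j, hj | hj⟩ : ∃ j, n = p + 2 * j ∨ n = p + 2 * j + 1 := ⟨(n - p) / 2, by omega⟩
      · rw [hj, (hp j).1] at h; cases h
      · rw [hj, (hp j).2] at h; cases h
    filter_upwards [eventually_ge_atTop (p + 1)] with t ht hb
    refine h (4 * t + 1) (by omega) ?_
    rw [changes, if_neg (by omega), if_neg (by omega), if_neg (by omega),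
      if_pos (.inr (by rwa [show (4 * t + 1) / 4 = t by omega]))]
  · intro h
    obtain ⟨T, hT⟩ := eventually_atTop.1 h
    refine ⟨4 * (T + 1), fun n => ?_⟩
    have hb : ∀ i, 4 * (T + 1) ≤ i → ¬ (i < 4 ∨ b (i / 4)) := by
      rintro i hi (h | h)
      · omega
      · exact hT _ (by omega) h
    constructor
    · rw [changes, if_neg (by omega), if_neg (hb _ (by omega))]
      split_ifs <;> first | rfl | omega
    · rw [changes, if_neg (by omega), if_neg (hb _ (by omega))]
      split_ifs <;> first | rfl | omega

theorem isComplete_eventually :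
    IsComplete (Sigma0 2) (omegaPower (accepted (m := 2) eventuallyFrag)) := by
  have hper : ∀ p, IsClosed {σ | Periodic σ p} := by
    intro p
    have : {σ | Periodic σ p} = ⋂ n, {σ | σ (p + 2 * n) = hash ∧ σ (p + 2 * n + 1) = dollar} := by
      ext σ
      simp [Periodic]
    rw [this]
    exact isClosed_iInter fun n => (isClopen_apply _ (· = hash)).isClosed.inter
      (isClopen_apply _ (· = dollar)).isClosed
  refine ⟨?_, fun Y _ _ _ A hA => ?_⟩
  · have h : omegaPower (accepted eventuallyFrag) = {σ | ¬ Framed σ} ∪ ({σ | Periodic σ 0} ∪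
        ⋃ p, {σ | σ 0 = mark ∧ Periodic σ p}) := by
      ext σ
      simp [mem_omegaPower_eventuallyFrag]
    rw [h]
    refine union_mem_Sigma0 (Sigma0_mono le_rfl one_le_two isOpen_not_framed)
      (union_mem_Sigma0 (Pi0_subset_Sigma0 le_rfl one_lt_two (hper 0)) ⟨_, fun p => ?_, rfl⟩)
    exact (isClopen_apply 0 (· = mark)).isClosed.inter (hper p)
  · obtain ⟨b, h1, h2⟩ := exists_eventually hA
    refine ⟨fun y => changes fun t => b t y, continuous_pi fun n => ?_, ?_⟩
    · exact ((h1 (n / 4)).comp fun P => changes (fun _ => P) n).continuous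
    · ext y
      rw [Set.mem_preimage, mem_omegaPower_eventuallyFrag, h2, ← periodic_changes]
      have h3 : ¬ Periodic (changes fun t => b t y) 0 := fun h => by
        have := (h 0).1
        simp [changes, mark] at this
      simp only [framed_changes, not_true_eq_false, false_or, h3]
      exact (and_iff_right rfl).symm

end Sym

end OmegaPower

namespace OmegaPower

open Filter

theorem at_replicate {S : Type*} {σ : ℕ → S} {p k : ℕ} {x : S} :
    At σ p (List.replicate k x) ↔ ∀ i < k, σ (p + i) = x := by
  rw [at_iff_getElem]
  simp

namespace Sym

open Frag

local infixr:65 " ⬝ " => Frag.seq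

/-! ### The base case of the third existential level -/

/-- The letter that precedes a number in unary. -/
def sep : Sym (Fin 2) := letter 1

theorem code_eq_four {x : Sym (Fin 2)} : code x = 4 ↔ x = sep :=
  code_injective.eq_iff (b := sep)

theorem code_mem_iff_ne_tick (x : Sym (Fin 2)) : code x ∈ [0, 2, 3, 4] ↔ x ≠ tick := by
  have := code_mem x
  rw [ne_eq, ← code_eq_one]
  simp only [List.mem_cons, List.not_mem_nil, or_false] at this ⊢
  omega

/-- A number in unary between `sep` and `dollar` that is not repeated after the next `hash`. -/
def unlinkFrag : Frag := keep [4] ⬝ star (push [1]) ⬝ keep [2] ⬝ keep [0] ⬝ star (pop [1]) ⬝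
  unions [zero ⬝ keep [1], pos ⬝ keep [0, 2, 3, 4]]

theorem wf_unlinkFrag : unlinkFrag.WF := by simp (maxDischargeDepth := 10) [unlinkFrag]

theorem rel_sep_seq {c c' : ℕ} {w : List (Sym (Fin 2))} {G : Frag} :
    rel code (keep [4] ⬝ G) c w c' ↔ ∃ v, w = sep :: v ∧ rel code G c v c' := by
  rw [rel_seq (wf_keep _)]
  simp only [rel_keep, List.mem_singleton, code_eq_four]
  constructor
  · rintro ⟨_, v, _, rfl, ⟨_, rfl, rfl, rfl⟩, h⟩
    exact ⟨v, rfl, h⟩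
  · rintro ⟨v, rfl, h⟩
    exact ⟨_, v, _, rfl, ⟨_, rfl, rfl, rfl⟩, h⟩

/-- A repetition that is too long is already recognised by one tick after the first `p`, so the word
may stop there; one that is too short leaves a positive counter at its end. -/
theorem mem_unlinkFrag {w : List (Sym (Fin 2))} : w ∈ accepted unlinkFrag ↔
    ∃ p q x, w = sep :: (List.replicate p tick ++ dollar :: hash :: (List.replicate q tick ++
      [x])) ∧
      ((p = q ∧ x = tick) ∨ (q < p ∧ x ≠ tick)) := by
  change (∃ c', rel code unlinkFrag 0 w c') ↔ _
  simp (maxDischargeDepth := 10) only [unlinkFrag, wf_seq, wf_keep, wf_zero, wf_pos,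
    rel_unions_cons, rel_unions_nil, or_false, rel_sep_seq, rel_pushTicks_seq, rel_dollar_seq,
    rel_hash_seq, rel_popTicks_seq, rel_zero_seq, rel_pos_seq, rel_keep, code_mem_iff_ne_tick,
    List.mem_singleton, code_eq_one]
  constructor
  · rintro ⟨c', _, rfl, p, _, rfl, _, rfl, _, rfl, q, _, d, hd, rfl, h⟩
    rcases h with ⟨rfl, x, rfl, rfl, -⟩ | ⟨h, x, hx, rfl, -⟩
    · exact ⟨p, q, _, rfl, .inl ⟨by omega, rfl⟩⟩
    · exact ⟨p, q, x, rfl, .inr ⟨by omega, hx⟩⟩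
  · rintro ⟨p, q, x, rfl, ⟨rfl, rfl⟩ | ⟨h, hx⟩⟩
    · exact ⟨0, _, rfl, p, _, rfl, _, rfl, _, rfl, p, _, 0, rfl, rfl, .inl ⟨rfl, _, rfl, rfl, rfl⟩⟩
    · exact ⟨p - q, _, rfl, p, _, rfl, _, rfl, _, rfl, q, _, p - q, by omega, rfl,
        .inr ⟨by omega, _, hx, rfl, rfl⟩⟩

/-- Words that start with `mark` and end with `dollar`, and words that start with a number in unary
and end with the same number. -/
def linkFrag : Frag :=
  let G := keep [4] ⬝ star (pop [1]) ⬝ zero ⬝ keep [2]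
  unions [keep [3] ⬝ anyWord 2 ⬝ keep [2], keep [0] ⬝ star (push [1]) ⬝ G,
    keep [0] ⬝ star (push [1]) ⬝ keep [0, 2, 3, 4] ⬝ anyWord 2 ⬝ G]

theorem wf_linkFrag : linkFrag.WF := by simp (maxDischargeDepth := 10) [linkFrag]

theorem mem_linkFrag {w : List (Sym (Fin 2))} : w ∈ accepted linkFrag ↔
    (∃ u, w = mark :: (u ++ [dollar])) ∨ ∃ i r, (∀ x ∈ r.head?, x ≠ tick) ∧
      w = hash :: (List.replicate i tick ++ (r ++ sep :: (List.replicate i tick ++ [dollar]))) := by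
  change (∃ c', rel code linkFrag 0 w c') ↔ _
  simp (maxDischargeDepth := 10) only [linkFrag, wf_seq, wf_keep, wf_anyWord, wf_star, wf_push,
      wf_pop, wf_zero,
    rel_unions_cons, rel_unions_nil, or_false, exists_or, rel_sep_seq, rel_pushTicks_seq,
    rel_hash_seq, rel_popTicks_seq, rel_zero_seq, rel_anyWord_seq,
    rel_seq (wf_keep [3]), rel_seq (wf_keep [0, 2, 3, 4]), rel_keep, code_mem_iff_ne_tick,
    List.mem_singleton, code_eq_three, code_eq_two]
  refine or_congr ?_ ?_
  · constructor
    · rintro ⟨_, _, _, _, rfl, ⟨_, rfl, rfl, rfl⟩, u, _, rfl, _, rfl, rfl, rfl⟩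
      exact ⟨u, rfl⟩
    · rintro ⟨u, rfl⟩
      exact ⟨0, [mark], _, 0, rfl, ⟨_, rfl, rfl, rfl⟩, u, _, rfl, _, rfl, rfl, rfl⟩
  · constructor
    · rintro (⟨_, _, rfl, i, _, rfl, _, rfl, j, _, d, hd, rfl, rfl, _, rfl, rfl, -⟩ |
        ⟨_, _, rfl, i, _, rfl,
        _, _, _, rfl, ⟨x, hx, rfl, rfl⟩, u, _, rfl, _, rfl, j, _, d, hd, rfl, rfl, _, rfl, rfl,
        -⟩)
      · obtain rfl : j = i := by omega
        exact ⟨j, [], by simp, rfl⟩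
      · obtain rfl : j = i := by omega
        exact ⟨j, x :: u, by simpa using hx, by simp⟩
    · rintro ⟨i, _ | ⟨x, r⟩, hr, rfl⟩
      · exact .inl ⟨0, _, rfl, i, _, rfl, _, rfl, i, _, 0, rfl, rfl, rfl, _, rfl, rfl, rfl⟩
      · exact .inr ⟨0, _, rfl, i, _, rfl, [x], _, _, rfl, ⟨x, by simpa using hr, rfl, rfl⟩, r, _,
            rfl,
          _, rfl, i, _, 0, rfl, rfl, rfl, _, rfl, rfl, rfl⟩

/-- The number `i` in unary occurs at position `p`. -/
def Occurs (σ : ℕ → Sym (Fin 2)) (i p : ℕ) : Prop :=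
  At σ p (sep :: (List.replicate i tick ++ [dollar]))

theorem occurs_iff {σ : ℕ → Sym (Fin 2)} {i p : ℕ} : Occurs σ i p ↔
    σ p = sep ∧ (∀ j < i, σ (p + 1 + j) = tick) ∧ σ (p + 1 + i) = dollar := by
  rw [Occurs, at_cons, at_append, at_replicate, at_singleton, List.length_replicate]

/-- The letter `hash` followed by the number `i` in unary occurs at position `p`. -/
def Starts (σ : ℕ → Sym (Fin 2)) (i p : ℕ) : Prop :=
  σ p = hash ∧ (∀ j < i, σ (p + 1 + j) = tick) ∧ σ (p + 1 + i) ≠ tick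

theorem ticks_unique {σ : ℕ → Sym (Fin 2)} {i j p : ℕ} (hi : ∀ k < i, σ (p + k) = tick)
    (hi' : σ (p + i) ≠ tick) (hj : ∀ k < j, σ (p + k) = tick) (hj' : σ (p + j) ≠ tick) : i = j := by
  rcases lt_trichotomy i j with h | h | h
  · exact absurd (hj i h) hi'
  · exact h
  · exact absurd (hi j h) hj'

theorem Starts.unique {σ : ℕ → Sym (Fin 2)} {i j p : ℕ} (hi : Starts σ i p) (hj : Starts σ j p) :
    i = j := ticks_unique hi.2.1 hi.2.2 hj.2.1 hj.2.2

/-- Without defects the ticks after the next `hash` can neither stop before `i` nor continue beyond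
it, so the number is copied. -/
theorem starts_of_occurs {σ : ℕ → Sym (Fin 2)} (hσ : Framed σ)
    (hb : ¬ ∃ p, ∃ b ∈ accepted unlinkFrag, At σ p b) {i p : ℕ} (h : Occurs σ i p) :
    Starts σ i (p + i + 2) := by
  have hbad : ∀ q x, ((i = q ∧ x = tick) ∨ (q < i ∧ x ≠ tick)) →
      (∀ j < q, σ (p + i + 2 + 1 + j) = tick) → σ (p + i + 2 + 1 + q) ≠ x := by
    intro q x hq hj hx
    refine hb ⟨p, _, mem_unlinkFrag.2 ⟨i, q, x, rfl, hq⟩, ?_⟩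
    obtain ⟨h1, h2, h3⟩ := occurs_iff.1 h
    rw [at_cons, at_append, at_cons, at_cons, at_append, at_singleton, at_replicate, at_replicate,
      List.length_replicate, List.length_replicate]
    have e : p + 1 + i + 1 + 1 = p + i + 2 + 1 := by ring
    refine ⟨h1, h2, h3, (hσ.2 _).1 h3, ?_, ?_⟩
    · rwa [e]
    · rwa [e]
  have hq : ∀ q ≤ i, ∀ j < q, σ (p + i + 2 + 1 + j) = tick := by
    intro q hq
    induction q with
    | zero => exact fun j hj => absurd hj (Nat.not_lt_zero _)
    | succ q ih =>
      have ih' := ih (by omega)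
      intro j hj
      rcases Nat.lt_succ_iff_lt_or_eq.1 hj with h' | rfl
      · exact ih' j h'
      · by_contra hx
        exact hbad j _ (.inr ⟨hq, hx⟩) ih' rfl
  have h3 := (occurs_iff.1 h).2.2
  refine ⟨?_, hq i le_rfl, hbad i tick (.inl ⟨rfl, rfl⟩) (hq i le_rfl)⟩
  rw [show p + i + 2 = p + 1 + i + 1 by ring]
  exact (hσ.2 _).1 h3

/-- A link word begins and ends with the same number, and in the absence of defects this number is
copied to the beginning of the next link word. So a single `i` is handed on through the whole
factorization, while numbers between two cuts are ignored. -/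
theorem mem_omegaPower_link {σ : ℕ → Sym (Fin 2)} (hσ : Framed σ)
    (hb : ¬ ∃ p, ∃ b ∈ accepted unlinkFrag, At σ p b) :
    σ ∈ omegaPower (accepted linkFrag) ↔
      ∃ i, (∀ n, ∃ p, n ≤ p ∧ Occurs σ i p) ∧ (σ 0 = mark ∨ Starts σ i 0) := by
  constructor
  · intro h
    obtain ⟨f, h0, hf, hw⟩ := mem_omegaPower_iff.1 h
    simp only [mem_linkFrag] at hw
    have hlt : ∀ k, f k < f (k + 1) := fun k => hf (Nat.lt_succ_self k)
    have hlink : ∀ k i r, (∀ x ∈ r.head?, x ≠ tick) → seg σ (f k) (f (k + 1) - f k) =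
        hash :: (List.replicate i tick ++ (r ++ sep :: (List.replicate i tick ++ [dollar]))) →
        Starts σ i (f k) ∧ ∃ p, f k ≤ p ∧ f (k + 1) = p + i + 2 ∧ Occurs σ i p := by
      intro k i r hr hs
      have h1 := congrArg List.length hs
      have h2 := at_seg σ (f k) (f (k + 1) - f k)
      rw [hs, at_cons, at_append, at_append, at_replicate, List.length_replicate] at h2
      obtain ⟨h3, h4, h5, h6⟩ := h2
      simp at h1
      have := hlt k
      refine ⟨⟨h3, h4, ?_⟩, f k + 1 + i + r.length, by omega, by omega, h6⟩
      -- After the ticks comes `sep` or the first letter of `r`. Neither is a tick, so the number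
      -- read is the whole run.
      cases r with
      | nil =>
        have := (at_cons.1 h6).1
        simp only [List.length_nil, add_zero] at this
        rw [this]
        simp [sep]
      | cons x r =>
        rw [(at_cons.1 h5).1]
        exact hr x rfl
    have hk : ∀ k, ∃ i, Starts σ i (f (k + 1)) ∧
        ∃ p, f (k + 1) ≤ p ∧ f (k + 1 + 1) = p + i + 2 ∧ Occurs σ i p := by
      intro k
      rcases hw (k + 1) with ⟨u, hu⟩ | ⟨i, r, hr, hs⟩
      · exfalso
        have h1 := hlt k
        have h2 := hlt (k + 1)
        obtain ⟨d, hd⟩ : ∃ d, f (k + 1 + 1) - f (k + 1) = d + 1 :=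
          ⟨_, (Nat.sub_add_cancel (by omega)).symm⟩
        rw [hd, seg_succ] at hu
        refine (hσ.2 (f (k + 1) - 1)).2.1 ?_
        rw [Nat.sub_add_cancel (by omega)]
        exact (List.cons.inj hu).1
      · exact ⟨i, hlink _ i r hr hs⟩
    obtain ⟨i, hi⟩ := hk 0
    have hall : ∀ k, Starts σ i (f (k + 1)) ∧
        ∃ p, f (k + 1) ≤ p ∧ f (k + 1 + 1) = p + i + 2 ∧ Occurs σ i p := by
      intro k
      induction k with
      | zero => exact hi
      | succ k ih =>
        obtain ⟨-, p, -, hp, ho⟩ := ih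
        obtain ⟨j, hj⟩ := hk (k + 1)
        have h1 := starts_of_occurs hσ hb ho
        rw [← hp] at h1
        rwa [h1.unique hj.1]
    refine ⟨i, fun n => ?_, ?_⟩
    · obtain ⟨-, p, hp, -, ho⟩ := hall n
      have := hf.le_apply (x := n + 1)
      exact ⟨p, by omega, ho⟩
    · rcases hw 0 with ⟨u, hu⟩ | ⟨j, r, hr, hs⟩
      · left
        have h1 := hlt 0
        obtain ⟨d, hd⟩ : ∃ d, f (0 + 1) - f 0 = d + 1 :=
          ⟨_, (Nat.sub_add_cancel (by omega)).symm⟩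
        rw [hd, seg_succ, h0] at hu
        exact (List.cons.inj hu).1
      · right
        obtain ⟨h1, p, -, hp, ho⟩ := hlink 0 j r hr hs
        have h2 := starts_of_occurs hσ hb ho
        rw [← hp] at h2
        rw [h0] at h1
        rwa [hi.1.unique h2]
  · rintro ⟨i, ho, hs⟩
    refine mem_omegaPower_of_step (fun q => q = 0 ∨ ∃ p, q = p + i + 2 ∧ Occurs σ i p) (.inl rfl) ?_
    intro q hq
    by_cases h0 : q = 0 ∧ σ 0 = mark
    · obtain ⟨rfl, h0⟩ := h0
      obtain ⟨p, hp, h⟩ := ho 1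
      refine ⟨p + i + 2, by omega, .inr ⟨p, rfl, h⟩, mem_linkFrag.2 (.inl ⟨seg σ 1 (p + i), ?_⟩)⟩
      rw [show p + i + 2 - 0 = p + i + 1 + 1 by omega, seg_succ, seg_add, seg_one, h0,
        show 0 + 1 + (p + i) = p + 1 + i by omega, (occurs_iff.1 h).2.2]
    · have hst : Starts σ i q := by
        rcases hq with rfl | ⟨p, rfl, h⟩
        · exact hs.resolve_left fun h => h0 ⟨rfl, h⟩
        · exact starts_of_occurs hσ hb h
      -- The next occurrence is sought beyond the number that starts at `q`, so that the two do not
      -- overlap.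
      obtain ⟨p, hp, h⟩ := ho (q + 1 + i)
      refine ⟨p + i + 2, by omega, .inr ⟨p, rfl, h⟩, mem_linkFrag.2 (.inr ⟨i,
        seg σ (q + 1 + i) (p - (q + 1 + i)), ?_, ?_⟩)⟩
      · intro x hx
        rcases Nat.eq_zero_or_pos (p - (q + 1 + i)) with h' | h'
        · rw [h'] at hx
          simp [seg] at hx
        · obtain ⟨d, hd⟩ := Nat.exists_eq_succ_of_ne_zero h'.ne'
          rw [hd, Nat.succ_eq_add_one, seg_succ] at hx
          simp only [List.head?_cons, Option.mem_some_iff] at hx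
          rw [← hx]
          exact hst.2.2
      · have e1 : seg σ (q + 1) i = List.replicate i tick := by
          have := at_replicate.2 hst.2.1
          rwa [At, List.length_replicate] at this
        have e2 : seg σ p (i + 2) = sep :: (List.replicate i tick ++ [dollar]) := by
          have h' : At σ p _ := h
          rw [At] at h'
          rw [← h']
          simp
        rw [show p + i + 2 - q = i + (p - (q + 1 + i) + (i + 2)) + 1 by omega, seg_succ, seg_add,
          seg_add, e1, hst.1, show q + 1 + i + (p - (q + 1 + i)) = p by omega, e2]

/-- A fragment for the third existential level. -/
def existsFrequentlyFrag : Frag := framed unlinkFrag linkFrag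

theorem wf_existsFrequentlyFrag : existsFrequentlyFrag.WF := wf_framed wf_unlinkFrag wf_linkFrag

theorem mem_omegaPower_existsFrequentlyFrag {σ : ℕ → Sym (Fin 2)} :
    σ ∈ omegaPower (accepted existsFrequentlyFrag) ↔
      ¬ Framed σ ∨ (∃ p, ∃ b ∈ accepted unlinkFrag, At σ p b) ∨
        ∃ i, (∀ n, ∃ p, n ≤ p ∧ Occurs σ i p) ∧ (σ 0 = mark ∨ Starts σ i 0) := by
  rw [existsFrequentlyFrag, mem_omegaPower_framed wf_unlinkFrag wf_linkFrag]
  · by_cases hσ : Framed σ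
    · by_cases hb : ∃ p, ∃ b ∈ accepted unlinkFrag, At σ p b
      · simp only [hb, true_or]
      · simp only [hb, false_or, mem_omegaPower_link hσ hb]
    · simp only [hσ, not_false_eq_true, true_or]
  · intro w hw
    rcases mem_linkFrag.1 hw with ⟨u, rfl⟩ | ⟨i, r, -, rfl⟩
    · exact ⟨mark :: u, rfl⟩
    · exact ⟨hash :: (List.replicate i tick ++ (r ++ sep :: List.replicate i tick)), by simp⟩

/-- The blocks of an infinite word in which the numbers `n t` occur. -/
def numberBlock (n : ℕ → ℕ) : ℕ → List (Sym (Fin 2))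
  | 0 => [mark]
  | t + 1 => sep :: (List.replicate (n t) tick ++ dollar :: hash :: List.replicate (n t) tick)

theorem numberBlock_ne_nil (n : ℕ → ℕ) (t : ℕ) : numberBlock n t ≠ [] := by
  cases t <;> simp [numberBlock]

/-- An infinite word in which the numbers `n t` occur. -/
def numbers (n : ℕ → ℕ) : ℕ → Sym (Fin 2) := concat (numberBlock n) (numberBlock_ne_nil n)

/-- The position of the number `n t`. -/
def position (n : ℕ → ℕ) (t : ℕ) : ℕ := (cum (numberBlock n) (t + 1)).length

section
variable (n : ℕ → ℕ)

theorem position_succ (t : ℕ) : position n (t + 1) = position n t + 2 * n t + 3 := by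
  rw [position, cum_succ, List.length_append, position]
  simp [numberBlock]
  omega

theorem strictMono_position : StrictMono (position n) :=
  strictMono_nat_of_lt_succ fun t => by rw [position_succ]; omega

theorem numbers_zero : numbers n 0 = mark := rfl

theorem numbers_at (t : ℕ) : numbers n (position n t) = sep ∧
    (∀ j < n t, numbers n (position n t + 1 + j) = tick) ∧
    numbers n (position n t + 1 + n t) = dollar ∧ numbers n (position n t + 1 + n t + 1) = hash ∧
    ∀ j < n t, numbers n (position n t + 1 + n t + 1 + 1 + j) = tick := by
  have h := at_concat (numberBlock_ne_nil n) (t + 1)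
  rw [numberBlock, at_cons, at_append, at_cons, at_cons, at_replicate, at_replicate,
    List.length_replicate] at h
  exact h

theorem exists_position {p : ℕ} (hp : 1 ≤ p) : ∃ t j, p = position n t + j ∧ j < 2 * n t + 3 := by
  induction p, hp using Nat.le_induction with
  | base => exact ⟨0, 0, rfl, by omega⟩
  | succ p _ ih =>
    obtain ⟨t, j, rfl, hj⟩ := ih
    rcases Nat.lt_or_ge (j + 1) (2 * n t + 3) with h | h
    · exact ⟨t, j + 1, rfl, h⟩
    · exact ⟨t + 1, 0, by rw [position_succ]; omega, by omega⟩

/-- The possible positions in a block and the letters that follow. -/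
theorem numbers_cases (p : ℕ) : (p = 0 ∧ numbers n p = mark ∧ numbers n (p + 1) = sep) ∨
    (∃ t, p = position n t ∧ numbers n p = sep ∧
      (numbers n (p + 1) = tick ∨ numbers n (p + 1) = dollar)) ∨
    (numbers n p = tick ∧ (numbers n (p + 1) = tick ∨ numbers n (p + 1) = dollar ∨
      numbers n (p + 1) = sep)) ∨
    (numbers n p = dollar ∧ numbers n (p + 1) = hash) ∨
    (numbers n p = hash ∧ (numbers n (p + 1) = tick ∨ numbers n (p + 1) = sep)) := by
  rcases Nat.eq_zero_or_pos p with rfl | hp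
  · exact .inl ⟨rfl, rfl, (numbers_at n 0).1⟩
  · right
    obtain ⟨t, j, rfl, hj⟩ := exists_position n hp
    obtain ⟨h1, h2, h3, h4, h5⟩ := numbers_at n t
    have h6 := (numbers_at n (t + 1)).1
    rw [position_succ] at h6
    have hc : j = 0 ∨ (∃ k, k < n t ∧ j = 1 + k) ∨ j = 1 + n t ∨ j = 1 + n t + 1 ∨
        ∃ k, k < n t ∧ j = 1 + n t + 1 + 1 + k := by
      by_cases ha : j = 0
      · exact .inl ha
      by_cases hb : j < 1 + n t
      · exact .inr (.inl ⟨j - 1, by omega, by omega⟩)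
      by_cases hd : j < 1 + n t + 1 + 1
      · omega
      · exact .inr (.inr (.inr (.inr ⟨j - (1 + n t + 1 + 1), by omega, by omega⟩)))
    rcases hc with rfl | ⟨k, hk, rfl⟩ | rfl | rfl | ⟨k, hk, rfl⟩
    · refine .inl ⟨t, rfl, h1, ?_⟩
      rcases Nat.eq_zero_or_pos (n t) with h0 | h0
      · rw [h0] at h3
        exact .inr h3
      · exact .inl (h2 0 h0)
    · refine .inr (.inl ⟨by rw [← add_assoc]; exact h2 k hk, ?_⟩)
      rcases Nat.lt_or_ge (k + 1) (n t) with h0 | h0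
      · left
        rw [← h2 _ h0]
        congr 1
        ring
      · right; left
        rw [← h3]
        congr 1
        omega
    · exact .inr (.inr (.inl ⟨by rw [← add_assoc]; exact h3, by rw [← add_assoc]; exact h4⟩))
    · refine .inr (.inr (.inr ⟨by simp only [← add_assoc]; exact h4, ?_⟩))
      rcases Nat.eq_zero_or_pos (n t) with h0 | h0
      · right
        rw [← h6, h0]
      · left
        rw [← h5 0 h0]
        congr 1
        ring
    · refine .inr (.inl ⟨by simp only [← add_assoc]; exact h5 k hk, ?_⟩)
      rcases Nat.lt_or_ge (k + 1) (n t) with h0 | h0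
      · left
        rw [← h5 _ h0]
        congr 1
        ring
      · right; right
        rw [← h6]
        congr 1
        omega

theorem framed_numbers : Framed (numbers n) := by
  refine ⟨.inr rfl, fun p => ?_⟩
  rcases numbers_cases n p with ⟨-, h1, h2⟩ | ⟨t, -, h1, h2 | h2⟩ | ⟨h1, h2 | h2 | h2⟩ | ⟨h1, h2⟩ |
    ⟨h1, h2 | h2⟩ <;> rw [h1, h2] <;> simp [sep, mark]

theorem occurs_numbers {i p : ℕ} : Occurs (numbers n) i p ↔ ∃ t, p = position n t ∧ n t = i := by
  rw [occurs_iff]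
  constructor
  · rintro ⟨h1, h2, h3⟩
    obtain ⟨t, rfl⟩ : ∃ t, p = position n t := by
      rcases numbers_cases n p with ⟨-, h, -⟩ | ⟨t, h, -⟩ | ⟨h, -⟩ | ⟨h, -⟩ | ⟨h, -⟩
      on_goal 2 => exact ⟨t, h⟩
      all_goals simp [h, sep, mark] at h1
    obtain ⟨-, h4, h5, -⟩ := numbers_at n t
    exact ⟨t, rfl, ticks_unique h4 (by simp [h5]) h2 (by simp [h3])⟩
  · rintro ⟨t, rfl, rfl⟩
    obtain ⟨h1, h2, h3, -⟩ := numbers_at n t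
    exact ⟨h1, h2, h3⟩

theorem no_unlink_numbers : ¬ ∃ p, ∃ b ∈ accepted unlinkFrag, At (numbers n) p b := by
  rintro ⟨p, b, hb, h⟩
  obtain ⟨i, q, x, rfl, hx⟩ := mem_unlinkFrag.1 hb
  rw [at_cons, at_append, at_cons, at_cons, at_append, at_singleton, at_replicate,
    List.length_replicate, List.length_replicate] at h
  obtain ⟨h1, h2, h3, h4, h5, h6⟩ := h
  obtain ⟨t, rfl, rfl⟩ := (occurs_numbers n).1 (occurs_iff.2 ⟨h1, h2, h3⟩)
  obtain ⟨-, -, -, -, h7⟩ := numbers_at n t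
  have h8 := (numbers_at n (t + 1)).1
  rcases hx with ⟨rfl, rfl⟩ | ⟨hq, hx⟩
  -- The copied ticks are followed by the `sep` of the next block, so the copy is not too long.
  · rw [position_succ, show position n t + 2 * n t + 3 =
      position n t + 1 + n t + 1 + 1 + n t by ring, h6] at h8
    simp [sep] at h8
  · exact hx (h6.symm.trans (h7 q hq))

theorem mem_omegaPower_numbers : numbers n ∈ omegaPower (accepted existsFrequentlyFrag) ↔
    ∃ i, ∃ᶠ t in atTop, n t = i := by
  rw [mem_omegaPower_existsFrequentlyFrag]
  simp only [framed_numbers, no_unlink_numbers, not_true_eq_false, false_or, numbers_zero, true_or,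
    and_true, occurs_numbers]
  refine exists_congr fun i => ?_
  rw [frequently_atTop]
  constructor
  · intro h N
    obtain ⟨_, hp, t, rfl, ht⟩ := h (position n N)
    exact ⟨t, (strictMono_position n).le_iff_le.1 hp, ht⟩
  · intro h N
    obtain ⟨t, ht, hi⟩ := h N
    exact ⟨_, ht.trans (strictMono_position n).le_apply, t, rfl, hi⟩

end

/-- An odd value is taken at most once and cannot recur; the value `2 * i` is taken exactly at the
pairs of `i` and `s` with `b i s`. -/
theorem exists_frequently_code {b : ℕ → ℕ → Prop} {n : ℕ → ℕ}
    (h1 : ∀ t, b t.unpair.1 t.unpair.2 → n t = 2 * t.unpair.1)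
    (h2 : ∀ t, ¬ b t.unpair.1 t.unpair.2 → n t = 2 * t + 1) :
    (∃ i, ∃ᶠ t in atTop, n t = i) ↔ ∃ i, ∃ᶠ s in atTop, b i s := by
  simp only [frequently_atTop]
  constructor
  · rintro ⟨i, h⟩
    refine ⟨i / 2, fun N => ?_⟩
    -- Beyond `i + 1` the value `i` is not of the form `2 * t + 1`; beyond the pair with `N` the
    -- second component is at least `N`, by monotonicity of pairing.
    obtain ⟨t, ht, rfl⟩ := h (max (i + 1) (Nat.pair (i / 2) N))
    have hb : b t.unpair.1 t.unpair.2 := by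
      by_contra hb
      have := h2 t hb
      have := le_of_max_le_left ht
      omega
    have h3 := h1 t hb
    have h4 : n t / 2 = t.unpair.1 := by omega
    rw [h4] at ht ⊢
    refine ⟨t.unpair.2, ?_, hb⟩
    by_contra hN
    have h5 := Nat.pair_lt_pair_right t.unpair.1 (not_le.1 hN)
    rw [Nat.pair_unpair] at h5
    exact absurd (le_of_max_le_right ht) (not_le.2 h5)
  · rintro ⟨i, h⟩
    refine ⟨2 * i, fun N => ?_⟩
    obtain ⟨s, hs, hb⟩ := h N
    refine ⟨Nat.pair i s, hs.trans (Nat.right_le_pair i s), ?_⟩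
    rw [h1 _ (by simpa using hb)]
    simp

/-- For fixed `i` infinitely many occurrences are a Π⁰₂ condition, and the start condition is
closed; the union over `i` gives Σ⁰₃. The reduction writes numbers in which recurrence codes the
normal form of `exists_exists_frequently`. -/
theorem isComplete_existsFrequently :
    IsComplete (Sigma0 3) (omegaPower (accepted (m := 2) existsFrequentlyFrag)) := by
  have hat : ∀ p (w : List (Sym (Fin 2))), IsClopen {σ | At σ p w} := fun p w =>
    (isLocallyConstant_seg p w.length).isClopen_fiber w
  refine ⟨?_, fun Y _ _ _ A hA => ?_⟩
  · have h : omegaPower (accepted existsFrequentlyFrag) = {σ | ¬ Framed σ} ∪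
        ((⋃ p, ⋃ b ∈ accepted unlinkFrag, {σ | At σ p b}) ∪
        ⋃ i, ((⋂ n, ⋃ p, ⋃ (_ : n ≤ p), {σ | Occurs σ i p}) ∩
          {σ | σ 0 = mark ∨ Starts σ i 0})) := by
      ext σ
      simp [mem_omegaPower_existsFrequentlyFrag]
    rw [h]
    refine union_mem_Sigma0 (Sigma0_mono le_rfl (by norm_num) isOpen_not_framed)
      (union_mem_Sigma0 (Sigma0_mono le_rfl (by norm_num) (mem_Sigma0_one.2 ?_))
        ⟨_, fun i => inter_mem_Pi0 ⟨_, fun n => mem_Sigma0_one.2 ?_, rfl⟩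
          (Pi0_mono le_rfl one_le_two (mem_Pi0_one.2 ?_)), rfl⟩)
    · exact isOpen_iUnion fun p => isOpen_biUnion fun b _ => isOpen_at p b
    · exact isOpen_iUnion fun p => isOpen_iUnion fun _ => isOpen_at p _
    · have h2 : {σ : ℕ → Sym (Fin 2) | σ 0 = mark ∨ Starts σ i 0} = {σ | σ 0 = mark} ∪
          ({σ | At σ 0 (hash :: List.replicate i tick)} ∩ {σ | σ (0 + 1 + i) ≠ tick}) := by
        ext σ
        simp [Starts, at_cons, at_replicate, and_assoc]
      rw [h2]
      exact (isClopen_apply 0 (· = mark)).isClosed.union ((hat _ _).isClosed.inter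
        (isClopen_apply _ (· ≠ tick)).isClosed)
  · classical
    obtain ⟨b, h1, h2⟩ := exists_exists_frequently hA
    let n : (ℕ → Y) → ℕ → ℕ := fun y t =>
      if b t.unpair.1 t.unpair.2 y then 2 * t.unpair.1 else 2 * t + 1
    have hn : ∀ t, IsLocallyConstant fun y => n y t := fun t =>
      (h1 t.unpair.1 t.unpair.2).comp fun P : Prop => if P then 2 * t.unpair.1 else 2 * t + 1
    refine ⟨fun y => numbers (n y), continuous_concat (fun y => numberBlock_ne_nil (n y))
      fun k => ?_, ?_⟩
    · cases k with
      | zero => exact IsLocallyConstant.const _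
      | succ k => exact (hn k).comp fun i =>
          sep :: (List.replicate i tick ++ dollar :: hash :: List.replicate i tick)
    · ext y
      rw [Set.mem_preimage, mem_omegaPower_numbers, h2]
      exact (exists_frequently_code (b := fun i s => b i s y) (fun t h => if_pos h)
        fun t h => if_neg h).symm

end Sym

end OmegaPower

/-! ### Iteration of the step over numerical alphabets, and the final families of automata. -/

namespace OmegaPower

open Frag

/-- The language over `Fin m` accepted by a fragment, for a pair of `m` and the fragment. -/
def lang (x : ℕ × Frag) : Language (Fin x.1) := {w | ∃ c', x.2.Sem 0 (w.map Fin.val) c'}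

theorem isComplete_map_Pi0 {S T : Type} [TopologicalSpace S] [TopologicalSpace T] {n : ℕ}
    {L : Language S} {M : Language T} (e : T ≃ₜ S) (h : ∀ w, w ∈ M ↔ w.map e ∈ L)
    (hL : IsComplete (Pi0 n) (omegaPower L)) : IsComplete (Pi0 n) (omegaPower M) :=
  hL.map (fun _ hf A => (preimage_borel hf n A).2) e fun _ => mem_omegaPower_map e.toEquiv h

theorem isComplete_map_Sigma0 {S T : Type} [TopologicalSpace S] [TopologicalSpace T] {n : ℕ}
    {L : Language S} {M : Language T} (e : T ≃ₜ S) (h : ∀ w, w ∈ M ↔ w.map e ∈ L)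
    (hL : IsComplete (Sigma0 n) (omegaPower L)) : IsComplete (Sigma0 n) (omegaPower M) :=
  hL.map (fun _ hf A => (preimage_borel hf n A).1) e fun _ => mem_omegaPower_map e.toEquiv h

namespace Sym

/-- The letters of a history alphabet as an initial segment of the numbers. -/
noncomputable def equivFin (m : ℕ) : Fin (m + 3) ≃ Sym (Fin m) :=
  (Equiv.ofBijective (fun x : Sym (Fin m) => (⟨code x, by
    rcases x with _ | _ | _ | a <;> simp [code]⟩ : Fin (m + 3)))
    ⟨fun x y h => code_injective (Fin.ext_iff.1 h), by
      rintro ⟨i, hi⟩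
      match i, hi with
      | 0, _ => exact ⟨hash, rfl⟩
      | 1, _ => exact ⟨tick, rfl⟩
      | 2, _ => exact ⟨dollar, rfl⟩
      | i + 3, hi => exact ⟨letter ⟨i, by omega⟩, rfl⟩⟩).symm

theorem code_equivFin {m : ℕ} (i : Fin (m + 3)) : code (equivFin m i) = i := by
  have h := (equivFin m).symm_apply_apply i
  exact congrArg Fin.val h

theorem mem_lang {m : ℕ} {F : Frag} (w : List (Fin (m + 3))) :
    w ∈ lang (m + 3, F) ↔ w.map (equivFin m) ∈ accepted (m := m) F := by
  change (∃ c', F.Sem 0 (w.map Fin.val) c') ↔ ∃ c', F.Sem 0 ((w.map (equivFin m)).map code) c'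
  rw [List.map_map]
  refine exists_congr fun c' => ?_
  rw [List.map_congr_left (g := code ∘ equivFin m) fun i _ => (code_equivFin i).symm]

/-- The step from one level to the next one. -/
def next (x : ℕ × Frag) : ℕ × Frag := (x.1 + 3, hist x.1 x.2)

theorem mem_lang_next {x : ℕ × Frag} (hx : x.2.WF) (w : List (Fin (x.1 + 3))) :
    w ∈ lang (next x) ↔ w.map (equivFin x.1) ∈ histLang (lang x) :=
  (mem_lang w).trans (rel_hist hx)

theorem wf_next {x : ℕ × Frag} (hx : x.2.WF) : (next x).2.WF := wf_hist hx

theorem isComplete_next_Pi0 {x : ℕ × Frag} (hx : x.2.WF) (h0 : 0 < x.1) {n : ℕ}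
    (h : IsComplete (Pi0 (n + 2)) (omegaPower (lang x))) :
    IsComplete (Pi0 (n + 3)) (omegaPower (lang (next x))) := by
  have : Nonempty (Fin x.1) := ⟨⟨0, h0⟩⟩
  exact isComplete_map_Pi0 (S := Sym (Fin x.1)) (T := Fin (x.1 + 3))
    (equivFin x.1).toHomeomorphOfDiscrete (mem_lang_next hx) (isComplete_histLang_Pi0 h)

theorem isComplete_next_Sigma0 {x : ℕ × Frag} (hx : x.2.WF) (h0 : 0 < x.1) {n : ℕ}
    (h : IsComplete (Sigma0 (n + 3)) (omegaPower (lang x))) :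
    IsComplete (Sigma0 (n + 4)) (omegaPower (lang (next x))) := by
  have : Nonempty (Fin x.1) := ⟨⟨0, h0⟩⟩
  exact isComplete_map_Sigma0 (S := Sym (Fin x.1)) (T := Fin (x.1 + 3))
    (equivFin x.1).toHomeomorphOfDiscrete (mem_lang_next hx) (isComplete_histLang_Sigma0 h)

/-- A nonempty alphabet is required at each step, because the hardness proof needs a letter for
headers and root. -/
theorem next_iterate {x : ℕ × Frag} (hx : x.2.WF) (h0 : 0 < x.1) (n : ℕ) :
    (next^[n] x).2.WF ∧ 0 < (next^[n] x).1 := by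
  induction n with
  | zero => exact ⟨hx, h0⟩
  | succ n ih =>
    rw [Function.iterate_succ_apply']
    exact ⟨wf_next ih.1, Nat.add_pos_left ih.2 3⟩

theorem isComplete_iterate_Pi0 {x : ℕ × Frag} (hx : x.2.WF) (h0 : 0 < x.1)
    (h : IsComplete (Pi0 2) (omegaPower (lang x))) (n : ℕ) :
    IsComplete (Pi0 (n + 2)) (omegaPower (lang (next^[n] x))) := by
  induction n with
  | zero => exact h
  | succ n ih =>
    rw [Function.iterate_succ_apply']
    exact isComplete_next_Pi0 (next_iterate hx h0 n).1 (next_iterate hx h0 n).2 ih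

theorem isComplete_iterate_Sigma0 {x : ℕ × Frag} (hx : x.2.WF) (h0 : 0 < x.1)
    (h : IsComplete (Sigma0 3) (omegaPower (lang x))) (n : ℕ) :
    IsComplete (Sigma0 (n + 3)) (omegaPower (lang (next^[n] x))) := by
  induction n with
  | zero => exact h
  | succ n ih =>
    rw [Function.iterate_succ_apply']
    exact isComplete_next_Sigma0 (next_iterate hx h0 n).1 (next_iterate hx h0 n).2 ih

theorem primrec_next : Primrec next :=
  (Primrec.nat_add.comp Primrec.fst (Primrec.const 3)).pair
    (primrec_hist Primrec.fst Primrec.snd)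

/-- The fragments for the multiplicative classes. -/
def piFrag (n : ℕ) : ℕ × Frag :=
  if n ≤ 1 then (5, keep [0]) else next^[n - 2] (5, Frag.seq (anyWord 2) (keep [0]))

/-- The fragments for the additive classes. -/
def sigmaFrag (n : ℕ) : ℕ × Frag :=
  if n ≤ 1 then (5, openFrag) else if n = 2 then (5, eventuallyFrag) else
    next^[n - 3] (5, existsFrequentlyFrag)

theorem primrec_piFrag : Primrec piFrag :=
  Primrec.ite (Primrec.nat_le.comp Primrec.id (Primrec.const 1)) (Primrec.const _)
    (Primrec.nat_iterate (Primrec.nat_sub.comp Primrec.id (Primrec.const 2)) (Primrec.const _)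
      (primrec_next.comp Primrec.snd).to₂)

theorem primrec_sigmaFrag : Primrec sigmaFrag :=
  Primrec.ite (Primrec.nat_le.comp Primrec.id (Primrec.const 1)) (Primrec.const _)
    (Primrec.ite (Primrec.eq.comp Primrec.id (Primrec.const 2)) (Primrec.const _)
      (Primrec.nat_iterate (Primrec.nat_sub.comp Primrec.id (Primrec.const 3)) (Primrec.const _)
        (primrec_next.comp Primrec.snd).to₂))

theorem piFrag_spec {n : ℕ} (hn : 1 ≤ n) :
    (piFrag n).2.WF ∧ IsComplete (Pi0 n) (omegaPower (lang (piFrag n))) := by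
  unfold piFrag
  split_ifs with h
  · obtain rfl : n = 1 := by omega
    exact ⟨wf_keep _, isComplete_map_Pi0 (equivFin 2).toHomeomorphOfDiscrete
      (mem_lang (m := 2)) isComplete_closed⟩
  · obtain ⟨k, rfl⟩ := Nat.exists_eq_add_of_le' (show 2 ≤ n by omega)
    have hw : (Frag.seq (anyWord 2) (keep [0])).WF := by simp
    exact ⟨(next_iterate hw (Nat.succ_pos 4) k).1, isComplete_iterate_Pi0 hw (Nat.succ_pos 4)
      (isComplete_map_Pi0 (equivFin 2).toHomeomorphOfDiscrete (mem_lang (m := 2))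
        isComplete_frequently) k⟩

/-- The step is available only from level `3` on, so the first two additive levels have languages of
their own. -/
theorem sigmaFrag_spec {n : ℕ} (hn : 1 ≤ n) :
    (sigmaFrag n).2.WF ∧ IsComplete (Sigma0 n) (omegaPower (lang (sigmaFrag n))) := by
  unfold sigmaFrag
  split_ifs with h h'
  · obtain rfl : n = 1 := by omega
    exact ⟨wf_openFrag, isComplete_map_Sigma0 (equivFin 2).toHomeomorphOfDiscrete
      (mem_lang (m := 2)) isComplete_open⟩
  · subst h'
    exact ⟨wf_eventuallyFrag, isComplete_map_Sigma0 (equivFin 2).toHomeomorphOfDiscrete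
      (mem_lang (m := 2)) isComplete_eventually⟩
  · obtain ⟨k, rfl⟩ := Nat.exists_eq_add_of_le' (show 3 ≤ n by omega)
    have hw := wf_existsFrequentlyFrag
    exact ⟨(next_iterate hw (Nat.succ_pos 4) k).1, isComplete_iterate_Sigma0 hw (Nat.succ_pos 4)
      (isComplete_map_Sigma0 (equivFin 2).toHomeomorphOfDiscrete (mem_lang (m := 2))
        isComplete_existsFrequently) k⟩

end Sym

theorem isOneCounter_automaton (c : OneCounterCode) : c.automaton.IsOneCounter := by
  rw [PDA.IsOneCounter, Nat.card_eq_fintype_card, Fintype.card_bool]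

end OmegaPower

theorem theorem3p9 :
    ∃ P S : ℕ → OmegaPower.OneCounterCode, Computable P ∧ Computable S ∧
      ∀ n : ℕ, 1 ≤ n →
        ((P n).automaton.IsOneCounter ∧
          OmegaPower.IsComplete (OmegaPower.Pi0 n)
            (OmegaPower.omegaPower (P n).automaton.language)) ∧
        ((S n).automaton.IsOneCounter ∧
          OmegaPower.IsComplete (OmegaPower.Sigma0 n)
            (OmegaPower.omegaPower (S n).automaton.language)) := by
  refine ⟨fun n => OmegaPower.Frag.toCode (OmegaPower.Sym.piFrag n),
    fun n => OmegaPower.Frag.toCode (OmegaPower.Sym.sigmaFrag n),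
    (OmegaPower.Frag.primrec_toCode.comp OmegaPower.Sym.primrec_piFrag).to_comp,
    (OmegaPower.Frag.primrec_toCode.comp OmegaPower.Sym.primrec_sigmaFrag).to_comp, fun n hn =>
    ⟨⟨OmegaPower.isOneCounter_automaton _, ?_⟩, OmegaPower.isOneCounter_automaton _, ?_⟩⟩
  · obtain ⟨h1, h2⟩ := OmegaPower.Sym.piFrag_spec hn
    rw [OmegaPower.Frag.language_toCode h1]
    exact h2
  · obtain ⟨h1, h2⟩ := OmegaPower.Sym.sigmaFrag_spec hn
    rw [OmegaPower.Frag.language_toCode h1]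
    exact h2
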